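/- Let $n\in\{2,3\}$, $k>0$, and let $D\subset\Omega\subset\mathbb{R}^n$ be bounded open sets with Lipschitz boundary (connectedness is not required); let $\nu$ be the outward unit normal to $\partial\Omega$, which exists at almost every point of $\partial\Omega$. Let $\eta\in L^\infty(\mathbb{R}^n;\mathbb{C})$ with $\eta=0$ almost everywhere in $\mathbb{R}^n\setminus\overline D$. For each $d\in\mathbb{S}^{n-1}$ let $u_{\rm sc}(\cdot,d)\in H^1_{\rm loc}(\mathbb{R}^n)$ be such that $u(x,d)=u_{\rm sc}(x,d)+e^{ikx\cdot d}$ is a weak solution of $$\Delta u+k^2(1+\eta)u=0\quad\text{in }\mathbb{R}^n,$$ and $u_{\rm sc}$ satisfies the Sommerfeld radiation condition $\lim_{r\to\infty}r^{(n-1)/2}(\partial u_{\rm sc}/\partial r-iku_{\rm sc})=0$, $r=|x|$, uniformly in $x/|x|$. Let $$\Phi(x,y)=\begin{cases}\frac{i}{4}H^{(1)}_0(k|x-y|), & n=2,\\[2pt] \frac{e^{ik|x-y|}}{4\pi|x-y|}, & n=3,\end{cases}\qquad x\neq y,$$ and for $z\in\mathbb{R}^n$ define $$I_2(z)=\int_{\mathbb{S}^{n-1}}\left|\int_{\partial\Omega}\left(\frac{\partial\,\mathrm{Im}\,\Phi(x,z)}{\partial\nu(x)}u_{\rm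 sc}(x,d)-\mathrm{Im}\,\Phi(x,z)\frac{\partial u_{\rm sc}(x,d)}{\partial\nu(x)}\right)ds(x)\right|^2ds(d).$$ Then each $u_{\rm sc}(\cdot,d)$ has a $C^1$ representative (whose Cauchy data on $\partial\Omega$ are used in $I_2$), the integral over $\partial\Omega$ above and the integral over $D$ below exist, and for every $z\in\mathbb{R}^n$ $$I_2(z)=\int_{\mathbb{S}^{n-1}}\left|k^2\int_D\mathrm{Im}\,\Phi(y,z)\,\eta(y)\,u(y,d)\,dy\right|^2ds(d),$$ where the two outer integrals are integrals of nonnegative functions with values in $[0,\infty]$. Moreover, for $y\ne z$, $$\mathrm{Im}\,\Phi(y,z)=\begin{cases}\frac14J_0(k|z-y|), & n=2,\\[2pt] \frac{k}{4\pi}j_0(k|z-y|), & n=3,\end{cases}$$ where $j_0(t)=\sin t/t$. -/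

import Mathlib

open MeasureTheory Filter Topology
open scoped ContDiff

noncomputable section

namespace Scattering

/-! ### Special functions of order zero -/

/-- Bessel function of the first kind `J₀(t) = ∑ (-1)^m (t/2)^(2m) / (m!)²`. -/
def besselJ0 (t : ℝ) : ℝ :=
  ∑' m : ℕ, (-1 : ℝ) ^ m * (t / 2) ^ (2 * m) / (m.factorial : ℝ) ^ 2

/-- Bessel function of the second kind, for `t > 0`:
`Y₀(t) = (2/π) (log(t/2) + γ) J₀(t) - (2/π) ∑ (-1)^m H_m (t/2)^(2m) / (m!)²`,
with `γ` Euler's constant and `H_m` the harmonic numbers. -/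
def besselY0 (t : ℝ) : ℝ :=
  2 / Real.pi * (Real.log (t / 2) + Real.eulerMascheroniConstant) * besselJ0 t
    - 2 / Real.pi *
      ∑' m : ℕ, (-1 : ℝ) ^ m * (harmonic m : ℝ) * (t / 2) ^ (2 * m) / (m.factorial : ℝ) ^ 2

/-- Hankel function of the first kind `H₀⁽¹⁾ = J₀ + i Y₀`. -/
def hankel0 (t : ℝ) : ℂ := (besselJ0 t : ℂ) + Complex.I * (besselY0 t : ℂ)

/-- Radiating fundamental solution of the Helmholtz equation `Δ + k²` in dimensions 2 and 3,
meaningful for `x ≠ y` (other dimensions get the dummy value `0`). -/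
def green {n : ℕ} (k : ℝ) (x y : EuclideanSpace ℝ (Fin n)) : ℂ :=
  if n = 2 then Complex.I / 4 * hankel0 (k * ‖x - y‖)
  else if n = 3 then
    Complex.exp (Complex.I * (k : ℂ) * (‖x - y‖ : ℂ)) / (4 * (Real.pi : ℂ) * (‖x - y‖ : ℂ))
  else 0

/-! ### Domains, surface measure, normal vector -/

/-- `D` is a bounded open set with Lipschitz boundary: near each boundary point, and in suitable
orthonormal coordinates with last axis `e`, `D` is the region below the graph of a Lipschitz
function (of the component `x - ⟪e, x⟫ e` of `x` orthogonal to `e`). -/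
structure IsBoundedLipschitz {n : ℕ} (D : Set (EuclideanSpace ℝ (Fin n))) : Prop where
  isOpen : IsOpen D
  isBounded : Bornology.IsBounded D
  graph : ∀ p ∈ frontier D, ∃ (e : EuclideanSpace ℝ (Fin n)) (r : ℝ) (K : NNReal)
    (γ : EuclideanSpace ℝ (Fin n) → ℝ), ‖e‖ = 1 ∧ 0 < r ∧ LipschitzWith K γ ∧
      ∀ x ∈ Metric.ball p r, (x ∈ D ↔ inner ℝ e x < γ (x - inner ℝ e x • e))

/-- Surface measure on `∂Ω`: the `(n-1)`-dimensional Hausdorff measure, normalized to agree with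
`(n-1)`-dimensional Lebesgue measure on hyperplanes. -/
def surfaceMeasure {n : ℕ} (Ω : Set (EuclideanSpace ℝ (Fin n))) :
    Measure (EuclideanSpace ℝ (Fin n)) :=
  (Measure.euclideanHausdorffMeasure (n - 1)).restrict (frontier Ω)

/-- The unit vector `ν` is the outward normal to `∂Ω` at `x`: near `x`, every cone around `-ν` of
opening less than a right angle lies in `Ω`, and every such cone around `ν` lies outside `Ω`. -/
def IsOutwardNormal {n : ℕ} (Ω : Set (EuclideanSpace ℝ (Fin n)))
    (x ν : EuclideanSpace ℝ (Fin n)) : Prop :=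
  ‖ν‖ = 1 ∧ ∀ ε : ℝ, 0 < ε → ∀ᶠ y in 𝓝 x,
    (inner ℝ ν (y - x) < -ε * ‖y - x‖ → y ∈ Ω) ∧ (ε * ‖y - x‖ < inner ℝ ν (y - x) → y ∉ Ω)

open Classical in
/-- The outward unit normal at `x`. It exists at almost every boundary point of a Lipschitz
domain; where there is none the value is `0`. -/
def outwardNormal {n : ℕ} (Ω : Set (EuclideanSpace ℝ (Fin n)))
    (x : EuclideanSpace ℝ (Fin n)) : EuclideanSpace ℝ (Fin n) :=
  if h : ∃ ν, IsOutwardNormal Ω x ν then h.choose else 0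

/-- The normal derivative `∂f/∂ν` at a point `x` of `∂Ω`. -/
def normalDeriv {n : ℕ} {F : Type*} [NormedAddCommGroup F] [NormedSpace ℝ F]
    (Ω : Set (EuclideanSpace ℝ (Fin n))) (f : EuclideanSpace ℝ (Fin n) → F)
    (x : EuclideanSpace ℝ (Fin n)) : F :=
  fderiv ℝ f x (outwardNormal Ω x)

/-! ### The scattering problem -/

/-- `f ∈ L²_loc(ℝⁿ)`. -/
def MemL2Loc {n : ℕ} (f : EuclideanSpace ℝ (Fin n) → ℂ) : Prop :=
  ∀ K : Set (EuclideanSpace ℝ (Fin n)), IsCompact K → MemLp f 2 (volume.restrict K)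

/-- The partial derivative `∂φ/∂xᵢ` at `x`. -/
def partialDeriv {n : ℕ} (i : Fin n) (φ : EuclideanSpace ℝ (Fin n) → ℝ)
    (x : EuclideanSpace ℝ (Fin n)) : ℝ :=
  fderiv ℝ φ x (EuclideanSpace.single i 1)

/-- `G i` is the weak partial derivative `∂ᵢ u` for every `i`. -/
def IsWeakGradient {n : ℕ} (u : EuclideanSpace ℝ (Fin n) → ℂ)
    (G : Fin n → EuclideanSpace ℝ (Fin n) → ℂ) : Prop :=
  ∀ (i : Fin n) (φ : EuclideanSpace ℝ (Fin n) → ℝ), ContDiff ℝ ∞ φ → HasCompactSupport φ →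
    ∫ x, (partialDeriv i φ x : ℂ) * u x = -∫ x, (φ x : ℂ) * G i x

/-- `u ∈ H¹_loc(ℝⁿ)` is a weak solution of `Δu + k²(1+η)u = 0` in `ℝⁿ`. -/
def IsWeakHelmholtzSolution {n : ℕ} (k : ℝ) (η u : EuclideanSpace ℝ (Fin n) → ℂ) : Prop :=
  MemL2Loc u ∧ ∃ G : Fin n → EuclideanSpace ℝ (Fin n) → ℂ,
    (∀ i, MemL2Loc (G i)) ∧ IsWeakGradient u G ∧
    ∀ φ : EuclideanSpace ℝ (Fin n) → ℝ, ContDiff ℝ ∞ φ → HasCompactSupport φ →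
      ∫ x, ∑ i, G i x * (partialDeriv i φ x : ℂ)
        = ∫ x, (k : ℂ) ^ 2 * (1 + η x) * u x * (φ x : ℂ)

/-- The representative of a locally integrable function given by the limits of its averages over
shrinking balls. If `f` agrees almost everywhere with a continuous function, then this is that
continuous function. -/
def rep {n : ℕ} (f : EuclideanSpace ℝ (Fin n) → ℂ) (x : EuclideanSpace ℝ (Fin n)) : ℂ :=
  limUnder (𝓝[>] (0 : ℝ)) fun r => ⨍ y in Metric.ball x r, f y

/-- The Sommerfeld radiation condition `r^((n-1)/2) (∂v/∂r - ikv) → 0` as `r = |x| → ∞`,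
uniformly in `x/|x|`. -/
def IsRadiating {n : ℕ} (k : ℝ) (v : EuclideanSpace ℝ (Fin n) → ℂ) : Prop :=
  Tendsto (fun x => ((‖x‖ ^ (((n : ℝ) - 1) / 2) : ℝ) : ℂ) *
    (fderiv ℝ v x (‖x‖⁻¹ • x) - Complex.I * (k : ℂ) * v x))
    (Bornology.cobounded (EuclideanSpace ℝ (Fin n))) (𝓝 0)

/-- The plane wave `e^{ik x·d}`. -/
def planeWave {n : ℕ} (k : ℝ) (d x : EuclideanSpace ℝ (Fin n)) : ℂ :=
  Complex.exp (Complex.I * (k : ℂ) * (inner ℝ x d : ℝ))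

/-- The total field `u = u_sc + u_in`, with incident plane wave of direction `d`. -/
def totalField {n : ℕ} (k : ℝ) (d : EuclideanSpace ℝ (Fin n))
    (usc : EuclideanSpace ℝ (Fin n) → ℂ) (x : EuclideanSpace ℝ (Fin n)) : ℂ :=
  usc x + planeWave k d x

/-- `usc` is a scattered field for the plane wave of direction `d`: the total field is a weak
solution of class `H¹_loc` (equivalently `usc` is of this class, since plane waves are smooth), and
`usc` is radiating. -/
structure IsScatteredField {n : ℕ} (k : ℝ) (η : EuclideanSpace ℝ (Fin n) → ℂ)
    (d : EuclideanSpace ℝ (Fin n)) (usc : EuclideanSpace ℝ (Fin n) → ℂ) : Prop where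
  weakSolution : IsWeakHelmholtzSolution k η (totalField k d usc)
  radiating : IsRadiating k (rep usc)

/-! ### The imaging functional -/

/-- The integrand over `∂Ω` of the imaging functional, for one incident direction:
`∂ν Im Φ(x,z) v(x) - Im Φ(x,z) ∂ν v(x)`, with Cauchy data `v`, `∂ν v` on `∂Ω`. -/
def boundaryIntegrand {n : ℕ} (k : ℝ) (Ω : Set (EuclideanSpace ℝ (Fin n)))
    (v : EuclideanSpace ℝ (Fin n) → ℂ) (z x : EuclideanSpace ℝ (Fin n)) : ℂ :=
  (normalDeriv Ω (fun x' => (green k x' z).im) x : ℂ) * v x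
    - ((green k x z).im : ℂ) * normalDeriv Ω v x

/-- The imaging functional `I₂(z)`, as the integral of a nonnegative function with respect to the
surface measure of the unit sphere of incident directions. The Cauchy data on `∂Ω` are those of the
continuous representative of the scattered field. -/
def imagingI2 {n : ℕ} (k : ℝ) (Ω : Set (EuclideanSpace ℝ (Fin n)))
    (usc : Metric.sphere (0 : EuclideanSpace ℝ (Fin n)) 1 → EuclideanSpace ℝ (Fin n) → ℂ)
    (z : EuclideanSpace ℝ (Fin n)) : ENNReal :=
  ∫⁻ d, ‖∫ x, boundaryIntegrand k Ω (rep (usc d)) z x ∂(surfaceMeasure Ω)‖ₑ ^ 2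
    ∂(volume : Measure (EuclideanSpace ℝ (Fin n))).toSphere

end Scattering

end

open Scattering

/-!
The function `w = Im Φ(·, z)` extends to an entire radial solution of `Δw + k²w = 0`, and each
`v = u_sc(·, d)` solves `Δv + k²v = -k²ηu` in the sense of distributions. By interior regularity
`v` is `C¹`: if the mollification kernel is chosen such that its derivative in the scale is a
Laplacian, then the mollifications of `v` vary with the scale by averages of `Δv ∈ L^∞_loc`, which
makes them converge in `C¹` in dimension at most three. Hence `v ∇w - w ∇v` is a continuous field
with weak divergence `k²wηu`, and the divergence theorem on `Ω` gives the inner integral, since `η`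
vanishes off `D`.

The divergence theorem on a Lipschitz domain reduces by a partition of unity to the region below a
Lipschitz graph. There a shear turns the derivative across the graph into one along vertical lines,
and the area formula identifies the boundary term with an integral over the graph. Mollification
extends the theorem from `C¹` fields to continuous fields with bounded weak divergence.
-/

noncomputable section

open MeasureTheory Filter Topology Module
open scoped ContDiff NNReal ENNReal

namespace Scattering

/-! ### The area formula -/

section AreaFormula

lemma euclideanHausdorffMeasure_image_le_of_dist_le {X Y Z : Type*}
    [MetricSpace Y] [MeasurableSpace Y] [BorelSpace Y]
    [MetricSpace Z] [MeasurableSpace Z] [BorelSpace Z]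
    {f : X → Y} {g : X → Z} {A : Set X} {K : ℝ≥0} (m : ℕ)
    (hfg : ∀ x ∈ A, ∀ y ∈ A, dist (f x) (f y) ≤ K * dist (g x) (g y)) :
    μHE[m] (f '' A) ≤ (K : ℝ≥0∞) ^ m * μHE[m] (g '' A) := by
  rcases A.eq_empty_or_nonempty with rfl | ⟨a, -⟩
  · simp
  have : Nonempty X := ⟨a⟩
  let q : Z → X := Function.invFunOn g A
  have hq : ∀ x ∈ A, q (g x) ∈ A ∧ g (q (g x)) = g x := fun x hx =>
    ⟨Function.invFunOn_mem ⟨x, hx, rfl⟩, Function.invFunOn_eq ⟨x, hx, rfl⟩⟩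
  have hlip : LipschitzOnWith K (f ∘ q) (g '' A) := by
    refine LipschitzOnWith.of_dist_le_mul ?_
    rintro _ ⟨x, hx, rfl⟩ _ ⟨y, hy, rfl⟩
    simpa only [Function.comp_apply, (hq x hx).2, (hq y hy).2] using
      hfg _ (hq x hx).1 _ (hq y hy).1
  have himage : f '' A ⊆ (f ∘ q) '' (g '' A) := by
    rintro _ ⟨x, hx, rfl⟩
    refine ⟨g x, ⟨x, hx, rfl⟩, dist_le_zero.1 ?_⟩
    simpa only [Function.comp_apply, (hq x hx).2, dist_self, mul_zero] using
      hfg _ (hq x hx).1 _ hx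
  simp only [Measure.euclideanHausdorffMeasure_def, Measure.smul_apply, ENNReal.smul_def,
    smul_eq_mul]
  rw [mul_left_comm]
  gcongr
  simpa only [ENNReal.rpow_natCast] using
    (measure_mono himage).trans (hlip.hausdorffMeasure_image_le (d := m) (by positivity))

lemma measure_image_eq_tsum_of_cover {X Y : Type*} [TopologicalSpace X] [PolishSpace X]
    [MeasurableSpace X] [BorelSpace X] [TopologicalSpace Y] [T2Space Y] [MeasurableSpace Y]
    [OpensMeasurableSpace Y] {μ : Measure Y} {G : X → Y} {s : Set X} {t : ℕ → Set X}
    (hs : MeasurableSet s) (hG : ContinuousOn G s) (hinj : Set.InjOn G s)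
    (ht : ∀ j, MeasurableSet (t j)) (hdisj : Pairwise (Function.onFun Disjoint t))
    (hcover : s ⊆ ⋃ j, t j) : μ (G '' s) = ∑' j, μ (G '' (s ∩ t j)) := by
  conv_lhs => rw [← Set.inter_eq_left.2 hcover, Set.inter_iUnion, Set.image_iUnion]
  refine measure_iUnion (fun i j hij => ?_) fun j => ?_
  · exact ((hdisj hij).mono Set.inter_subset_right Set.inter_subset_right).image hinj
      Set.inter_subset_left Set.inter_subset_left
  · exact (hs.inter (ht j)).image_of_continuousOn_injOn (hG.mono Set.inter_subset_left)
      (hinj.mono Set.inter_subset_left)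

variable {U V : Type*} [NormedAddCommGroup U] [InnerProductSpace ℝ U] [FiniteDimensional ℝ U]
  [MeasurableSpace U] [BorelSpace U] [NormedAddCommGroup V] [InnerProductSpace ℝ V]
  [MeasurableSpace V] [BorelSpace V]

lemma normDet_le_of_norm_le {L L' : U →ₗ[ℝ] V} {K : ℝ≥0} (h : ∀ v, ‖L v‖ ≤ K * ‖L' v‖) :
    ENNReal.ofReal L.normDet ≤ (K : ℝ≥0∞) ^ finrank ℝ U * ENNReal.ofReal L'.normDet := by
  have hball := euclideanHausdorffMeasure_image_le_of_dist_le (f := L) (g := L')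
    (A := Metric.ball (0 : U) 1) (K := K) (finrank ℝ U) fun x _ y _ => by
      simpa only [dist_eq_norm, ← map_sub] using h (x - y)
  rw [LinearMap.euclideanHausdorffMeasure_image_eq_normDet_mul_volume,
    LinearMap.euclideanHausdorffMeasure_image_eq_normDet_mul_volume, ← mul_assoc] at hball
  exact (ENNReal.mul_le_mul_iff_left (Metric.measure_ball_pos volume _ one_pos).ne'
    measure_ball_lt_top.ne).1 hball

lemma norm_le_mul_of_norm_sub_le {W : Type*} [SeminormedAddCommGroup W] {a b : W} {K : ℝ≥0}
    (hK : 1 ≤ K) (hab : ‖a - b‖ ≤ (1 - (K : ℝ)⁻¹) * ‖b‖) :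
    ‖a‖ ≤ K * ‖b‖ ∧ ‖b‖ ≤ K * ‖a‖ := by
  have hK' : (1 : ℝ) ≤ K := by exact_mod_cast hK
  have hcancel : (K : ℝ) * (K : ℝ)⁻¹ = 1 := mul_inv_cancel₀ (by positivity)
  constructor
  · have hfactor : 2 - (K : ℝ)⁻¹ ≤ K := by
      nlinarith [sq_nonneg ((K : ℝ) - 1), inv_nonneg.2 (zero_le_one.trans hK')]
    nlinarith [norm_sub_norm_le a b, norm_nonneg b]
  · have hlower : (K : ℝ)⁻¹ * ‖b‖ ≤ ‖a‖ := by
      linarith [norm_sub_rev a b ▸ norm_sub_norm_le b a]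
    calc ‖b‖ = K * ((K : ℝ)⁻¹ * ‖b‖) := by rw [← mul_assoc, hcancel, one_mul]
      _ ≤ K * ‖a‖ := by gcongr

/-- The area formula for `G` on `s` holds up to the factor `C`: the Hausdorff measure of `G '' s`
and the integral over `s` of the Jacobian of `G` (computed from the derivative `G'`) bound each
other up to that factor. -/
def AreaComparable (C : ℝ≥0∞) (G : U → V) (G' : U → U →L[ℝ] V) (s : Set U) : Prop :=
  μHE[finrank ℝ U] (G '' s) ≤ C * ∫⁻ y in s, ENNReal.ofReal (G' y).normDet ∧
    ∫⁻ y in s, ENNReal.ofReal (G' y).normDet ≤ C * μHE[finrank ℝ U] (G '' s)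

variable {C : ℝ≥0∞} {G : U → V} {G' : U → U →L[ℝ] V} {s : Set U} {K c : ℝ≥0}

lemma AreaComparable.of_cover {t : ℕ → Set U} (hs : MeasurableSet s) (hG : ContinuousOn G s)
    (hinj : Set.InjOn G s) (ht : ∀ j, MeasurableSet (t j))
    (hdisj : Pairwise (Function.onFun Disjoint t)) (hcover : s ⊆ ⋃ j, t j)
    (hpiece : ∀ j, AreaComparable C G G' (s ∩ t j)) : AreaComparable C G G' s := by
  have hintegral : ∫⁻ y in s, ENNReal.ofReal (G' y).normDet =
      ∑' j, ∫⁻ y in s ∩ t j, ENNReal.ofReal (G' y).normDet := by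
    conv_lhs => rw [← Set.inter_eq_left.2 hcover, Set.inter_iUnion]
    exact lintegral_iUnion (fun j => hs.inter (ht j)) (fun i j hij =>
      (hdisj hij).mono Set.inter_subset_right Set.inter_subset_right) _
  rw [AreaComparable, hintegral, measure_image_eq_tsum_of_cover hs hG hinj ht hdisj hcover,
    ← ENNReal.tsum_mul_left, ← ENNReal.tsum_mul_left]
  exact ⟨ENNReal.tsum_le_tsum fun j => (hpiece j).1, ENNReal.tsum_le_tsum fun j => (hpiece j).2⟩

lemma AreaComparable.of_norm_le {L : U →L[ℝ] V} (hs : MeasurableSet s)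
    (hGL : ∀ x ∈ s, ∀ y ∈ s,
      ‖G x - G y‖ ≤ K * ‖L (x - y)‖ ∧ ‖L (x - y)‖ ≤ K * ‖G x - G y‖)
    (hG'L : ∀ y ∈ s, ∀ v, ‖G' y v‖ ≤ K * ‖L v‖ ∧ ‖L v‖ ≤ K * ‖G' y v‖) :
    AreaComparable ((K : ℝ≥0∞) ^ (2 * finrank ℝ U)) G G' s := by
  set m := finrank ℝ U
  have hLs : μHE[m] (L '' s) = ENNReal.ofReal L.normDet * volume s :=
    LinearMap.euclideanHausdorffMeasure_image_eq_normDet_mul_volume (L : U →ₗ[ℝ] V) s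
  have hGs_le : μHE[m] (G '' s) ≤ (K : ℝ≥0∞) ^ m * μHE[m] (L '' s) :=
    euclideanHausdorffMeasure_image_le_of_dist_le m fun x hx y hy => by
      simpa only [dist_eq_norm, ← map_sub] using (hGL x hx y hy).1
  have hLs_le : μHE[m] (L '' s) ≤ (K : ℝ≥0∞) ^ m * μHE[m] (G '' s) :=
    euclideanHausdorffMeasure_image_le_of_dist_le m fun x hx y hy => by
      simpa only [dist_eq_norm, ← map_sub] using (hGL x hx y hy).2
  rw [AreaComparable, two_mul, pow_add, mul_assoc, mul_assoc]
  constructor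
  · refine hGs_le.trans (mul_le_mul_right ?_ _)
    rw [hLs, ← lintegral_const_mul' _ _ (by simp), ← setLIntegral_const]
    exact setLIntegral_mono' hs fun y hy => normDet_le_of_norm_le fun v => (hG'L y hy v).2
  · calc ∫⁻ y in s, ENNReal.ofReal (G' y).normDet
        ≤ ∫⁻ _ in s, (K : ℝ≥0∞) ^ m * ENNReal.ofReal L.normDet :=
          setLIntegral_mono' hs fun y hy => normDet_le_of_norm_le fun v => (hG'L y hy v).1
      _ = (K : ℝ≥0∞) ^ m * μHE[m] (L '' s) := by rw [setLIntegral_const, hLs, mul_assoc]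
      _ ≤ (K : ℝ≥0∞) ^ m * ((K : ℝ≥0∞) ^ m * μHE[m] (G '' s)) := by gcongr

lemma AreaComparable.of_oscillation_le [FiniteDimensional ℝ V] (hs : MeasurableSet s)
    (hG : ∀ y ∈ s, HasFDerivAt G (G' y) y) (hinj : Set.InjOn G s)
    (hexp : ∀ y ∈ s, ∀ v, ‖v‖ ≤ c * ‖G' y v‖) (hK : 1 < K) {δ : ℝ≥0} (hδ : 0 < δ)
    (hδK : δ * c ≤ 1 - K⁻¹) (hosc : ∀ y ∈ s, ∀ y' ∈ s, ‖G' y - G' y'‖ ≤ δ) :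
    AreaComparable ((K : ℝ≥0∞) ^ (2 * finrank ℝ U)) G G' s := by
  rcases s.eq_empty_or_nonempty with rfl | hne
  · simp [AreaComparable]
  obtain ⟨t, L, hdisj, ht, hcover, happrox, hL⟩ :=
    exists_partition_approximatesLinearOn_of_hasFDerivWithinAt G s G'
      (fun y hy => (hG y hy).hasFDerivWithinAt) (fun _ => δ) fun _ => hδ.ne'
  refine .of_cover hs (fun _ hy => (hG _ hy).continuousAt.continuousWithinAt) hinj ht hdisj
    hcover fun j => ?_
  obtain ⟨y₀, hy₀, hLj⟩ := hL hne j
  have hclose : ∀ a v, ‖a - L j v‖ ≤ δ * ‖v‖ → ‖a‖ ≤ K * ‖L j v‖ ∧ ‖L j v‖ ≤ K * ‖a‖ := by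
    refine fun a v hav => norm_le_mul_of_norm_sub_le hK.le ?_
    have hδK' : (δ : ℝ) * c ≤ 1 - (K : ℝ)⁻¹ := by
      rw [← NNReal.coe_inv, ← NNReal.coe_one, ← NNReal.coe_sub (inv_le_one_of_one_le₀ hK.le)]
      exact_mod_cast hδK
    calc ‖a - L j v‖ ≤ δ * (c * ‖L j v‖) := hav.trans (by gcongr; exact hLj ▸ hexp y₀ hy₀ v)
      _ ≤ (1 - (K : ℝ)⁻¹) * ‖L j v‖ := by rw [← mul_assoc]; gcongr
  refine .of_norm_le (hs.inter (ht j)) (L := L j)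
    (fun x hx y hy => hclose _ _ (happrox j x hx y hy)) fun y hy v => hclose _ _ ?_
  rw [← sub_apply, hLj]
  exact ((G' y - G' y₀).le_opNorm v).trans (by gcongr; exact hosc y hy.1 y₀ hy₀)

lemma exists_measurable_partition_dist_lt {X Y : Type*} [MeasurableSpace X] [PseudoMetricSpace Y]
    [TopologicalSpace.SeparableSpace Y] [Nonempty Y] [MeasurableSpace Y] [OpensMeasurableSpace Y]
    {f : X → Y} (hf : Measurable f) {ε : ℝ} (hε : 0 < ε) :
    ∃ t : ℕ → Set X, (∀ j, MeasurableSet (t j)) ∧ Pairwise (Function.onFun Disjoint t) ∧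
      ⋃ j, t j = Set.univ ∧ ∀ j, ∀ x ∈ t j, ∀ y ∈ t j, dist (f x) (f y) < ε := by
  let b : ℕ → Set X := fun j => f ⁻¹' Metric.ball (TopologicalSpace.denseSeq Y j) (ε / 2)
  have hb : ⋃ j, b j = Set.univ := by
    refine Set.eq_univ_of_forall fun x => Set.mem_iUnion.2 ?_
    exact (TopologicalSpace.denseRange_denseSeq Y).exists_dist_lt (f x) (half_pos hε)
  refine ⟨disjointed b, .disjointed fun j => hf Metric.isOpen_ball.measurableSet,
    disjoint_disjointed b, by rw [iUnion_disjointed, hb], fun j x hx y hy => ?_⟩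
  have hxb : dist (f x) _ < ε / 2 := disjointed_subset b j hx
  have hyb : dist (f y) _ < ε / 2 := disjointed_subset b j hy
  linarith [dist_triangle_right (f x) (f y) (TopologicalSpace.denseSeq Y j)]

theorem euclideanHausdorffMeasure_image_eq_lintegral_normDet [FiniteDimensional ℝ V]
    (hs : MeasurableSet s) (hG : ∀ y ∈ s, HasFDerivAt G (G' y) y) (hinj : Set.InjOn G s)
    (hexp : ∀ y ∈ s, ∀ v, ‖v‖ ≤ c * ‖G' y v‖) (hG' : Measurable G') :
    μHE[finrank ℝ U] (G '' s) = ∫⁻ y in s, ENNReal.ofReal (G' y).normDet := by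
  have hcomparable : ∀ K : ℝ≥0, 1 < K →
      AreaComparable ((K : ℝ≥0∞) ^ (2 * finrank ℝ U)) G G' s := by
    intro K hK
    have hgap : 0 < 1 - K⁻¹ := tsub_pos_of_lt (inv_lt_one_of_one_lt₀ hK)
    set δ := (1 - K⁻¹) / (c + 1)
    have hδ : 0 < δ := by positivity
    obtain ⟨t, ht, hdisj, hcover, hosc⟩ := exists_measurable_partition_dist_lt hG' (ε := δ) hδ
    refine .of_cover hs (fun y hy => (hG y hy).continuousAt.continuousWithinAt) hinj ht hdisj
      (hcover ▸ Set.subset_univ s) fun j => ?_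
    refine .of_oscillation_le (hs.inter (ht j)) (fun y hy => hG y hy.1)
      (hinj.mono Set.inter_subset_left) (fun y hy => hexp y hy.1) hK hδ ?_
      fun y hy y' hy' => dist_eq_norm (G' y) (G' y') ▸ (hosc j y hy.2 y' hy'.2).le
    calc δ * c ≤ δ * (c + 1) := by gcongr; exact le_self_add
      _ = 1 - K⁻¹ := div_mul_cancel₀ _ (by positivity)
  have hlim : ∀ a : ℝ≥0∞,
      Tendsto (fun K : ℝ≥0 => (K : ℝ≥0∞) ^ (2 * finrank ℝ U) * a) (𝓝[>] 1) (𝓝 a) := by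
    intro a
    have hpow : Continuous fun K : ℝ≥0 => (K : ℝ≥0∞) ^ (2 * finrank ℝ U) := by fun_prop
    simpa using ENNReal.Tendsto.mul_const (b := a)
      ((hpow.tendsto 1).mono_left nhdsWithin_le_nhds) (Or.inl (by simp))
  have hevent : ∀ᶠ K : ℝ≥0 in 𝓝[>] 1, 1 < K := self_mem_nhdsWithin
  exact le_antisymm (ge_of_tendsto (hlim _) (hevent.mono fun K hK => (hcomparable K hK).1))
    (ge_of_tendsto (hlim _) (hevent.mono fun K hK => (hcomparable K hK).2))

end AreaFormula

/-! ### Lipschitz graphs over a hyperplane -/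

section Hyperplane

variable {E : Type*} [NormedAddCommGroup E] [InnerProductSpace ℝ E] {e : E}

/-- The hyperplane orthogonal to `e`. -/
abbrev hyperplane (e : E) : Submodule ℝ E := (ℝ ∙ e)ᗮ

/-- The orthogonal projection onto the hyperplane orthogonal to `e`. -/
def toHyperplane (e : E) : E →L[ℝ] hyperplane e := (hyperplane e).orthogonalProjectionOnto

lemma inner_coe_hyperplane (y : hyperplane e) : inner ℝ e (y : E) = 0 :=
  Submodule.mem_orthogonal_singleton_iff_inner_right.1 y.2

lemma norm_toHyperplane_le (x : E) : ‖toHyperplane e x‖ ≤ ‖x‖ :=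
  Submodule.norm_orthogonalProjectionOnto_apply_le _ _

lemma coe_toHyperplane (he : ‖e‖ = 1) (x : E) :
    (toHyperplane e x : E) = x - inner ℝ e x • e := by
  have h := Submodule.starProjection_orthogonal_val (K := ℝ ∙ e) x
  rwa [Submodule.starProjection_unit_singleton ℝ he] at h

lemma coe_toHyperplane_add_inner_smul (he : ‖e‖ = 1) (x : E) :
    (toHyperplane e x : E) + inner ℝ e x • e = x := by
  rw [coe_toHyperplane he, sub_add_cancel]

lemma toHyperplane_coe_add_smul (y : hyperplane e) (t : ℝ) :
    toHyperplane e ((y : E) + t • e) = y := by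
  rw [toHyperplane, map_add, map_smul,
    Submodule.orthogonalProjectionOnto_orthogonalComplement_singleton_eq_zero]
  simp

lemma inner_coe_add_smul (he : ‖e‖ = 1) (y : hyperplane e) (t : ℝ) :
    inner ℝ e ((y : E) + t • e) = t := by
  simp [inner_add_right, inner_coe_hyperplane, inner_smul_right, he]

lemma norm_coe_add_smul_sq (he : ‖e‖ = 1) (y : hyperplane e) (t : ℝ) :
    ‖(y : E) + t • e‖ ^ 2 = ‖y‖ ^ 2 + t ^ 2 := by
  simp [norm_add_sq_real, inner_smul_right, real_inner_comm, inner_coe_hyperplane, norm_smul, he]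

lemma norm_le_norm_coe_add_smul (he : ‖e‖ = 1) (y : hyperplane e) (t : ℝ) :
    ‖y‖ ≤ ‖(y : E) + t • e‖ :=
  le_of_sq_le_sq ((le_add_of_nonneg_right (sq_nonneg t)).trans_eq
    (norm_coe_add_smul_sq he y t).symm) (norm_nonneg _)

lemma finrank_hyperplane [FiniteDimensional ℝ E] (he : ‖e‖ = 1) :
    finrank ℝ (hyperplane e) = finrank ℝ E - 1 := by
  have hspan : finrank ℝ (ℝ ∙ e) = 1 := finrank_span_singleton (norm_ne_zero_iff.1 (by simp [he]))
  exact Nat.eq_sub_of_add_eq' (hspan ▸ (ℝ ∙ e).finrank_add_finrank_orthogonal)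

end Hyperplane

section Graph

variable {E : Type*} [NormedAddCommGroup E] [InnerProductSpace ℝ E]
  {e : E} {γ : hyperplane e → ℝ} {K : ℝ≥0}

/-- The parametrization of the graph of `γ` by the hyperplane over which it lies. -/
def graphMap (γ : hyperplane e → ℝ) (y : hyperplane e) : E := (y : E) + γ y • e

/-- The parametrization of the graph of the linear map `ℓ`. -/
def graphDeriv (ℓ : hyperplane e →L[ℝ] ℝ) : hyperplane e →L[ℝ] E :=
  (hyperplane e).subtypeL + ℓ.smulRight e

/-- The region below the graph of `γ`. -/
def subgraph (γ : hyperplane e → ℝ) : Set E := {x | inner ℝ e x < γ (toHyperplane e x)}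

lemma toHyperplane_graphMap (y : hyperplane e) : toHyperplane e (graphMap γ y) = y :=
  toHyperplane_coe_add_smul y _

lemma inner_graphMap (he : ‖e‖ = 1) (y : hyperplane e) : inner ℝ e (graphMap γ y) = γ y :=
  inner_coe_add_smul he y _

lemma norm_le_norm_graphMap (he : ‖e‖ = 1) (y : hyperplane e) : ‖y‖ ≤ ‖graphMap γ y‖ :=
  norm_le_norm_coe_add_smul he y _

lemma graphMap_injective : Function.Injective (graphMap γ) :=
  Function.LeftInverse.injective toHyperplane_graphMap

lemma continuous_graphMap (hγ : Continuous γ) : Continuous (graphMap γ) := by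
  unfold graphMap
  fun_prop

lemma lipschitzWith_graphMap (he : ‖e‖ = 1) (hγ : LipschitzWith K γ) :
    LipschitzWith (1 + K) (graphMap γ) := by
  refine (LipschitzWith.subtype_val (hyperplane e : Set E)).add
    (LipschitzWith.of_dist_le_mul fun y z => ?_)
  rw [dist_eq_norm, ← sub_smul, norm_smul, he, mul_one, ← dist_eq_norm]
  exact hγ.dist_le_mul y z

lemma hasFDerivAt_graphMap {y : hyperplane e} (h : DifferentiableAt ℝ γ y) :
    HasFDerivAt (graphMap γ) (graphDeriv (fderiv ℝ γ y)) y :=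
  (hyperplane e).subtypeL.hasFDerivAt.add (h.hasFDerivAt.smul_const e)

lemma isOpen_subgraph (hγ : Continuous γ) : IsOpen (subgraph γ) :=
  isOpen_lt (by fun_prop) (by fun_prop)

lemma graphMap_add_smul_mem_subgraph_iff (he : ‖e‖ = 1) (y : hyperplane e) (s : ℝ) :
    graphMap γ y + s • e ∈ subgraph γ ↔ s < 0 := by
  rw [graphMap, add_assoc, ← add_smul, subgraph, Set.mem_ofPred_eq, inner_coe_add_smul he,
    toHyperplane_coe_add_smul, add_lt_iff_neg_left]

lemma frontier_subgraph (he : ‖e‖ = 1) (hγ : Continuous γ) :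
    frontier (subgraph γ) = Set.range (graphMap γ) := by
  refine Set.Subset.antisymm (fun x hx => ?_) ?_
  · have hx : inner ℝ e x = γ (toHyperplane e x) :=
      frontier_lt_subset_eq (by fun_prop) (by fun_prop) hx
    exact ⟨toHyperplane e x, by rw [graphMap, ← hx, coe_toHyperplane_add_inner_smul he]⟩
  · rintro _ ⟨y, rfl⟩
    rw [(isOpen_subgraph hγ).frontier_eq]
    have hdown : Tendsto (fun s : ℝ => graphMap γ y + s • e) (𝓝[<] 0) (𝓝 (graphMap γ y)) := by
      have : Continuous fun s : ℝ => graphMap γ y + s • e := by fun_prop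
      simpa using (this.tendsto 0).mono_left nhdsWithin_le_nhds
    refine ⟨mem_closure_of_tendsto hdown ?_, ?_⟩
    · filter_upwards [self_mem_nhdsWithin] with s hs
      exact (graphMap_add_smul_mem_subgraph_iff he y s).2 hs
    · simpa using (graphMap_add_smul_mem_subgraph_iff (γ := γ) he y 0).not.2 (lt_irrefl 0)

lemma hasCompactSupport_comp_graphMap_add_smul [FiniteDimensional ℝ E] (he : ‖e‖ = 1)
    {φ : E → ℝ} (hφ : HasCompactSupport φ) (s : ℝ) :
    HasCompactSupport fun y => φ (graphMap γ y + s • e) := by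
  obtain ⟨R, hR⟩ := hφ.isCompact.isBounded.exists_norm_le
  refine HasCompactSupport.of_support_subset_isCompact (isCompact_closedBall (0 : hyperplane e) R)
    fun y hy => ?_
  have hnorm : ‖y‖ ≤ ‖graphMap γ y + s • e‖ := by
    rw [graphMap, add_assoc, ← add_smul]
    exact norm_le_norm_coe_add_smul he y _
  exact mem_closedBall_zero_iff.2 (hnorm.trans (hR _ (subset_tsupport φ hy)))

lemma hasCompactSupport_comp_add_smul (he : ‖e‖ = 1) {φ : E → ℝ} (hφ : HasCompactSupport φ)
    (x : E) : HasCompactSupport fun s : ℝ => φ (x + s • e) := by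
  obtain ⟨R, hR⟩ := hφ.isCompact.isBounded.exists_norm_le
  refine HasCompactSupport.of_support_subset_isCompact (isCompact_closedBall (0 : ℝ) (R + ‖x‖))
    fun s hs => ?_
  have hnorm := norm_sub_le (x + s • e) x
  rw [add_sub_cancel_left, norm_smul, he, mul_one] at hnorm
  exact mem_closedBall_zero_iff.2 (hnorm.trans (by gcongr; exact hR _ (subset_tsupport φ hs)))

end Graph

section GraphNormal

open scoped Gradient

variable {E : Type*} [NormedAddCommGroup E] [InnerProductSpace ℝ E] [FiniteDimensional ℝ E]
  {e : E} {γ : hyperplane e → ℝ} {K : ℝ≥0}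

/-- The normal of the graph of `γ` pointing out of the subgraph, with component `1` along `e`.
Its norm is the area element of the graph. -/
def graphNormal (γ : hyperplane e → ℝ) (y : hyperplane e) : E := e - (∇ γ y : hyperplane e)

lemma inner_graphNormal (he : ‖e‖ = 1) (y : hyperplane e) (h : E) :
    inner ℝ (graphNormal γ y) h = inner ℝ e h - fderiv ℝ γ y (toHyperplane e h) := by
  rw [graphNormal, inner_sub_left]
  congr 1
  conv_lhs => rw [← coe_toHyperplane_add_inner_smul he h]
  rw [inner_add_right, inner_smul_right, real_inner_comm e (∇ γ y : hyperplane e).1,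
    inner_coe_hyperplane, mul_zero, add_zero, ← Submodule.coe_inner, inner_gradient_left]

lemma norm_gradient_eq (y : hyperplane e) : ‖∇ γ y‖ = ‖fderiv ℝ γ y‖ := by
  rw [← toDual_gradient, LinearIsometryEquiv.norm_map]

lemma norm_graphNormal (he : ‖e‖ = 1) (y : hyperplane e) :
    ‖graphNormal γ y‖ = √(1 + ‖fderiv ℝ γ y‖ ^ 2) := by
  have hsq := norm_coe_add_smul_sq he (-∇ γ y) 1
  rw [one_smul, norm_neg, norm_gradient_eq, Submodule.coe_neg, neg_add_eq_sub] at hsq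
  rw [eq_comm, Real.sqrt_eq_iff_eq_sq (by positivity) (norm_nonneg _), graphNormal, hsq]
  ring

lemma one_le_norm_graphNormal (he : ‖e‖ = 1) (y : hyperplane e) : 1 ≤ ‖graphNormal γ y‖ := by
  rw [norm_graphNormal he, Real.one_le_sqrt]
  exact le_add_of_nonneg_right (sq_nonneg _)

lemma norm_graphNormal_le (he : ‖e‖ = 1) (hγ : LipschitzWith K γ) (y : hyperplane e) :
    ‖graphNormal γ y‖ ≤ 1 + K := by
  refine (norm_sub_le _ _).trans (add_le_add he.le ?_)
  rw [← Submodule.coe_norm, norm_gradient_eq]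
  exact norm_fderiv_le_of_lipschitz ℝ hγ

lemma measurable_graphNormal [MeasurableSpace E] [BorelSpace E] : Measurable (graphNormal γ) := by
  have hgrad : Measurable (∇ γ) :=
    (InnerProductSpace.toDual ℝ (hyperplane e)).symm.continuous.measurable.comp
      (measurable_fderiv ℝ γ)
  exact measurable_const.sub hgrad.subtype_val

lemma adjoint_comp_graphDeriv (he : ‖e‖ = 1) (ℓ : hyperplane e →L[ℝ] ℝ) :
    ((graphDeriv ℓ).adjoint ∘L graphDeriv ℓ : hyperplane e →ₗ[ℝ] hyperplane e) =
      LinearMap.transvection (ℓ : hyperplane e →ₗ[ℝ] ℝ)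
        ((InnerProductSpace.toDual ℝ (hyperplane e)).symm ℓ) := by
  ext1 v
  refine ext_inner_right ℝ fun w => ?_
  have hadj : inner ℝ ((graphDeriv ℓ).adjoint (graphDeriv ℓ v)) w =
      inner ℝ (graphDeriv ℓ v) (graphDeriv ℓ w) := ContinuousLinearMap.adjoint_inner_left _ _ _
  have hv : inner ℝ (v : E) e = 0 := by rw [real_inner_comm, inner_coe_hyperplane]
  simp only [ContinuousLinearMap.coe_coe, ContinuousLinearMap.comp_apply,
    LinearMap.transvection.apply]
  rw [hadj]
  simp [graphDeriv, inner_add_left, inner_add_right, inner_smul_left, inner_smul_right,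
    inner_coe_hyperplane, hv, he, InnerProductSpace.toDual_symm_apply, mul_comm]

lemma normDet_graphDeriv (he : ‖e‖ = 1) (ℓ : hyperplane e →L[ℝ] ℝ) :
    (graphDeriv ℓ).normDet = √(1 + ‖ℓ‖ ^ 2) := by
  have hdet : ((graphDeriv ℓ).adjoint ∘L graphDeriv ℓ).det = 1 + ‖ℓ‖ ^ 2 := by
    set a := (InnerProductSpace.toDual ℝ (hyperplane e)).symm ℓ with ha
    have hℓa : ℓ a = ‖ℓ‖ ^ 2 := by
      rw [← InnerProductSpace.toDual_symm_apply, ← ha, real_inner_self_eq_norm_sq, ha,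
        LinearIsometryEquiv.norm_map]
    rw [ContinuousLinearMap.det, adjoint_comp_graphDeriv he, LinearMap.transvection.det, ← ha,
      ContinuousLinearMap.coe_coe, hℓa]
  rw [← hdet, ← (graphDeriv ℓ).normDet_sq]
  exact (Real.sqrt_sq (LinearMap.normDet_nonneg _)).symm

variable [MeasurableSpace E] [BorelSpace E]

lemma euclideanHausdorffMeasure_graphMap_image_eq_zero (he : ‖e‖ = 1) (hγ : LipschitzWith K γ)
    {A : Set (hyperplane e)} (hA : volume A = 0) :
    μHE[finrank ℝ E - 1] (graphMap γ '' A) = 0 := by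
  have hle := euclideanHausdorffMeasure_image_le_of_dist_le (f := graphMap γ) (g := id) (A := A)
    (finrank ℝ (hyperplane e)) fun x _ y _ => (lipschitzWith_graphMap he hγ).dist_le_mul x y
  rw [Set.image_id, InnerProductSpace.euclideanHausdorffMeasure_eq_volume, hA, mul_zero,
    finrank_hyperplane he] at hle
  exact le_antisymm hle zero_le

lemma euclideanHausdorffMeasure_graphMap_image (he : ‖e‖ = 1) (hγ : LipschitzWith K γ)
    {A : Set (hyperplane e)} (hA : MeasurableSet A) :
    μHE[finrank ℝ E - 1] (graphMap γ '' A) = ∫⁻ y in A, ‖graphNormal γ y‖ₑ := by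
  let T : Set (hyperplane e) := {y | DifferentiableAt ℝ γ y}
  have hT : MeasurableSet T := measurableSet_of_differentiableAt ℝ γ
  have hTc : volume Tᶜ = 0 := hγ.ae_differentiableAt
  have hderiv : Measurable fun y => graphDeriv (fderiv ℝ γ y) := by
    have : Continuous fun ℓ : hyperplane e →L[ℝ] ℝ => graphDeriv ℓ := by
      exact continuous_const.add
        ((ContinuousLinearMap.smulRightL ℝ (hyperplane e) E).flip e).continuous
    exact this.measurable.comp (measurable_fderiv ℝ γ)
  have hgood := euclideanHausdorffMeasure_image_eq_lintegral_normDet (c := 1) (hA.inter hT)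
    (fun y hy => hasFDerivAt_graphMap hy.2) graphMap_injective.injOn
    (fun y _ v => by
      rw [NNReal.coe_one, one_mul]
      exact norm_le_norm_coe_add_smul he v (fderiv ℝ γ y v))
    hderiv
  simp_rw [finrank_hyperplane he, normDet_graphDeriv he, ← norm_graphNormal he, ofReal_norm]
    at hgood
  have hbad : μHE[finrank ℝ E - 1] (graphMap γ '' (A ∩ Tᶜ)) = 0 :=
    euclideanHausdorffMeasure_graphMap_image_eq_zero he hγ
      (measure_mono_null Set.inter_subset_right hTc)
  have hAT : (A ∩ T : Set (hyperplane e)) =ᵐ[volume] A := by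
    simpa using (ae_eq_refl A).inter (ae_eq_univ.2 hTc : T =ᵐ[volume] Set.univ)
  calc μHE[finrank ℝ E - 1] (graphMap γ '' A)
      = μHE[finrank ℝ E - 1] (graphMap γ '' (A ∩ T)) := by
        conv_lhs => rw [← Set.inter_union_compl A T, Set.image_union]
        exact measure_congr (union_ae_eq_left_of_ae_eq_empty (ae_eq_empty.2 hbad))
    _ = ∫⁻ y in A, ‖graphNormal γ y‖ₑ := by rw [hgood, setLIntegral_congr hAT]

lemma restrict_range_graphMap (he : ‖e‖ = 1) (hγ : LipschitzWith K γ) :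
    (μHE[finrank ℝ E - 1]).restrict (Set.range (graphMap γ)) =
      (volume.withDensity fun y => ‖graphNormal γ y‖ₑ).map (graphMap γ) := by
  have hm := (continuous_graphMap hγ.continuous).measurable
  ext B hB
  rw [Measure.map_apply hm hB, withDensity_apply _ (hm hB), Measure.restrict_apply hB,
    ← euclideanHausdorffMeasure_graphMap_image he hγ (hm hB), Set.image_preimage_eq_inter_range]

end GraphNormal

/-! ### The Gauss–Green formula below a Lipschitz graph -/

section GraphShear

variable {E : Type*} [NormedAddCommGroup E] [InnerProductSpace ℝ E] {e : E}
  {γ : hyperplane e → ℝ}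

/-- The shear `(y, s) ↦ y + (γ y + s) e`, which carries the lower half space onto the subgraph
of `γ`. -/
def graphShear (γ : hyperplane e → ℝ) (p : hyperplane e × ℝ) : E := graphMap γ p.1 + p.2 • e

lemma graphShear_eq (p : hyperplane e × ℝ) :
    graphShear γ p = (p.1 : E) + (γ p.1 + p.2) • e := by
  rw [graphShear, graphMap, add_smul, add_assoc]

lemma continuous_graphShear (hγ : Continuous γ) : Continuous (graphShear γ) := by
  have := continuous_graphMap hγ
  unfold graphShear
  fun_prop

lemma graphShear_injective (he : ‖e‖ = 1) : Function.Injective (graphShear γ) := by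
  intro p q h
  rw [graphShear_eq, graphShear_eq] at h
  have hbase := congrArg (toHyperplane e) h
  have hheight := congrArg (inner ℝ e) h
  rw [toHyperplane_coe_add_smul, toHyperplane_coe_add_smul] at hbase
  rw [inner_coe_add_smul he, inner_coe_add_smul he, hbase] at hheight
  exact Prod.ext hbase (add_left_cancel hheight)

variable [FiniteDimensional ℝ E] [MeasurableSpace E] [BorelSpace E]

lemma measurableEmbedding_graphShear (he : ‖e‖ = 1) (hγ : Continuous γ) :
    MeasurableEmbedding (graphShear γ) :=
  (continuous_graphShear hγ).measurableEmbedding (graphShear_injective he)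

lemma measurePreserving_coe_add_smul (he : ‖e‖ = 1) :
    MeasurePreserving (fun p : hyperplane e × ℝ => (p.1 : E) + p.2 • e) := by
  have hsum := ((ℝ ∙ e).measurePreserving_measurableEquivProd (0 : E)).symm
  rw [InnerProductSpace.euclideanHausdorffMeasure_eq_volume] at hsum
  have hspan := (LinearIsometryEquiv.toSpanUnitSingleton (𝕜 := ℝ) e he).measurePreserving
  have hswap : MeasurePreserving (Prod.swap : hyperplane e × ℝ → ℝ × hyperplane e) :=
    Measure.measurePreserving_swap
  convert! (hsum.comp (hspan.prod (MeasurePreserving.id volume))).comp hswap using 1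
  ext p
  simp [add_comm]

lemma measurePreserving_graphShear (he : ‖e‖ = 1) (hγ : Continuous γ) :
    MeasurePreserving (graphShear γ) := by
  have hvertical : MeasurePreserving (fun p : hyperplane e × ℝ => (p.1, γ p.1 + p.2)) :=
    (MeasurePreserving.id (volume : Measure (hyperplane e))).skew_product
      (g := fun y s => γ y + s) (Continuous.measurable (by fun_prop))
      (Eventually.of_forall fun y => map_add_left_eq_self _ _)
  convert! (measurePreserving_coe_add_smul he).comp hvertical using 1
  ext p
  exact graphShear_eq p

lemma setIntegral_subgraph {F : Type*} [NormedAddCommGroup F] [NormedSpace ℝ F] (he : ‖e‖ = 1)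
    (hγ : Continuous γ) (f : E → F) :
    ∫ x in subgraph γ, f x =
      ∫ p in (Set.univ : Set (hyperplane e)) ×ˢ Set.Iic (0 : ℝ), f (graphShear γ p) := by
  have hpreimage : graphShear γ ⁻¹' subgraph γ = Set.univ ×ˢ Set.Iio (0 : ℝ) := by
    ext p
    simp [graphShear, graphMap_add_smul_mem_subgraph_iff he]
  rw [← (measurePreserving_graphShear he hγ).setIntegral_preimage_emb
    (measurableEmbedding_graphShear he hγ), hpreimage, Measure.volume_eq_prod]
  exact setIntegral_congr_set (Measure.set_prod_ae_eq (ae_eq_refl _) Iio_ae_eq_Iic)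

lemma volume_range_graphMap (he : ‖e‖ = 1) (hγ : Continuous γ) :
    volume (Set.range (graphMap γ)) = 0 := by
  have hmeas : MeasurableSet (Set.range (graphMap γ)) :=
    ((continuous_graphMap hγ).measurableEmbedding graphMap_injective).measurableSet_range
  have hpreimage : graphShear γ ⁻¹' Set.range (graphMap γ) = Set.univ ×ˢ {(0 : ℝ)} := by
    have hgraph : graphMap γ = fun y => graphShear γ (y, 0) := by simp [graphShear]
    rw [hgraph]
    ext ⟨y, s⟩
    simp [(graphShear_injective he).eq_iff, eq_comm]
  rw [← (measurePreserving_graphShear he hγ).measure_preimage hmeas.nullMeasurableSet, hpreimage,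
    Measure.volume_eq_prod, Measure.prod_prod, Real.volume_singleton, mul_zero]

end GraphShear

section GraphGaussGreen

variable {E : Type*} [NormedAddCommGroup E] [InnerProductSpace ℝ E]
  {e : E} {γ : hyperplane e → ℝ} {K : ℝ≥0} {φ : E → ℝ}

lemma integral_Iic_fderiv_graphShear (he : ‖e‖ = 1) (hφ : ContDiff ℝ 1 φ)
    (hc : HasCompactSupport φ) (y : hyperplane e) :
    ∫ s in Set.Iic (0 : ℝ), fderiv ℝ φ (graphShear γ (y, s)) e = φ (graphMap γ y) := by
  have hline (s : ℝ) : HasDerivAt (fun s : ℝ => graphMap γ y + s • e) e s := by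
    simpa using ((hasDerivAt_id s).smul_const e).const_add (graphMap γ y)
  have hderiv (s : ℝ) : deriv (fun s : ℝ => φ (graphMap γ y + s • e)) s =
      fderiv ℝ φ (graphShear γ (y, s)) e :=
    ((hφ.differentiable one_ne_zero _).hasFDerivAt.comp_hasDerivAt s (hline s)).deriv
  have hsmooth : ContDiff ℝ 1 fun s : ℝ => φ (graphMap γ y + s • e) := by fun_prop
  simpa only [hderiv, zero_smul, add_zero] using
    (hasCompactSupport_comp_add_smul he hc (graphMap γ y)).integral_Iic_deriv_eq hsmooth 0

variable [FiniteDimensional ℝ E]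

lemma norm_inner_graphNormal_le (he : ‖e‖ = 1) (hγ : LipschitzWith K γ) (h : E)
    (y : hyperplane e) : ‖inner ℝ (graphNormal γ y) h‖ ≤ (1 + K) * ‖h‖ :=
  (norm_inner_le_norm _ _).trans (by gcongr; exact norm_graphNormal_le he hγ y)

variable [MeasurableSpace E] [BorelSpace E]

lemma measurable_inner_graphNormal (h : E) : Measurable fun y => inner ℝ (graphNormal γ y) h :=
  measurable_graphNormal.inner measurable_const

lemma integral_fderiv_graphShear_graphDeriv (he : ‖e‖ = 1) (hγ : LipschitzWith K γ)
    (hφ : ContDiff ℝ 1 φ) (hc : HasCompactSupport φ) (s : ℝ) (v : hyperplane e) :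
    ∫ y, fderiv ℝ φ (graphShear γ (y, s)) (graphDeriv (fderiv ℝ γ y) v) = 0 := by
  obtain ⟨C, hC⟩ := hφ.lipschitzWith_of_hasCompactSupport hc one_ne_zero
  have hlip : LipschitzWith (C * (1 + K)) fun y => φ (graphMap γ y + s • e) := by
    refine hC.comp ?_
    simpa using (lipschitzWith_graphMap he hγ).add (LipschitzWith.const (s • e))
  have hparts := LipschitzWith.integral_lineDeriv_mul_eq (μ := (volume : Measure (hyperplane e)))
    (LipschitzWith.const (1 : ℝ)) hlip (hasCompactSupport_comp_graphMap_add_smul he hc s) (-v)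
  have hconst (y : hyperplane e) : lineDeriv ℝ (fun _ : hyperplane e => (1 : ℝ)) y (-v) = 0 := by
    simp [lineDeriv]
  simp only [hconst, neg_neg, zero_mul, integral_zero, mul_one] at hparts
  rw [hparts]
  refine integral_congr_ae ?_
  filter_upwards [hγ.ae_differentiableAt (μ := volume)] with y hy
  have hchain : HasFDerivAt (fun y => φ (graphMap γ y + s • e)) _ y :=
    HasFDerivAt.comp y (hφ.differentiable one_ne_zero _).hasFDerivAt
      ((hasFDerivAt_graphMap hy).add_const (s • e))
  exact (hchain.hasLineDerivAt v).lineDeriv.symm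

/-- Since `h - ⟪N, h⟫ e` is tangent to the graph for every normal `N` with `⟪N, e⟫ = 1`, only the
derivative in the direction `e` survives the integration over a translate of the graph. -/
lemma integral_fderiv_graphShear (he : ‖e‖ = 1) (hγ : LipschitzWith K γ)
    (hφ : ContDiff ℝ 1 φ) (hc : HasCompactSupport φ) (h : E) (s : ℝ) :
    ∫ y, fderiv ℝ φ (graphShear γ (y, s)) h =
      ∫ y, inner ℝ (graphNormal γ y) h * fderiv ℝ φ (graphShear γ (y, s)) e := by
  have hint (w : E) : Integrable fun y => fderiv ℝ φ (graphShear γ (y, s)) w := by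
    refine Continuous.integrable_of_hasCompactSupport ?_
      (hasCompactSupport_comp_graphMap_add_smul he (hc.fderiv_apply ℝ w) s)
    exact ((hφ.continuous_fderiv one_ne_zero).comp ((continuous_graphShear hγ.continuous).comp
      (by fun_prop))).clm_apply continuous_const
  have hint_e : Integrable fun y =>
      inner ℝ (graphNormal γ y) h * fderiv ℝ φ (graphShear γ (y, s)) e :=
    (hint e).bdd_mul (measurable_inner_graphNormal h).aestronglyMeasurable
      (Eventually.of_forall (norm_inner_graphNormal_le he hγ h))
  rw [← sub_eq_zero, ← integral_sub (hint h) hint_e,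
    ← integral_fderiv_graphShear_graphDeriv he hγ hφ hc s (toHyperplane e h)]
  refine integral_congr_ae (Eventually.of_forall fun y => ?_)
  have htangent : h - inner ℝ (graphNormal γ y) h • e =
      graphDeriv (fderiv ℝ γ y) (toHyperplane e h) := by
    have hgraph : graphDeriv (fderiv ℝ γ y) (toHyperplane e h) =
        (toHyperplane e h : E) + fderiv ℝ γ y (toHyperplane e h) • e := rfl
    rw [inner_graphNormal he, hgraph, coe_toHyperplane he, sub_smul]
    abel
  simp only [← htangent, map_sub, map_smul, smul_eq_mul]

theorem setIntegral_subgraph_fderiv (he : ‖e‖ = 1) (hγ : LipschitzWith K γ)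
    (hφ : ContDiff ℝ 1 φ) (hc : HasCompactSupport φ) (h : E) :
    ∫ x in subgraph γ, fderiv ℝ φ x h =
      ∫ y, φ (graphMap γ y) * inner ℝ (graphNormal γ y) h := by
  have hint (w : E) : Integrable fun p : hyperplane e × ℝ => fderiv ℝ φ (graphShear γ p) w :=
    (measurePreserving_graphShear he hγ.continuous).integrable_comp_of_integrable
      (((hφ.continuous_fderiv one_ne_zero).clm_apply
        continuous_const).integrable_of_hasCompactSupport (hc.fderiv_apply ℝ w))
  have hint_e : Integrable fun p : hyperplane e × ℝ =>
      inner ℝ (graphNormal γ p.1) h * fderiv ℝ φ (graphShear γ p) e :=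
    (hint e).bdd_mul ((measurable_inner_graphNormal h).comp measurable_fst).aestronglyMeasurable
      (Eventually.of_forall fun p => norm_inner_graphNormal_le he hγ h p.1)
  have hhalf : (volume : Measure (hyperplane e × ℝ)).restrict (Set.univ ×ˢ Set.Iic (0 : ℝ)) =
      (volume : Measure (hyperplane e)).prod (volume.restrict (Set.Iic (0 : ℝ))) := by
    rw [Measure.volume_eq_prod, ← Measure.prod_restrict, Measure.restrict_univ]
  replace hint := (hint h).restrict (s := Set.univ ×ˢ Set.Iic (0 : ℝ))
  replace hint_e := hint_e.restrict (s := Set.univ ×ˢ Set.Iic (0 : ℝ))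
  rw [hhalf] at hint hint_e
  calc ∫ x in subgraph γ, fderiv ℝ φ x h
      = ∫ s in Set.Iic (0 : ℝ), ∫ y, fderiv ℝ φ (graphShear γ (y, s)) h := by
        rw [setIntegral_subgraph he hγ.continuous, hhalf, integral_prod_symm _ hint]
    _ = ∫ s in Set.Iic (0 : ℝ), ∫ y,
          inner ℝ (graphNormal γ y) h * fderiv ℝ φ (graphShear γ (y, s)) e := by
        simp_rw [integral_fderiv_graphShear he hγ hφ hc h]
    _ = ∫ y, inner ℝ (graphNormal γ y) h *
          ∫ s in Set.Iic (0 : ℝ), fderiv ℝ φ (graphShear γ (y, s)) e := by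
        rw [← integral_prod_symm _ hint_e, integral_prod _ hint_e]
        simp_rw [integral_const_mul]
    _ = ∫ y, φ (graphMap γ y) * inner ℝ (graphNormal γ y) h := by
        simp_rw [integral_Iic_fderiv_graphShear he hφ hc, mul_comm]

end GraphGaussGreen

/-! ### Surface measure and outward normal in a graph chart -/

section OutwardNormal

variable {n : ℕ} {Ω Ω' : Set (EuclideanSpace ℝ (Fin n))} {x ν ν' : EuclideanSpace ℝ (Fin n)}

lemma IsOutwardNormal.unique (h : IsOutwardNormal Ω x ν) (h' : IsOutwardNormal Ω x ν') :
    ν = ν' := by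
  by_contra hne
  set d := ν' - ν with hd
  have hd_pos : 0 < ‖d‖ := norm_pos_iff.2 (sub_ne_zero.2 (Ne.symm hne))
  have hd_sq : ‖d‖ ^ 2 = 2 - 2 * inner ℝ ν ν' := by
    rw [hd, norm_sub_sq_real, h.1, h'.1, real_inner_comm]; ring
  have hinner : inner ℝ ν d = -(‖d‖ ^ 2 / 2) := by
    rw [hd_sq, hd, inner_sub_right, real_inner_self_eq_norm_sq, h.1]; ring
  have hinner' : inner ℝ ν' d = ‖d‖ ^ 2 / 2 := by
    rw [hd_sq, hd, inner_sub_right, real_inner_self_eq_norm_sq, h'.1, real_inner_comm]; ring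
  have htendsto : Tendsto (fun t : ℝ => x + t • d) (𝓝[>] 0) (𝓝 x) := by
    have hcont : Continuous fun t : ℝ => x + t • d := by fun_prop
    simpa using (hcont.tendsto 0).mono_left nhdsWithin_le_nhds
  -- A short step along `ν' - ν` would lead both into `Ω` and out of it.
  have hε : 0 < ‖d‖ / 4 := by positivity
  obtain ⟨t, hmem, hnotMem, ht : 0 < t⟩ := ((htendsto.eventually (h.2 _ hε)).and
    ((htendsto.eventually (h'.2 _ hε)).and self_mem_nhdsWithin)).exists
  simp only [add_sub_cancel_left, inner_smul_right, norm_smul, Real.norm_of_nonneg ht.le,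
    hinner, hinner'] at hmem hnotMem
  have hpos : 0 < t * ‖d‖ ^ 2 := by positivity
  exact hnotMem.2 (by linarith) (hmem.1 (by linarith))

lemma IsOutwardNormal.outwardNormal_eq (h : IsOutwardNormal Ω x ν) : outwardNormal Ω x = ν := by
  have hex : ∃ ν, IsOutwardNormal Ω x ν := ⟨ν, h⟩
  rw [outwardNormal, dif_pos hex]
  exact hex.choose_spec.unique h

lemma norm_outwardNormal_le (x : EuclideanSpace ℝ (Fin n)) : ‖outwardNormal Ω x‖ ≤ 1 := by
  unfold outwardNormal
  split_ifs with h
  · exact h.choose_spec.1.le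
  · simp

lemma IsOutwardNormal.congr_set (h : IsOutwardNormal Ω x ν) (hΩ : Ω =ᶠ[𝓝 x] Ω') :
    IsOutwardNormal Ω' x ν := by
  refine ⟨h.1, fun ε hε => ?_⟩
  filter_upwards [h.2 ε hε, hΩ.mem_iff] with y hy hy_iff
  rwa [← hy_iff]

lemma isOutwardNormal_subgraph {e : EuclideanSpace ℝ (Fin n)} {γ : hyperplane e → ℝ}
    {y : hyperplane e} (he : ‖e‖ = 1) (hγ : DifferentiableAt ℝ γ y) :
    IsOutwardNormal (subgraph γ) (graphMap γ y) (NormedSpace.normalize (graphNormal γ y)) := by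
  have hJ : 1 ≤ ‖graphNormal γ y‖ := one_le_norm_graphNormal he y
  refine ⟨NormedSpace.norm_normalize_eq_one_iff.2 (norm_pos_iff.1 (by linarith)),
    fun ε hε => ?_⟩
  have hbase : Tendsto (toHyperplane e) (𝓝 (graphMap γ y)) (𝓝 y) := by
    simpa only [toHyperplane_graphMap] using (toHyperplane e).continuous.tendsto (graphMap γ y)
  filter_upwards [hbase.eventually (hγ.hasFDerivAt.isLittleO.def hε)] with x hx
  set v := x - graphMap γ y with hv
  have hbase_v : toHyperplane e x - y = toHyperplane e v := by
    rw [hv, map_sub, toHyperplane_graphMap]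
  have herror : |γ (toHyperplane e x) - γ y - fderiv ℝ γ y (toHyperplane e v)| ≤ ε * ‖v‖ := by
    rw [hbase_v] at hx
    exact hx.trans (by gcongr; exact norm_toHyperplane_le v)
  have hmem : x ∈ subgraph γ ↔ inner ℝ (graphNormal γ y) v <
      γ (toHyperplane e x) - γ y - fderiv ℝ γ y (toHyperplane e v) := by
    rw [inner_graphNormal he, hv, inner_sub_right, inner_graphMap he, subgraph, Set.mem_ofPred_eq]
    constructor <;> intro h <;> linarith
  have hnormal : inner ℝ (graphNormal γ y) v =
      ‖graphNormal γ y‖ * inner ℝ (NormedSpace.normalize (graphNormal γ y)) v := by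
    rw [← real_inner_smul_left, NormedSpace.norm_smul_normalize]
  have hεv : 0 ≤ ε * ‖v‖ := by positivity
  obtain ⟨herror_ge, herror_le⟩ := abs_le.1 herror
  rw [hmem, hnormal]
  constructor
  · intro h
    nlinarith
  · intro h
    nlinarith

end OutwardNormal

section GraphChart

variable {n : ℕ}

/-- A chart of the boundary of `Ω`: inside the open set `U`, the set `Ω` is the region below the
graph of a `K`-Lipschitz function `γ` over a hyperplane. -/
structure IsGraphChart (Ω U : Set (EuclideanSpace ℝ (Fin n))) {e : EuclideanSpace ℝ (Fin n)}
    (K : ℝ≥0) (γ : hyperplane e → ℝ) : Prop where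
  norm_axis : ‖e‖ = 1
  lipschitzWith : LipschitzWith K γ
  isOpen : IsOpen U
  inter_eq : Ω ∩ U = subgraph γ ∩ U

variable {Ω U : Set (EuclideanSpace ℝ (Fin n))} {e : EuclideanSpace ℝ (Fin n)} {K : ℝ≥0}
  {γ : hyperplane e → ℝ}

namespace IsGraphChart

lemma measurableEmbedding_graphMap (hU : IsGraphChart Ω U K γ) :
    MeasurableEmbedding (graphMap γ) :=
  (continuous_graphMap hU.lipschitzWith.continuous).measurableEmbedding graphMap_injective

lemma frontier_inter_eq (hU : IsGraphChart Ω U K γ) :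
    frontier Ω ∩ U = Set.range (graphMap γ) ∩ U := by
  rw [← frontier_inter_open_inter hU.isOpen, hU.inter_eq, frontier_inter_open_inter hU.isOpen,
    frontier_subgraph hU.norm_axis hU.lipschitzWith.continuous]

lemma restrict_surfaceMeasure (hU : IsGraphChart Ω U K γ) :
    (surfaceMeasure Ω).restrict U =
      ((volume.withDensity fun y => ‖graphNormal γ y‖ₑ).map (graphMap γ)).restrict U := by
  have hgraph := restrict_range_graphMap hU.norm_axis hU.lipschitzWith
  rw [finrank_euclideanSpace_fin] at hgraph
  rw [← hgraph, surfaceMeasure, Measure.restrict_restrict hU.isOpen.measurableSet,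
    Measure.restrict_restrict hU.isOpen.measurableSet, Set.inter_comm, hU.frontier_inter_eq,
    Set.inter_comm]

lemma ae_outwardNormal_eq (hU : IsGraphChart Ω U K γ) :
    ∀ᵐ x ∂(surfaceMeasure Ω).restrict U,
      outwardNormal Ω x = NormedSpace.normalize (graphNormal γ (toHyperplane e x)) := by
  rw [hU.restrict_surfaceMeasure, ae_restrict_iff' hU.isOpen.measurableSet,
    hU.measurableEmbedding_graphMap.ae_map_iff]
  refine (withDensity_absolutelyContinuous (volume : Measure (hyperplane e)) _).ae_le ?_
  filter_upwards [hU.lipschitzWith.ae_differentiableAt (μ := volume)] with y hy hyU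
  have hlocal : subgraph γ =ᶠ[𝓝 (graphMap γ y)] Ω := eventuallyEq_set.2 <| by
    filter_upwards [hU.isOpen.mem_nhds hyU] with x hx
    simpa [hx] using (Set.ext_iff.1 hU.inter_eq x).symm
  rw [((isOutwardNormal_subgraph hU.norm_axis hy).congr_set hlocal).outwardNormal_eq,
    toHyperplane_graphMap]

lemma surfaceMeasure_lt_top (hU : IsGraphChart Ω U K γ) (hbdd : Bornology.IsBounded U) :
    surfaceMeasure Ω U < ⊤ := by
  obtain ⟨R, hR⟩ := hbdd.exists_norm_le
  have hpreimage : graphMap γ ⁻¹' U ⊆ Metric.closedBall 0 R := fun y hy =>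
    mem_closedBall_zero_iff.2 ((norm_le_norm_graphMap hU.norm_axis y).trans (hR _ hy))
  have hmeas : MeasurableSet (graphMap γ ⁻¹' U) :=
    hU.measurableEmbedding_graphMap.measurable hU.isOpen.measurableSet
  calc surfaceMeasure Ω U
      = ∫⁻ y in graphMap γ ⁻¹' U, ‖graphNormal γ y‖ₑ := by
        rw [← Measure.restrict_apply_self, hU.restrict_surfaceMeasure,
          Measure.restrict_apply_self, hU.measurableEmbedding_graphMap.map_apply,
          withDensity_apply _ hmeas]
    _ ≤ ∫⁻ _ in Metric.closedBall (0 : hyperplane e) R, ENNReal.ofReal (1 + K) := by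
        refine (lintegral_mono_set hpreimage).trans (lintegral_mono fun y => ?_)
        rw [← ofReal_norm]
        exact ENNReal.ofReal_le_ofReal (norm_graphNormal_le hU.norm_axis hU.lipschitzWith y)
    _ < ⊤ := by
        rw [setLIntegral_const]
        exact ENNReal.mul_lt_top ENNReal.ofReal_lt_top measure_closedBall_lt_top

lemma measurable_normalize_graphNormal :
    Measurable fun x => NormedSpace.normalize (graphNormal γ (toHyperplane e x)) := by
  have hN : Measurable fun x => graphNormal γ (toHyperplane e x) :=
    measurable_graphNormal.comp (toHyperplane e).continuous.measurable
  exact hN.norm.inv.smul hN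

lemma aestronglyMeasurable_outwardNormal (hU : IsGraphChart Ω U K γ) :
    AEStronglyMeasurable (outwardNormal Ω) ((surfaceMeasure Ω).restrict U) :=
  measurable_normalize_graphNormal.aestronglyMeasurable.congr
    (EventuallyEq.symm hU.ae_outwardNormal_eq)

lemma volume_frontier_inter (hU : IsGraphChart Ω U K γ) : volume (frontier Ω ∩ U) = 0 := by
  rw [hU.frontier_inter_eq]
  exact measure_mono_null Set.inter_subset_left
    (volume_range_graphMap hU.norm_axis hU.lipschitzWith.continuous)

lemma integral_surfaceMeasure (hU : IsGraphChart Ω U K γ) {φ : EuclideanSpace ℝ (Fin n) → ℝ}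
    (hsupp : tsupport φ ⊆ U) (h : EuclideanSpace ℝ (Fin n)) :
    ∫ x, inner ℝ (outwardNormal Ω x) h * φ x ∂surfaceMeasure Ω =
      ∫ y, φ (graphMap γ y) * inner ℝ (graphNormal γ y) h := by
  let ψ x := inner ℝ (NormedSpace.normalize (graphNormal γ (toHyperplane e x))) h * φ x
  have hzero (x) (hx : x ∉ U) : φ x = 0 :=
    image_eq_zero_of_notMem_tsupport fun hx' => hx (hsupp hx')
  calc ∫ x, inner ℝ (outwardNormal Ω x) h * φ x ∂surfaceMeasure Ω
      = ∫ x in U, inner ℝ (outwardNormal Ω x) h * φ x ∂surfaceMeasure Ω :=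
        (setIntegral_eq_integral_of_forall_compl_eq_zero fun x hx => by
          rw [hzero x hx, mul_zero]).symm
    _ = ∫ x in U, ψ x ∂surfaceMeasure Ω :=
        integral_congr_ae (hU.ae_outwardNormal_eq.mono fun x hx => by simp only [ψ, hx])
    _ = ∫ x, ψ x ∂(volume.withDensity fun y => ‖graphNormal γ y‖ₑ).map (graphMap γ) := by
        rw [hU.restrict_surfaceMeasure]
        exact setIntegral_eq_integral_of_forall_compl_eq_zero fun x hx => by
          simp only [ψ, hzero x hx, mul_zero]
    _ = ∫ y, ‖graphNormal γ y‖ * ψ (graphMap γ y) := by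
        rw [hU.measurableEmbedding_graphMap.integral_map,
          integral_withDensity_eq_integral_toReal_smul measurable_graphNormal.enorm
            (Eventually.of_forall fun y => enorm_lt_top)]
        simp only [toReal_enorm, smul_eq_mul]
    _ = ∫ y, φ (graphMap γ y) * inner ℝ (graphNormal γ y) h := by
        refine integral_congr_ae (Eventually.of_forall fun y => ?_)
        simp only [ψ, toHyperplane_graphMap]
        rw [← mul_assoc, ← real_inner_smul_left, NormedSpace.norm_smul_normalize, mul_comm]

lemma setIntegral_fderiv (hU : IsGraphChart Ω U K γ) {φ : EuclideanSpace ℝ (Fin n) → ℝ}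
    (hφ : ContDiff ℝ 1 φ) (hc : HasCompactSupport φ) (hsupp : tsupport φ ⊆ U)
    (h : EuclideanSpace ℝ (Fin n)) :
    ∫ x in Ω, fderiv ℝ φ x h = ∫ x, inner ℝ (outwardNormal Ω x) h * φ x ∂surfaceMeasure Ω := by
  have hzero (x) (hx : x ∉ U) : fderiv ℝ φ x h = 0 := by
    rw [image_eq_zero_of_notMem_tsupport fun hx' => hx (hsupp (tsupport_fderiv_subset ℝ hx')),
      zero_apply]
  have hrestrict (s : Set (EuclideanSpace ℝ (Fin n))) :
      ∫ x in s ∩ U, fderiv ℝ φ x h = ∫ x in s, fderiv ℝ φ x h := by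
    rw [Set.inter_comm, ← Measure.restrict_restrict hU.isOpen.measurableSet]
    exact setIntegral_eq_integral_of_forall_compl_eq_zero hzero
  rw [hU.integral_surfaceMeasure hsupp, ← hrestrict, hU.inter_eq, hrestrict,
    setIntegral_subgraph_fderiv hU.norm_axis hU.lipschitzWith hφ hc]

end IsGraphChart

end GraphChart

/-! ### The Gauss–Green formula on bounded Lipschitz domains -/

section LipschitzDomain

variable {n : ℕ} {Ω : Set (EuclideanSpace ℝ (Fin n))}

namespace IsBoundedLipschitz

lemma isCompact_frontier (hΩ : IsBoundedLipschitz Ω) : IsCompact (frontier Ω) :=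
  hΩ.isBounded.isCompact_closure.of_isClosed_subset isClosed_frontier frontier_subset_closure

lemma exists_isGraphChart (hΩ : IsBoundedLipschitz Ω) {p : EuclideanSpace ℝ (Fin n)}
    (hp : p ∈ frontier Ω) :
    ∃ (e : EuclideanSpace ℝ (Fin n)) (U : Set (EuclideanSpace ℝ (Fin n))) (K : ℝ≥0)
      (γ : hyperplane e → ℝ), IsGraphChart Ω U K γ ∧ Bornology.IsBounded U ∧ p ∈ U := by
  obtain ⟨e, r, K, γ, he, hr, hγ, hmem⟩ := hΩ.graph p hp
  refine ⟨e, Metric.ball p r, K, fun y => γ y,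
    ⟨he, (mul_one K) ▸ hγ.comp (LipschitzWith.subtype_val _), Metric.isOpen_ball, ?_⟩,
    Metric.isBounded_ball, Metric.mem_ball_self hr⟩
  ext x
  refine and_congr_left fun hx => (hmem x hx).trans ?_
  rw [subgraph, Set.mem_ofPred_eq, coe_toHyperplane he]

lemma isFiniteMeasure_surfaceMeasure (hΩ : IsBoundedLipschitz Ω) :
    IsFiniteMeasure (surfaceMeasure Ω) := by
  have hlt : surfaceMeasure Ω (frontier Ω) < ⊤ := by
    refine hΩ.isCompact_frontier.measure_lt_top_of_nhdsWithin fun p hp => ?_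
    obtain ⟨e, U, K, γ, hU, hbdd, hpU⟩ := hΩ.exists_isGraphChart hp
    exact ⟨U, mem_nhdsWithin_of_mem_nhds (hU.isOpen.mem_nhds hpU), hU.surfaceMeasure_lt_top hbdd⟩
  exact ⟨by rwa [surfaceMeasure, Measure.restrict_apply_self,
    ← Measure.restrict_apply_univ] at hlt⟩

lemma aestronglyMeasurable_outwardNormal (hΩ : IsBoundedLipschitz Ω) :
    AEStronglyMeasurable (outwardNormal Ω) (surfaceMeasure Ω) := by
  have h : AEStronglyMeasurable (outwardNormal Ω)
      ((surfaceMeasure Ω).restrict (frontier Ω)) := by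
    refine hΩ.isCompact_frontier.induction_on
      (p := fun s => AEStronglyMeasurable (outwardNormal Ω) ((surfaceMeasure Ω).restrict s))
      (by simp) (fun s t hst ht => ht.mono_set hst)
      (fun s t hs ht => aestronglyMeasurable_union_iff.2 ⟨hs, ht⟩) fun p hp => ?_
    obtain ⟨e, U, K, γ, hU, -, hpU⟩ := hΩ.exists_isGraphChart hp
    exact ⟨U, mem_nhdsWithin_of_mem_nhds (hU.isOpen.mem_nhds hpU),
      hU.aestronglyMeasurable_outwardNormal⟩
  rwa [surfaceMeasure, Measure.restrict_restrict isClosed_frontier.measurableSet,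
    Set.inter_self] at h

lemma volume_frontier (hΩ : IsBoundedLipschitz Ω) : volume (frontier Ω) = 0 := by
  refine hΩ.isCompact_frontier.measure_zero_of_nhdsWithin fun p hp => ?_
  obtain ⟨e, U, K, γ, hU, -, hpU⟩ := hΩ.exists_isGraphChart hp
  exact ⟨frontier Ω ∩ U, inter_mem self_mem_nhdsWithin
    (mem_nhdsWithin_of_mem_nhds (hU.isOpen.mem_nhds hpU)), hU.volume_frontier_inter⟩

lemma integrable_inner_outwardNormal_smul {F : Type*} [NormedAddCommGroup F] [NormedSpace ℝ F]
    (hΩ : IsBoundedLipschitz Ω) {f : EuclideanSpace ℝ (Fin n) → F} (hf : Continuous f)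
    (h : EuclideanSpace ℝ (Fin n)) :
    Integrable (fun x => inner ℝ (outwardNormal Ω x) h • f x) (surfaceMeasure Ω) := by
  have := hΩ.isFiniteMeasure_surfaceMeasure
  obtain ⟨C, hC⟩ := hΩ.isCompact_frontier.exists_bound_of_continuousOn hf.continuousOn
  refine Integrable.of_bound ((hΩ.aestronglyMeasurable_outwardNormal.inner
    aestronglyMeasurable_const).smul hf.aestronglyMeasurable) (‖h‖ * C) ?_
  filter_upwards [ae_restrict_mem isClosed_frontier.measurableSet] with x hx
  rw [norm_smul]
  refine mul_le_mul ((norm_inner_le_norm _ _).trans ?_) (hC x hx) (norm_nonneg _) (norm_nonneg _)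
  exact mul_le_of_le_one_left (norm_nonneg _) (norm_outwardNormal_le x)

end IsBoundedLipschitz

end LipschitzDomain

section Partition

variable {E : Type*} [NormedAddCommGroup E] [NormedSpace ℝ E] [FiniteDimensional ℝ E]

open scoped Manifold in
lemma exists_contDiff_sum_eq_of_nhds_cover {m : ℕ∞} {φ : E → ℝ} (hφ : ContDiff ℝ m φ)
    (hc : HasCompactSupport φ) {U : E → Set E} (hU : ∀ x, IsOpen (U x)) (hxU : ∀ x, x ∈ U x) :
    ∃ (t : Finset E) (ψ : t → E → ℝ), (∀ i, ContDiff ℝ m (ψ i)) ∧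
      (∀ i, HasCompactSupport (ψ i)) ∧ (∀ i, tsupport (ψ i) ⊆ U i) ∧
      φ = fun x => ∑ i, ψ i x := by
  obtain ⟨t, -, hcover⟩ := hc.isCompact.elim_nhds_subcover U fun x _ => (hU x).mem_nhds (hxU x)
  rw [← Set.iUnion_subtype (fun x => x ∈ t) fun x => U x] at hcover
  obtain ⟨f, hf⟩ := SmoothPartitionOfUnity.exists_isSubordinate 𝓘(ℝ, E) (isClosed_tsupport φ)
    (fun i : t => U i) (fun i => hU i) hcover
  refine ⟨t, fun i x => f i x * φ x,
    fun i => ((f i).contMDiff.contDiff.of_le (by exact_mod_cast le_top)).mul hφ,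
    fun i => hc.mul_left, fun i => tsupport_mul_subset_left.trans (hf i), ?_⟩
  ext x
  by_cases hx : x ∈ tsupport φ
  · have hsum := f.sum_eq_one hx
    rw [finsum_eq_sum_of_fintype] at hsum
    rw [← Finset.sum_mul, hsum, one_mul]
  · simp [image_eq_zero_of_notMem_tsupport hx]

end Partition

section CompactSupport

variable {E : Type*} [NormedAddCommGroup E] [NormedSpace ℝ E]
  [MeasurableSpace E] [BorelSpace E] {μ : Measure E} {φ : E → ℝ}

lemma integrable_fderiv_apply [IsFiniteMeasureOnCompacts μ] (hφ : ContDiff ℝ 1 φ)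
    (hc : HasCompactSupport φ) (h : E) : Integrable (fun x => fderiv ℝ φ x h) μ :=
  ((hφ.continuous_fderiv one_ne_zero).clm_apply continuous_const).integrable_of_hasCompactSupport
    (hc.fderiv_apply ℝ h)

lemma integral_fderiv_eq_zero [FiniteDimensional ℝ E] [μ.IsAddHaarMeasure] (hφ : ContDiff ℝ 1 φ)
    (hc : HasCompactSupport φ) (h : E) : ∫ x, fderiv ℝ φ x h ∂μ = 0 := by
  have hparts := integral_mul_fderiv_eq_neg_fderiv_mul_of_integrable (μ := μ)
    (f := fun _ : E => (1 : ℝ)) (g := φ) (v := h) (by simp)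
    (by simpa using integrable_fderiv_apply hφ hc h)
    (by simpa using hφ.continuous.integrable_of_hasCompactSupport hc)
    (fun x _ => differentiableAt_const _) (fun x _ => hφ.differentiable one_ne_zero x)
  simpa using hparts

end CompactSupport

section GaussGreen

variable {n : ℕ} {Ω : Set (EuclideanSpace ℝ (Fin n))} {φ : EuclideanSpace ℝ (Fin n) → ℝ}

lemma integral_surfaceMeasure_eq_zero (hφ : ∀ x ∈ frontier Ω, φ x = 0)
    (h : EuclideanSpace ℝ (Fin n)) :
    ∫ x, inner ℝ (outwardNormal Ω x) h * φ x ∂surfaceMeasure Ω = 0 := by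
  refine integral_eq_zero_of_ae ?_
  filter_upwards [ae_restrict_mem isClosed_frontier.measurableSet] with x hx
  simp [hφ x hx]

lemma setIntegral_fderiv_of_tsupport_subset (hΩ : IsOpen Ω) (hφ : ContDiff ℝ 1 φ)
    (hc : HasCompactSupport φ) (hsupp : tsupport φ ⊆ Ω) (h : EuclideanSpace ℝ (Fin n)) :
    ∫ x in Ω, fderiv ℝ φ x h = ∫ x, inner ℝ (outwardNormal Ω x) h * φ x ∂surfaceMeasure Ω := by
  rw [setIntegral_eq_integral_of_forall_compl_eq_zero, integral_fderiv_eq_zero hφ hc,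
    integral_surfaceMeasure_eq_zero]
  · rw [hΩ.frontier_eq]
    exact fun x hx => image_eq_zero_of_notMem_tsupport fun hx' => hx.2 (hsupp hx')
  · intro x hx
    rw [image_eq_zero_of_notMem_tsupport fun hx' => hx (hsupp (tsupport_fderiv_subset ℝ hx')),
      zero_apply]

lemma setIntegral_fderiv_of_disjoint_closure (hsupp : Disjoint (tsupport φ) (closure Ω))
    (h : EuclideanSpace ℝ (Fin n)) :
    ∫ x in Ω, fderiv ℝ φ x h = ∫ x, inner ℝ (outwardNormal Ω x) h * φ x ∂surfaceMeasure Ω := by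
  have hnotMem {x} (hx : x ∈ closure Ω) : x ∉ tsupport φ := hsupp.notMem_of_mem_right hx
  rw [integral_surfaceMeasure_eq_zero fun x hx =>
    image_eq_zero_of_notMem_tsupport (hnotMem (frontier_subset_closure hx))]
  refine setIntegral_eq_zero_of_forall_eq_zero fun x hx => ?_
  rw [image_eq_zero_of_notMem_tsupport fun hx' =>
    hnotMem (subset_closure hx) (tsupport_fderiv_subset ℝ hx'), zero_apply]

namespace IsBoundedLipschitz

lemma exists_isOpen_setIntegral_fderiv (hΩ : IsBoundedLipschitz Ω)
    (x : EuclideanSpace ℝ (Fin n)) :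
    ∃ U, IsOpen U ∧ x ∈ U ∧ ∀ φ : EuclideanSpace ℝ (Fin n) → ℝ, ContDiff ℝ 1 φ →
      HasCompactSupport φ → tsupport φ ⊆ U → ∀ h, ∫ x in Ω, fderiv ℝ φ x h =
        ∫ x, inner ℝ (outwardNormal Ω x) h * φ x ∂surfaceMeasure Ω := by
  by_cases hx : x ∈ frontier Ω
  · obtain ⟨e, U, K, γ, hU, -, hxU⟩ := hΩ.exists_isGraphChart hx
    exact ⟨U, hU.isOpen, hxU, fun φ hφ hc hsupp => hU.setIntegral_fderiv hφ hc hsupp⟩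
  by_cases hxΩ : x ∈ Ω
  · exact ⟨Ω, hΩ.isOpen, hxΩ,
      fun φ hφ hc hsupp => setIntegral_fderiv_of_tsupport_subset hΩ.isOpen hφ hc hsupp⟩
  · refine ⟨(closure Ω)ᶜ, isClosed_closure.isOpen_compl, fun hx' => hx ?_, fun φ _ _ hsupp =>
      setIntegral_fderiv_of_disjoint_closure (Set.subset_compl_iff_disjoint_right.1 hsupp)⟩
    rw [hΩ.isOpen.frontier_eq]
    exact ⟨hx', hxΩ⟩

lemma setIntegral_fderiv_of_hasCompactSupport (hΩ : IsBoundedLipschitz Ω)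
    (hφ : ContDiff ℝ 1 φ) (hc : HasCompactSupport φ) (h : EuclideanSpace ℝ (Fin n)) :
    ∫ x in Ω, fderiv ℝ φ x h = ∫ x, inner ℝ (outwardNormal Ω x) h * φ x ∂surfaceMeasure Ω := by
  choose U hUo hxU hU using hΩ.exists_isOpen_setIntegral_fderiv
  obtain ⟨t, ψ, hψ, hψc, hψU, rfl⟩ :=
    exists_contDiff_sum_eq_of_nhds_cover (m := 1) hφ hc hUo hxU
  have hderiv (x) : fderiv ℝ (fun x => ∑ i, ψ i x) x h = ∑ i, fderiv ℝ (ψ i) x h := by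
    rw [fderiv_fun_sum fun i _ => (hψ i).differentiable one_ne_zero x, sum_apply]
  simp only [hderiv, Finset.mul_sum]
  rw [integral_finsetSum _ fun i _ => (integrable_fderiv_apply (hψ i) (hψc i) h).integrableOn,
    integral_finsetSum _ fun i _ => by
      simpa using hΩ.integrable_inner_outwardNormal_smul (hψ i).continuous h]
  exact Finset.sum_congr rfl fun i _ => hU i _ (hψ i) (hψc i) (hψU i) h

lemma setIntegral_fderiv_real (hΩ : IsBoundedLipschitz Ω) (hφ : ContDiff ℝ 1 φ)
    (h : EuclideanSpace ℝ (Fin n)) :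
    ∫ x in Ω, fderiv ℝ φ x h = ∫ x, inner ℝ (outwardNormal Ω x) h * φ x ∂surfaceMeasure Ω := by
  obtain ⟨R, hR, hΩR⟩ := hΩ.isBounded.closure.subset_ball_lt 0 0
  let χ : ContDiffBump (0 : EuclideanSpace ℝ (Fin n)) := ⟨R, R + 1, hR, by linarith⟩
  have hcutoff (x) (hx : x ∈ closure Ω) : (fun x => χ x * φ x) =ᶠ[𝓝 x] φ := by
    filter_upwards [χ.eventuallyEq_one_of_mem_ball (hΩR hx)] with y hy
    rw [hy, Pi.one_apply, one_mul]
  calc ∫ x in Ω, fderiv ℝ φ x h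
      = ∫ x in Ω, fderiv ℝ (fun x => χ x * φ x) x h :=
        setIntegral_congr_fun hΩ.isOpen.measurableSet fun x hx => by
          rw [(hcutoff x (subset_closure hx)).fderiv_eq]
    _ = ∫ x, inner ℝ (outwardNormal Ω x) h * (χ x * φ x) ∂surfaceMeasure Ω :=
        hΩ.setIntegral_fderiv_of_hasCompactSupport (χ.contDiff.mul hφ)
          χ.hasCompactSupport.mul_right h
    _ = ∫ x, inner ℝ (outwardNormal Ω x) h * φ x ∂surfaceMeasure Ω := by
        refine integral_congr_ae ?_
        filter_upwards [ae_restrict_mem isClosed_frontier.measurableSet] with x hx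
        exact congrArg (_ * ·) (hcutoff x (frontier_subset_closure hx)).eq_of_nhds

theorem setIntegral_fderiv {F : Type*} [NormedAddCommGroup F] [NormedSpace ℝ F] [CompleteSpace F]
    (hΩ : IsBoundedLipschitz Ω) {φ : EuclideanSpace ℝ (Fin n) → F} (hφ : ContDiff ℝ 1 φ)
    (h : EuclideanSpace ℝ (Fin n)) :
    ∫ x in Ω, fderiv ℝ φ x h = ∫ x, inner ℝ (outwardNormal Ω x) h • φ x ∂surfaceMeasure Ω := by
  have hint : IntegrableOn (fun x => fderiv ℝ φ x h) Ω :=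
    (((hφ.continuous_fderiv one_ne_zero).clm_apply
      continuous_const).continuousOn.integrableOn_compact
        hΩ.isBounded.isCompact_closure).mono_set subset_closure
  rw [SeparatingDual.eq_iff_forall_dual_eq (R := ℝ)]
  intro L
  have hderiv (x) : fderiv ℝ (L ∘ φ) x h = L (fderiv ℝ φ x h) := by
    rw [fderiv_comp x L.differentiableAt (hφ.differentiable one_ne_zero x), L.fderiv,
      ContinuousLinearMap.comp_apply]
  have hreal := hΩ.setIntegral_fderiv_real (L.contDiff.comp hφ) h
  rw [← L.integral_comp_comm hint,
    ← L.integral_comp_comm (hΩ.integrable_inner_outwardNormal_smul hφ.continuous h)]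
  simpa only [hderiv, map_smul, smul_eq_mul, Function.comp_apply] using hreal

end IsBoundedLipschitz

end GaussGreen

/-! ### The Gauss–Green formula for continuous fields with bounded weak divergence -/

section LocallyEssBounded

variable {E F : Type*} [NormedAddCommGroup E] [MeasureSpace E]

/-- Essential boundedness on bounded sets, i.e. membership in `L^∞_loc` apart from
measurability. -/
def LocallyEssBounded [NormedAddCommGroup F] (g : E → F) : Prop :=
  ∀ R : ℝ, ∃ C : ℝ, ∀ᵐ x, ‖x‖ ≤ R → ‖g x‖ ≤ C

lemma locallyEssBounded_of_continuous [ProperSpace E] [NormedAddCommGroup F] {g : E → F}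
    (hg : Continuous g) : LocallyEssBounded g := fun R => by
  obtain ⟨C, hC⟩ := (isCompact_closedBall (0 : E) R).exists_bound_of_continuousOn hg.continuousOn
  exact ⟨C, Eventually.of_forall fun x hx => hC x (mem_closedBall_zero_iff.2 hx)⟩

lemma locallyEssBounded_of_memLp_top [NormedAddCommGroup F] {g : E → F}
    (hg : MemLp g ⊤) : LocallyEssBounded g := fun _ => by
  have hlt := eLpNorm_exponent_top (f := g) (μ := volume) ▸ hg.eLpNorm_lt_top
  refine ⟨(eLpNormEssSup g volume).toReal, ?_⟩
  filter_upwards [ae_le_eLpNormEssSup (f := g) (μ := volume)] with x hx _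
  rw [← toReal_enorm]
  exact ENNReal.toReal_mono hlt.ne hx

namespace LocallyEssBounded

lemma congr [NormedAddCommGroup F] {f g : E → F} (hf : LocallyEssBounded f)
    (hfg : f =ᵐ[volume] g) : LocallyEssBounded g := fun R => by
  obtain ⟨C, hC⟩ := hf R
  refine ⟨C, ?_⟩
  filter_upwards [hC, hfg] with x hx hfgx
  rwa [← hfgx]

lemma mul [NormedRing F] {f g : E → F} (hf : LocallyEssBounded f)
    (hg : LocallyEssBounded g) : LocallyEssBounded fun x => f x * g x := fun R => by
  obtain ⟨C, hC⟩ := hf R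
  obtain ⟨C', hC'⟩ := hg R
  refine ⟨C * C', ?_⟩
  filter_upwards [hC, hC'] with x hfx hgx hx
  exact norm_mul_le_of_le (hfx hx) (hgx hx)

lemma integrableOn [NormedAddCommGroup F] [BorelSpace E]
    [ProperSpace E] [IsFiniteMeasureOnCompacts (volume : Measure E)] {g : E → F}
    (hg : LocallyEssBounded g) (hgm : AEStronglyMeasurable g volume) {s : Set E}
    (hs : Bornology.IsBounded s) : IntegrableOn g s := by
  obtain ⟨R, hR⟩ := hs.exists_norm_le
  obtain ⟨C, hC⟩ := hg R
  have hball : IntegrableOn g (Metric.closedBall 0 R) := by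
    refine IntegrableOn.of_bound measure_closedBall_lt_top hgm.restrict C ?_
    rw [ae_restrict_iff' measurableSet_closedBall]
    exact hC.mono fun x hx hxR => hx (mem_closedBall_zero_iff.1 hxR)
  exact hball.mono_set fun x hx => mem_closedBall_zero_iff.2 (hR x hx)

lemma locallyIntegrable [NormedAddCommGroup F] [BorelSpace E]
    [ProperSpace E] [IsFiniteMeasureOnCompacts (volume : Measure E)] {g : E → F}
    (hg : LocallyEssBounded g) (hgm : AEStronglyMeasurable g volume) : LocallyIntegrable g :=
  locallyIntegrable_iff.2 fun _ hK => hg.integrableOn hgm hK.isBounded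

end LocallyEssBounded

end LocallyEssBounded

section Mollify

open scoped Convolution

variable {n : ℕ} {F : Type*} [NormedAddCommGroup F] [NormedSpace ℝ F]
  {g : EuclideanSpace ℝ (Fin n) → F}

/-- The convolution of `g` with the normalized bump function `ρ`. -/
def mollify (ρ : ContDiffBump (0 : EuclideanSpace ℝ (Fin n)))
    (g : EuclideanSpace ℝ (Fin n) → F) : EuclideanSpace ℝ (Fin n) → F :=
  ρ.normed volume ⋆[ContinuousLinearMap.lsmul ℝ ℝ, volume] g

lemma mollify_apply (ρ : ContDiffBump (0 : EuclideanSpace ℝ (Fin n)))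
    (g : EuclideanSpace ℝ (Fin n) → F) (x : EuclideanSpace ℝ (Fin n)) :
    mollify ρ g x = ∫ y, ρ.normed volume (x - y) • g y :=
  convolution_eq_swap _

lemma contDiff_mollify (ρ : ContDiffBump (0 : EuclideanSpace ℝ (Fin n)))
    (hg : LocallyIntegrable g) : ContDiff ℝ 1 (mollify ρ g) :=
  ρ.hasCompactSupport_normed.contDiff_convolution_left _ ρ.contDiff_normed hg

lemma norm_mollify_le (ρ : ContDiffBump (0 : EuclideanSpace ℝ (Fin n))) {R C : ℝ}
    (hC : ∀ᵐ x, ‖x‖ ≤ R + ρ.rOut → ‖g x‖ ≤ C) {x : EuclideanSpace ℝ (Fin n)} (hx : ‖x‖ ≤ R) :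
    ‖mollify ρ g x‖ ≤ C := by
  have hint : Integrable fun y => ρ.normed volume (x - y) * C :=
    (ρ.integrable_normed.comp_sub_left x).mul_const C
  have hbound : ∀ᵐ y, ‖ρ.normed volume (x - y) • g y‖ ≤ ρ.normed volume (x - y) * C := by
    filter_upwards [hC] with y hy
    rw [norm_smul, Real.norm_of_nonneg (ρ.nonneg_normed _)]
    by_cases h0 : ρ.normed volume (x - y) = 0
    · simp [h0]
    have hsupp : x - y ∈ Function.support (ρ.normed volume) := h0
    rw [ρ.support_normed_eq, mem_ball_zero_iff, norm_sub_rev] at hsupp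
    refine mul_le_mul_of_nonneg_left (hy ?_) (ρ.nonneg_normed _)
    linarith [norm_sub_norm_le y x]
  calc ‖mollify ρ g x‖ ≤ ∫ y, ρ.normed volume (x - y) * C := by
        rw [mollify_apply]
        exact norm_integral_le_of_norm_le hint hbound
    _ = C := by
        rw [integral_mul_const, integral_sub_left_eq_self (fun y => ρ.normed volume y),
          ρ.integral_normed, one_mul]

lemma fderiv_mollify_apply (ρ : ContDiffBump (0 : EuclideanSpace ℝ (Fin n)))
    (hg : LocallyIntegrable g) (x h : EuclideanSpace ℝ (Fin n)) :
    fderiv ℝ (mollify ρ g) x h = ∫ y, fderiv ℝ (ρ.normed volume) (x - y) h • g y := by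
  have hρc : HasCompactSupport (ρ.normed volume) := ρ.hasCompactSupport_normed
  have hρ : ContDiff ℝ 1 (ρ.normed volume) := ρ.contDiff_normed
  have hexists : ConvolutionExistsAt (fderiv ℝ (ρ.normed volume)) g x
      ((ContinuousLinearMap.lsmul ℝ ℝ).precompL (EuclideanSpace ℝ (Fin n))) volume :=
    (hρc.fderiv ℝ).convolutionExists_left _ (hρ.continuous_fderiv one_ne_zero) hg x
  rw [mollify, (hρc.hasFDerivAt_convolution_left _ hρ hg x).fderiv, convolution_eq_swap,
    ContinuousLinearMap.integral_apply hexists.integrable_swap]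
  rfl

/-- A sequence of bump functions with radii tending to `0`, the ratio of the radii being fixed as
the Lebesgue differentiation theorem requires. -/
def shrinkingBump (n j : ℕ) : ContDiffBump (0 : EuclideanSpace ℝ (Fin n)) :=
  ⟨1 / (2 * ((j : ℝ) + 1)), 1 / ((j : ℝ) + 1), by positivity,
    one_div_lt_one_div_of_lt (by positivity) (by linarith [Nat.cast_add_one_pos (α := ℝ) j])⟩

lemma shrinkingBump_rOut_le (n j : ℕ) : (shrinkingBump n j).rOut ≤ 1 :=
  div_le_one_of_le₀ (by simp) (by positivity)

lemma tendsto_shrinkingBump_rOut (n : ℕ) :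
    Tendsto (fun j => (shrinkingBump n j).rOut) atTop (𝓝 0) :=
  tendsto_one_div_add_atTop_nhds_zero_nat

lemma tendsto_mollify_shrinkingBump [CompleteSpace F] (hg : Continuous g)
    (x : EuclideanSpace ℝ (Fin n)) :
    Tendsto (fun j => mollify (shrinkingBump n j) g x) atTop (𝓝 (g x)) :=
  ContDiffBump.convolution_tendsto_right_of_continuous (tendsto_shrinkingBump_rOut n) hg x

lemma ae_tendsto_mollify_shrinkingBump [CompleteSpace F] (hg : LocallyIntegrable g) :
    ∀ᵐ x, Tendsto (fun j => mollify (shrinkingBump n j) g x) atTop (𝓝 (g x)) := by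
  refine ContDiffBump.ae_convolution_tendsto_right_of_locallyIntegrable (K := 2)
    (tendsto_shrinkingBump_rOut n) (Eventually.of_forall fun j => le_of_eq ?_) hg
  simp only [shrinkingBump]
  field_simp

lemma LocallyEssBounded.exists_norm_mollify_shrinkingBump_le (hg : LocallyEssBounded g) (R : ℝ) :
    ∃ C, ∀ j x, ‖x‖ ≤ R → ‖mollify (shrinkingBump n j) g x‖ ≤ C := by
  obtain ⟨C, hC⟩ := hg (R + 1)
  refine ⟨C, fun j x hx => norm_mollify_le _ (hC.mono fun y hy hyR => hy ?_) hx⟩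
  linarith [shrinkingBump_rOut_le n j]

end Mollify

section WeakDivergence

variable {n : ℕ} {F : Fin n → EuclideanSpace ℝ (Fin n) → ℂ} {g : EuclideanSpace ℝ (Fin n) → ℂ}

/-- `g` is the divergence of the vector field with components `F i`, in the sense of
distributions. -/
def IsWeakDivergence (F : Fin n → EuclideanSpace ℝ (Fin n) → ℂ)
    (g : EuclideanSpace ℝ (Fin n) → ℂ) : Prop :=
  ∀ φ : EuclideanSpace ℝ (Fin n) → ℝ, ContDiff ℝ ∞ φ → HasCompactSupport φ →
    ∫ x, ∑ i, F i x * (partialDeriv i φ x : ℂ) = -∫ x, g x * (φ x : ℂ)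

lemma partialDeriv_comp_const_sub {φ : EuclideanSpace ℝ (Fin n) → ℝ} (hφ : Differentiable ℝ φ)
    (i : Fin n) (x y : EuclideanSpace ℝ (Fin n)) :
    partialDeriv i (fun y => φ (x - y)) y = -partialDeriv i φ (x - y) := by
  have hcomp : HasFDerivAt (fun y => φ (x - y)) _ y :=
    (hφ (x - y)).hasFDerivAt.comp y ((hasFDerivAt_id y).const_sub x)
  rw [partialDeriv, hcomp.fderiv]
  simp [partialDeriv]

lemma continuous_partialDeriv {φ : EuclideanSpace ℝ (Fin n) → ℝ} (hφ : ContDiff ℝ 1 φ)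
    (i : Fin n) : Continuous (partialDeriv i φ) :=
  (hφ.continuous_fderiv one_ne_zero).clm_apply continuous_const

lemma hasCompactSupport_partialDeriv {φ : EuclideanSpace ℝ (Fin n) → ℝ}
    (hc : HasCompactSupport φ) (i : Fin n) : HasCompactSupport (partialDeriv i φ) :=
  hc.fderiv_apply ℝ _

lemma integrable_mul_ofReal_of_hasCompactSupport {f : EuclideanSpace ℝ (Fin n) → ℂ}
    (hf : LocallyIntegrable f) {φ : EuclideanSpace ℝ (Fin n) → ℝ} (hφ : Continuous φ)
    (hc : HasCompactSupport φ) : Integrable fun x => f x * (φ x : ℂ) := by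
  simpa only [Complex.real_smul, mul_comm] using
    hf.integrable_smul_left_of_hasCompactSupport hφ hc

lemma IsWeakDivergence.sum_fderiv_mollify (hF : ∀ i, LocallyIntegrable (F i))
    (hFg : IsWeakDivergence F g) (ρ : ContDiffBump (0 : EuclideanSpace ℝ (Fin n)))
    (x : EuclideanSpace ℝ (Fin n)) :
    ∑ i, fderiv ℝ (mollify ρ (F i)) x (EuclideanSpace.single i 1) = mollify ρ g x := by
  let ψ : EuclideanSpace ℝ (Fin n) → ℝ := fun y => ρ.normed volume (x - y)
  have hψ : ContDiff ℝ ∞ ψ := ρ.contDiff_normed.comp (contDiff_const.sub contDiff_id)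
  have hψc : HasCompactSupport ψ :=
    ρ.hasCompactSupport_normed.comp_homeomorph (Homeomorph.subLeft x)
  have hcomponent (i) : fderiv ℝ (mollify ρ (F i)) x (EuclideanSpace.single i 1) =
      -∫ y, F i y * (partialDeriv i ψ y : ℂ) := by
    rw [fderiv_mollify_apply ρ (hF i), ← integral_neg]
    refine integral_congr_ae (Eventually.of_forall fun y => ?_)
    have hψy : partialDeriv i ψ y = -partialDeriv i (ρ.normed volume) (x - y) :=
      partialDeriv_comp_const_sub (ρ.contDiff_normed.differentiable one_ne_zero) i x y
    simp only [hψy, Complex.real_smul, Complex.ofReal_neg, neg_mul, neg_neg, mul_comm (F i y)]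
    rfl
  have hint (i) : Integrable fun y => F i y * (partialDeriv i ψ y : ℂ) :=
    integrable_mul_ofReal_of_hasCompactSupport (hF i)
      (continuous_partialDeriv (hψ.of_le (by simp)) i) (hasCompactSupport_partialDeriv hψc i)
  simp only [hcomponent]
  rw [Finset.sum_neg_distrib, ← integral_finsetSum _ fun i _ => hint i, hFg _ hψ hψc, neg_neg,
    mollify_apply]
  simp only [ψ, Complex.real_smul, mul_comm]

namespace IsBoundedLipschitz

variable {Ω : Set (EuclideanSpace ℝ (Fin n))}

lemma integrable_sum_mul_outwardNormal (hΩ : IsBoundedLipschitz Ω)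
    (hF : ∀ i, Continuous (F i)) :
    Integrable (fun x => ∑ i, F i x * (outwardNormal Ω x i : ℂ)) (surfaceMeasure Ω) := by
  refine integrable_finsetSum _ fun i _ => ?_
  simpa [EuclideanSpace.inner_single_right, mul_comm] using
    hΩ.integrable_inner_outwardNormal_smul (hF i) (EuclideanSpace.single i 1)

lemma setIntegral_sum_fderiv (hΩ : IsBoundedLipschitz Ω) (hF : ∀ i, ContDiff ℝ 1 (F i)) :
    ∫ x in Ω, ∑ i, fderiv ℝ (F i) x (EuclideanSpace.single i 1) =
      ∫ x, ∑ i, F i x * (outwardNormal Ω x i : ℂ) ∂surfaceMeasure Ω := by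
  have hvol (i) : IntegrableOn (fun x => fderiv ℝ (F i) x (EuclideanSpace.single i 1)) Ω :=
    ((((hF i).continuous_fderiv one_ne_zero).clm_apply
      continuous_const).continuousOn.integrableOn_compact
        hΩ.isBounded.isCompact_closure).mono_set subset_closure
  have hnormal (i) (x) : F i x * (outwardNormal Ω x i : ℂ) =
      inner ℝ (outwardNormal Ω x) (EuclideanSpace.single i 1) • F i x := by
    simp [EuclideanSpace.inner_single_right, mul_comm]
  simp only [hnormal]
  rw [integral_finsetSum _ fun i _ => hvol i, integral_finsetSum _ fun i _ =>
    hΩ.integrable_inner_outwardNormal_smul (hF i).continuous _]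
  exact Finset.sum_congr rfl fun i _ => hΩ.setIntegral_fderiv (hF i) _

lemma tendsto_setIntegral_mollify (hΩ : IsBoundedLipschitz Ω)
    (hgm : AEStronglyMeasurable g volume) (hg : LocallyEssBounded g) :
    Tendsto (fun j => ∫ x in Ω, mollify (shrinkingBump n j) g x) atTop
      (𝓝 (∫ x in Ω, g x)) := by
  have hgl := hg.locallyIntegrable hgm
  obtain ⟨R, hR⟩ := hΩ.isBounded.exists_norm_le
  obtain ⟨C, hC⟩ := hg.exists_norm_mollify_shrinkingBump_le R
  refine tendsto_integral_of_dominated_convergence (fun _ => C)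
    (fun j => (contDiff_mollify _ hgl).continuous.aestronglyMeasurable)
    (integrableOn_const hΩ.isBounded.measure_lt_top.ne) (fun j => ?_)
    (ae_restrict_of_ae (ae_tendsto_mollify_shrinkingBump hgl))
  filter_upwards [ae_restrict_mem hΩ.isOpen.measurableSet] with x hx
  exact hC j x (hR x hx)

lemma tendsto_integral_mollify_mul_outwardNormal (hΩ : IsBoundedLipschitz Ω)
    (hF : ∀ i, Continuous (F i)) :
    Tendsto (fun j => ∫ x, ∑ i, mollify (shrinkingBump n j) (F i) x * (outwardNormal Ω x i : ℂ)
        ∂surfaceMeasure Ω) atTop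
      (𝓝 (∫ x, ∑ i, F i x * (outwardNormal Ω x i : ℂ) ∂surfaceMeasure Ω)) := by
  have := hΩ.isFiniteMeasure_surfaceMeasure
  obtain ⟨R, hR⟩ := hΩ.isCompact_frontier.isBounded.exists_norm_le
  choose C hC using fun i =>
    (locallyEssBounded_of_continuous (hF i)).exists_norm_mollify_shrinkingBump_le R
  have hnormal (x i) : ‖(outwardNormal Ω x i : ℂ)‖ ≤ 1 := by
    rw [Complex.norm_real]
    exact (PiLp.norm_apply_le _ _).trans (norm_outwardNormal_le x)
  refine tendsto_integral_of_dominated_convergence (fun _ => ∑ i, C i)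
    (fun j => (hΩ.integrable_sum_mul_outwardNormal fun i =>
      (contDiff_mollify _ (hF i).locallyIntegrable).continuous).aestronglyMeasurable)
    (integrable_const _) (fun j => ?_) (Eventually.of_forall fun x =>
      tendsto_finsetSum _ fun i _ => (tendsto_mollify_shrinkingBump (hF i) x).mul_const _)
  filter_upwards [ae_restrict_mem isClosed_frontier.measurableSet] with x hx
  refine norm_sum_le_of_le _ fun i _ => ?_
  rw [norm_mul]
  exact (mul_le_of_le_one_right (norm_nonneg _) (hnormal x i)).trans (hC i j x (hR x hx))

theorem integral_sum_mul_outwardNormal (hΩ : IsBoundedLipschitz Ω)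
    (hF : ∀ i, Continuous (F i)) (hgm : AEStronglyMeasurable g volume)
    (hg : LocallyEssBounded g) (hFg : IsWeakDivergence F g) :
    ∫ x, ∑ i, F i x * (outwardNormal Ω x i : ℂ) ∂surfaceMeasure Ω = ∫ x in Ω, g x := by
  have hmollified (j) : ∫ x, ∑ i, mollify (shrinkingBump n j) (F i) x * (outwardNormal Ω x i : ℂ)
      ∂surfaceMeasure Ω = ∫ x in Ω, mollify (shrinkingBump n j) g x := by
    rw [← hΩ.setIntegral_sum_fderiv fun i => contDiff_mollify _ (hF i).locallyIntegrable]
    simp only [hFg.sum_fderiv_mollify fun i => (hF i).locallyIntegrable]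
  have hlim := hΩ.tendsto_integral_mollify_mul_outwardNormal hF
  simp only [hmollified] at hlim
  exact tendsto_nhds_unique hlim (hΩ.tendsto_setIntegral_mollify hgm hg)

end IsBoundedLipschitz

end WeakDivergence

/-! ### The imaginary part of the fundamental solution -/

section PowerSeries

/-- The sequences of coefficients of the everywhere convergent power series. -/
def IsEntireCoeff (a : ℕ → ℝ) : Prop := ∀ s : ℝ, Summable fun m => a m * s ^ m

/-- The sum of the power series with coefficients `a`. -/
def powSeries (a : ℕ → ℝ) (s : ℝ) : ℝ := ∑' m, a m * s ^ m

/-- The coefficients of the derivative of the power series with coefficients `a`. -/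
def derivCoeff (a : ℕ → ℝ) (m : ℕ) : ℝ := (m + 1) * a (m + 1)

namespace IsEntireCoeff

variable {a : ℕ → ℝ}

lemma hasSum (ha : IsEntireCoeff a) (s : ℝ) : HasSum (fun m => a m * s ^ m) (powSeries a s) :=
  (ha s).hasSum

lemma hasFPowerSeriesOnBall (ha : IsEntireCoeff a) :
    HasFPowerSeriesOnBall (powSeries a) (FormalMultilinearSeries.ofScalars ℝ a) 0 ⊤ where
  r_le := by
    refine (FormalMultilinearSeries.radius_eq_top_of_summable_norm _ fun r => ?_).ge
    simpa using (ha r).norm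
  r_pos := ENNReal.zero_lt_top
  hasSum {s} _ := by simpa [FormalMultilinearSeries.ofScalars_apply_eq, mul_comm] using ha.hasSum s

lemma contDiff (ha : IsEntireCoeff a) : ContDiff ℝ ∞ (powSeries a) :=
  contDiff_iff_contDiffAt.2 fun s =>
    (ha.hasFPowerSeriesOnBall.analyticAt_of_mem (by simp)).contDiffAt

lemma hasSum_derivCoeff (ha : IsEntireCoeff a) (s : ℝ) :
    HasSum (fun m => derivCoeff a m * s ^ m) (deriv (powSeries a) s) := by
  have hsum := ha.hasFPowerSeriesOnBall.fderiv.hasSum (y := s) (by simp)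
  simpa [FormalMultilinearSeries.apply_eq_pow_smul_coeff, Scattering.derivCoeff, mul_comm] using
    hsum.mapL (ContinuousLinearMap.apply ℝ ℝ (1 : ℝ))

lemma derivCoeff (ha : IsEntireCoeff a) : IsEntireCoeff (derivCoeff a) := fun s =>
  (ha.hasSum_derivCoeff s).summable

lemma hasDerivAt (ha : IsEntireCoeff a) (s : ℝ) :
    HasDerivAt (powSeries a) (powSeries (Scattering.derivCoeff a) s) s := by
  rw [(ha.derivCoeff.hasSum s).unique (ha.hasSum_derivCoeff s)]
  exact (ha.contDiff.differentiable (by simp) s).hasDerivAt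

end IsEntireCoeff

/-- The coefficients, in powers of the square of the distance to the origin, of the entire radial
solution of `Δw + k²w = 0` in dimension `n` with the value `c` at the origin. -/
def waveCoeff (n : ℕ) (k c : ℝ) (m : ℕ) : ℝ :=
  c * (-k ^ 2) ^ m / ∏ j ∈ Finset.range m, (((j : ℝ) + 1) * (4 * j + 2 * n))

variable {n : ℕ} {k c : ℝ}

lemma waveCoeff_succ (hn : 0 < n) (m : ℕ) :
    ((m : ℝ) + 1) * (4 * m + 2 * n) * waveCoeff n k c (m + 1) = -k ^ 2 * waveCoeff n k c m := by
  have hfactor (j : ℕ) : ((j : ℝ) + 1) * (4 * j + 2 * n) ≠ 0 := by positivity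
  have hprod := Finset.prod_ne_zero_iff.2 fun j (_ : j ∈ Finset.range m) => hfactor j
  rw [waveCoeff, waveCoeff, Finset.prod_range_succ, pow_succ]
  field_simp [hfactor m]

lemma isEntireCoeff_waveCoeff (hn : 0 < n) : IsEntireCoeff (waveCoeff n k c) := by
  intro s
  have hn' : (1 : ℝ) ≤ n := by exact_mod_cast hn
  have hfactorial (m : ℕ) :
      (m.factorial : ℝ) ≤ ∏ j ∈ Finset.range m, (((j : ℝ) + 1) * (4 * j + 2 * n)) := by
    rw [← Finset.prod_range_add_one_eq_factorial]
    push_cast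
    refine Finset.prod_le_prod (fun j _ => by positivity) fun j _ => ?_
    exact le_mul_of_one_le_right (by positivity) (by linarith [Nat.cast_nonneg (α := ℝ) j])
  refine Summable.of_norm_bounded
    ((Real.summable_pow_div_factorial (k ^ 2 * |s|)).mul_left |c|) fun m => ?_
  have hpos : (0 : ℝ) < m.factorial := by positivity
  rw [waveCoeff, Real.norm_eq_abs, abs_mul, abs_div, abs_mul, abs_pow, abs_pow, abs_neg,
    abs_of_nonneg (sq_nonneg k), abs_of_pos (hpos.trans_le (hfactorial m)), mul_pow]
  calc |c| * (k ^ 2) ^ m / (∏ j ∈ Finset.range m, (((j : ℝ) + 1) * (4 * j + 2 * n))) * |s| ^ m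
      ≤ |c| * (k ^ 2) ^ m / m.factorial * |s| ^ m := by gcongr; exact hfactorial m
    _ = |c| * ((k ^ 2) ^ m * |s| ^ m / m.factorial) := by ring

/-- This is the Helmholtz equation for a radial function, in the variable `s = |x|²`. -/
lemma powSeries_waveCoeff_ode (hn : 0 < n) (s : ℝ) :
    4 * s * powSeries (derivCoeff (derivCoeff (waveCoeff n k c))) s +
      2 * n * powSeries (derivCoeff (waveCoeff n k c)) s =
        -k ^ 2 * powSeries (waveCoeff n k c) s := by
  set a := waveCoeff n k c
  have ha : IsEntireCoeff a := isEntireCoeff_waveCoeff hn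
  have hsecond : HasSum (fun m : ℕ => (m : ℝ) * derivCoeff a m * s ^ m)
      (s * powSeries (derivCoeff (derivCoeff a)) s) := by
    rw [← hasSum_nat_add_iff' 1]
    simp only [Finset.range_one, Finset.sum_singleton, CharP.cast_eq_zero, zero_mul, sub_zero]
    refine ((ha.derivCoeff.derivCoeff.hasSum s).mul_left s).congr_fun fun m => ?_
    rw [derivCoeff.eq_def (derivCoeff a)]
    push_cast
    ring
  have hleft := (hsecond.mul_left 4).add ((ha.derivCoeff.hasSum s).mul_left (2 * (n : ℝ)))
  have hterm (m : ℕ) : 4 * ((m : ℝ) * derivCoeff a m * s ^ m) +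
      2 * n * (derivCoeff a m * s ^ m) = -k ^ 2 * (a m * s ^ m) := by
    rw [← mul_assoc (-k ^ 2), ← waveCoeff_succ hn m, derivCoeff]
    ring
  simp only [hterm] at hleft
  rw [← hleft.unique ((ha.hasSum s).mul_left (-k ^ 2))]
  ring

end PowerSeries

section RadialWave

variable {n : ℕ} {k c : ℝ}

/-- The Laplacian of a real function, as the sum of its pure second partial derivatives. -/
def laplace (φ : EuclideanSpace ℝ (Fin n) → ℝ) (x : EuclideanSpace ℝ (Fin n)) : ℝ :=
  ∑ i, partialDeriv i (partialDeriv i φ) x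

lemma partialDeriv_radial {h h' : ℝ → ℝ} (hh : ∀ s, HasDerivAt h (h' s) s) (i : Fin n)
    (z x : EuclideanSpace ℝ (Fin n)) :
    partialDeriv i (fun x => h (‖x - z‖ ^ 2)) x = h' (‖x - z‖ ^ 2) * (2 * (x i - z i)) := by
  have hcomp : HasFDerivAt (fun x : EuclideanSpace ℝ (Fin n) => h (‖x - z‖ ^ 2)) _ x :=
    (hh (‖x - z‖ ^ 2)).comp_hasFDerivAt x ((hasFDerivAt_id x).sub_const z).norm_sq
  rw [partialDeriv, hcomp.fderiv]
  simp [EuclideanSpace.inner_single_right]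

lemma partialDeriv_partialDeriv_radial {h h' h'' : ℝ → ℝ} (hh : ∀ s, HasDerivAt h (h' s) s)
    (hh' : ∀ s, HasDerivAt h' (h'' s) s) (i : Fin n) (z x : EuclideanSpace ℝ (Fin n)) :
    partialDeriv i (partialDeriv i fun x => h (‖x - z‖ ^ 2)) x =
      4 * h'' (‖x - z‖ ^ 2) * (x i - z i) ^ 2 + 2 * h' (‖x - z‖ ^ 2) := by
  have hfirst : partialDeriv i (fun x : EuclideanSpace ℝ (Fin n) => h (‖x - z‖ ^ 2)) = fun x =>
      h' (‖x - z‖ ^ 2) * (2 * (x i - z i)) := funext (partialDeriv_radial hh i z)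
  have hradial : DifferentiableAt ℝ
      (fun x : EuclideanSpace ℝ (Fin n) => h' (‖x - z‖ ^ 2)) x :=
    (hh' _).differentiableAt.comp x
      ((differentiableAt_id.sub (differentiableAt_const z)).norm_sq ℝ)
  have hlinear : HasFDerivAt (fun x : EuclideanSpace ℝ (Fin n) => 2 * (x i - z i))
      ((2 : ℝ) • (EuclideanSpace.proj i : EuclideanSpace ℝ (Fin n) →L[ℝ] ℝ)) x :=
    ((EuclideanSpace.proj i : EuclideanSpace ℝ (Fin n) →L[ℝ] ℝ).hasFDerivAt.sub_const
      (z i)).const_mul 2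
  have hsecond := partialDeriv_radial hh' i z x
  rw [partialDeriv] at hsecond ⊢
  rw [hfirst, (hradial.hasFDerivAt.fun_mul hlinear).fderiv]
  simp only [add_apply, smul_apply, smul_eq_mul, hsecond, PiLp.proj_apply,
    PiLp.single_apply, if_true]
  ring

lemma laplace_radial {h h' h'' : ℝ → ℝ} (hh : ∀ s, HasDerivAt h (h' s) s)
    (hh' : ∀ s, HasDerivAt h' (h'' s) s) (z x : EuclideanSpace ℝ (Fin n)) :
    laplace (fun x => h (‖x - z‖ ^ 2)) x =
      4 * ‖x - z‖ ^ 2 * h'' (‖x - z‖ ^ 2) + 2 * n * h' (‖x - z‖ ^ 2) := by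
  have hnorm : ∑ i, (x i - z i) ^ 2 = ‖x - z‖ ^ 2 :=
    (EuclideanSpace.real_norm_sq_eq (x - z)).symm
  simp only [laplace, partialDeriv_partialDeriv_radial hh hh', Finset.sum_add_distrib,
    ← Finset.mul_sum, hnorm, Finset.sum_const, Finset.card_univ, Fintype.card_fin, nsmul_eq_mul]
  ring

/-- The entire radial solution of the Helmholtz equation `Δw + k²w = 0` centred at `z`, with
`w(z) = c`. -/
def radialWave (k c : ℝ) (z x : EuclideanSpace ℝ (Fin n)) : ℝ :=
  powSeries (waveCoeff n k c) (‖x - z‖ ^ 2)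

lemma contDiff_radialWave (hn : 0 < n) (z : EuclideanSpace ℝ (Fin n)) :
    ContDiff ℝ ∞ (radialWave k c z) :=
  (isEntireCoeff_waveCoeff hn).contDiff.comp ((contDiff_id.sub contDiff_const).norm_sq ℝ)

lemma laplace_radialWave (hn : 0 < n) (z x : EuclideanSpace ℝ (Fin n)) :
    laplace (radialWave k c z) x = -k ^ 2 * radialWave k c z x := by
  have ha := isEntireCoeff_waveCoeff (k := k) (c := c) hn
  rw [radialWave, ← powSeries_waveCoeff_ode hn]
  exact laplace_radial ha.hasDerivAt ha.derivCoeff.hasDerivAt z x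

lemma waveCoeff_two (k c : ℝ) (m : ℕ) :
    waveCoeff 2 k c m = c * (-k ^ 2) ^ m / (4 ^ m * (m.factorial : ℝ) ^ 2) := by
  rw [waveCoeff]
  congr 1
  induction m with
  | zero => simp
  | succ m ih =>
    rw [Finset.prod_range_succ, ih, Nat.factorial_succ]
    push_cast
    ring

lemma waveCoeff_three (k c : ℝ) (m : ℕ) :
    waveCoeff 3 k c m = c * (-k ^ 2) ^ m / ((2 * m + 1).factorial : ℝ) := by
  rw [waveCoeff]
  congr 1
  induction m with
  | zero => simp
  | succ m ih =>
    rw [Finset.prod_range_succ, ih, show 2 * (m + 1) + 1 = 2 * m + 1 + 1 + 1 by ring,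
      Nat.factorial_succ (2 * m + 1 + 1), Nat.factorial_succ (2 * m + 1)]
    push_cast
    ring

lemma powSeries_waveCoeff_two (k c r : ℝ) :
    powSeries (waveCoeff 2 k c) (r ^ 2) = c * besselJ0 (k * r) := by
  rw [besselJ0, powSeries, ← tsum_mul_left]
  refine tsum_congr fun m => ?_
  rw [waveCoeff_two, neg_pow (k ^ 2), div_pow, mul_pow, pow_mul (2 : ℝ), pow_mul k, pow_mul r]
  norm_num
  ring

lemma hasSum_sinc (t : ℝ) :
    HasSum (fun m : ℕ => (-1 : ℝ) ^ m * t ^ (2 * m) / ((2 * m + 1).factorial : ℝ))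
      (Real.sinc t) := by
  by_cases ht : t = 0
  · subst ht
    simpa using hasSum_single (f := fun m : ℕ =>
      (-1 : ℝ) ^ m * (0 : ℝ) ^ (2 * m) / ((2 * m + 1).factorial : ℝ)) 0 fun m hm => by simp [hm]
  · rw [Real.sinc_of_ne_zero ht]
    refine ((Real.hasSum_sin t).div_const t).congr_fun fun m => ?_
    rw [eq_div_iff ht, pow_succ]
    ring

lemma powSeries_waveCoeff_three (k c r : ℝ) :
    powSeries (waveCoeff 3 k c) (r ^ 2) = c * Real.sinc (k * r) := by
  refine HasSum.tsum_eq (((hasSum_sinc (k * r)).mul_left c).congr_fun fun m => ?_)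
  rw [waveCoeff_three, neg_pow (k ^ 2), mul_pow, pow_mul k, pow_mul r]
  ring

lemma im_green_eq_two (hn : n = 2) (k : ℝ) (x z : EuclideanSpace ℝ (Fin n)) :
    (green k x z).im = 1 / 4 * besselJ0 (k * ‖x - z‖) := by
  rw [green, if_pos hn, hankel0]
  simp [Complex.mul_im]

lemma im_green_eq_three (hn : n = 3) (k : ℝ) {x z : EuclideanSpace ℝ (Fin n)} (hxz : x ≠ z) :
    (green k x z).im = k / (4 * Real.pi) * Real.sinc (k * ‖x - z‖) := by
  have hr : ‖x - z‖ ≠ 0 := norm_ne_zero_iff.2 (sub_ne_zero.2 hxz)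
  have hexponent : Complex.I * (k : ℂ) * (‖x - z‖ : ℂ) = ((k * ‖x - z‖ : ℝ) : ℂ) * Complex.I := by
    push_cast
    ring
  have hdenom : 4 * (Real.pi : ℂ) * (‖x - z‖ : ℂ) = ((4 * Real.pi * ‖x - z‖ : ℝ) : ℂ) := by
    push_cast
    ring
  rw [green, if_neg (by omega), if_pos hn, hexponent, hdenom, Complex.div_ofReal_im,
    Complex.exp_ofReal_mul_I_im]
  rcases eq_or_ne k 0 with rfl | hk
  · simp
  · rw [Real.sinc_of_ne_zero (mul_ne_zero hk hr)]
    field_simp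

/-- The value at `x = z` of the smooth extension of `Im Φ(·, z)`, for `n = 2` and `n = 3`. -/
def greenConst (n : ℕ) (k : ℝ) : ℝ := if n = 2 then 1 / 4 else k / (4 * Real.pi)

lemma im_green_eq_radialWave (hn : n = 2 ∨ n = 3) (k : ℝ) {x z : EuclideanSpace ℝ (Fin n)}
    (hxz : x ≠ z) : (green k x z).im = radialWave k (greenConst n k) z x := by
  rcases hn with rfl | rfl
  · rw [im_green_eq_two rfl, radialWave, powSeries_waveCoeff_two, greenConst, if_pos rfl]
  · rw [im_green_eq_three rfl k hxz, radialWave, powSeries_waveCoeff_three, greenConst,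
      if_neg (by norm_num)]

end RadialWave

/-! ### Interior regularity for the Poisson equation in dimension at most three -/

section Cutoff

/-- A smooth nonincreasing function with value `1` at `0`, vanishing on `[1, ∞)`. -/
def cutoff (s : ℝ) : ℝ := Real.smoothTransition (1 - s)

lemma contDiff_cutoff : ContDiff ℝ ∞ cutoff :=
  Real.smoothTransition.contDiff.comp (contDiff_const.sub contDiff_id)

lemma contDiff_deriv_cutoff : ContDiff ℝ ∞ (deriv cutoff) :=
  (contDiff_infty_iff_deriv.1 contDiff_cutoff).2

lemma contDiff_deriv_deriv_cutoff : ContDiff ℝ ∞ (deriv (deriv cutoff)) :=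
  (contDiff_infty_iff_deriv.1 contDiff_deriv_cutoff).2

lemma hasDerivAt_cutoff (s : ℝ) : HasDerivAt cutoff (deriv cutoff s) s :=
  (contDiff_cutoff.differentiable (by simp) s).hasDerivAt

lemma hasDerivAt_deriv_cutoff (s : ℝ) : HasDerivAt (deriv cutoff) (deriv (deriv cutoff) s) s :=
  (contDiff_deriv_cutoff.differentiable (by simp) s).hasDerivAt

lemma cutoff_nonneg (s : ℝ) : 0 ≤ cutoff s := Real.smoothTransition.nonneg _

lemma cutoff_le_one (s : ℝ) : cutoff s ≤ 1 := Real.smoothTransition.le_one _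

lemma cutoff_eq_zero {s : ℝ} (hs : 1 ≤ s) : cutoff s = 0 :=
  Real.smoothTransition.zero_of_nonpos (by linarith)

lemma deriv_eq_zero_of_eqOn_Ioi {h : ℝ → ℝ} {a : ℝ} (hh : ∀ s, a < s → h s = 0) {s : ℝ}
    (hs : a < s) : deriv h s = 0 := by
  have hzero : h =ᶠ[𝓝 s] fun _ => 0 := (lt_mem_nhds hs).mono hh
  rw [hzero.deriv_eq, deriv_const]

lemma deriv_cutoff_eq_zero {s : ℝ} (hs : 1 < s) : deriv cutoff s = 0 :=
  deriv_eq_zero_of_eqOn_Ioi (fun _ ht => cutoff_eq_zero ht.le) hs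

lemma deriv_deriv_cutoff_eq_zero {s : ℝ} (hs : 1 < s) : deriv (deriv cutoff) s = 0 :=
  deriv_eq_zero_of_eqOn_Ioi (fun _ ht => deriv_cutoff_eq_zero ht) hs

lemma deriv_cutoff_nonpos (s : ℝ) : deriv cutoff s ≤ 0 :=
  have hanti : Antitone cutoff := fun _ _ hst => Real.smoothTransition.monotone (by linarith)
  hanti.deriv_nonpos

lemma exists_deriv_cutoff_ne_zero : ∃ s : ℝ, 0 < s ∧ deriv cutoff s ≠ 0 := by
  obtain ⟨s, hs, hslope⟩ := exists_deriv_eq_slope cutoff zero_lt_one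
    contDiff_cutoff.continuous.continuousOn
    (contDiff_cutoff.differentiable (by simp)).differentiableOn
  refine ⟨s, hs.1, ?_⟩
  rw [hslope, cutoff_eq_zero le_rfl, cutoff, sub_zero, Real.smoothTransition.one]
  norm_num

lemma exists_lipschitzWith_cutoff_sq : ∃ L : ℝ≥0, LipschitzWith L fun s : ℝ => cutoff (s ^ 2) := by
  refine ContDiff.lipschitzWith_of_hasCompactSupport (𝕂 := ℝ) (n := ∞)
    (HasCompactSupport.intro (isCompact_closedBall 0 1) fun s hs => cutoff_eq_zero ?_)
    (contDiff_cutoff.comp (contDiff_id.pow 2)) (by simp)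
  rw [mem_closedBall_zero_iff, Real.norm_eq_abs, not_le] at hs
  exact (one_lt_sq_iff_one_lt_abs s).2 hs |>.le

end Cutoff

section CutoffKernel

variable {n : ℕ}

/-- A multiple of the mollification kernel at scale `1 / l` built from the cutoff function. Taking
the derivative of `cutoff` as the profile makes the derivative in `l` of the kernel a Laplacian. -/
def cutoffKernel (l : ℝ) (v : EuclideanSpace ℝ (Fin n)) : ℝ :=
  l ^ n * deriv cutoff (l ^ 2 * ‖v‖ ^ 2)

/-- The derivative of `cutoffKernel l v` with respect to `l`. -/
def cutoffKernelDeriv (l : ℝ) (v : EuclideanSpace ℝ (Fin n)) : ℝ :=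
  n * l ^ (n - 1) * deriv cutoff (l ^ 2 * ‖v‖ ^ 2) +
    l ^ n * (deriv (deriv cutoff) (l ^ 2 * ‖v‖ ^ 2) * (2 * l * ‖v‖ ^ 2))

lemma hasDerivAt_cutoffKernel (l : ℝ) (v : EuclideanSpace ℝ (Fin n)) :
    HasDerivAt (fun l => cutoffKernel l v) (cutoffKernelDeriv l v) l := by
  have hsq : HasDerivAt (fun l : ℝ => l ^ 2 * ‖v‖ ^ 2) (2 * l * ‖v‖ ^ 2) l := by
    simpa using (hasDerivAt_pow 2 l).mul_const (‖v‖ ^ 2)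
  exact (hasDerivAt_pow n l).fun_mul ((hasDerivAt_deriv_cutoff _).comp l hsq)

lemma one_lt_sq_mul_sq {l a : ℝ} (hl : 0 < l) (ha : 1 / l < a) : 1 < l ^ 2 * a ^ 2 := by
  rw [← mul_pow]
  exact one_lt_pow₀ ((div_lt_iff₀' hl).1 ha) two_ne_zero

lemma cutoffKernel_eq_zero {l : ℝ} (hl : 0 < l) {v : EuclideanSpace ℝ (Fin n)}
    (hv : 1 / l < ‖v‖) : cutoffKernel l v = 0 := by
  rw [cutoffKernel, deriv_cutoff_eq_zero (one_lt_sq_mul_sq hl hv), mul_zero]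

lemma cutoffKernelDeriv_eq_zero {l : ℝ} (hl : 0 < l) {v : EuclideanSpace ℝ (Fin n)}
    (hv : 1 / l < ‖v‖) : cutoffKernelDeriv l v = 0 := by
  rw [cutoffKernelDeriv, deriv_cutoff_eq_zero (one_lt_sq_mul_sq hl hv),
    deriv_deriv_cutoff_eq_zero (one_lt_sq_mul_sq hl hv)]
  ring

lemma contDiff_cutoffKernel (l : ℝ) :
    ContDiff ℝ ∞ (cutoffKernel l : EuclideanSpace ℝ (Fin n) → ℝ) :=
  contDiff_const.mul (contDiff_deriv_cutoff.comp (contDiff_const.mul (contDiff_id.norm_sq ℝ)))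

lemma hasCompactSupport_cutoffKernel {l : ℝ} (hl : 0 < l) :
    HasCompactSupport (cutoffKernel l : EuclideanSpace ℝ (Fin n) → ℝ) :=
  HasCompactSupport.intro (isCompact_closedBall 0 (1 / l)) fun v hv =>
    cutoffKernel_eq_zero hl (by rwa [mem_closedBall_zero_iff, not_le] at hv)

lemma continuous_cutoffKernelDeriv :
    Continuous fun p : ℝ × EuclideanSpace ℝ (Fin n) => cutoffKernelDeriv p.1 p.2 := by
  have hderiv := contDiff_deriv_cutoff.continuous
  have hderiv_deriv := contDiff_deriv_deriv_cutoff.continuous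
  unfold cutoffKernelDeriv
  fun_prop

lemma cutoffKernelDeriv_eq_laplace {l : ℝ} (hn : 0 < n) (hl : l ≠ 0)
    (x y : EuclideanSpace ℝ (Fin n)) :
    cutoffKernelDeriv l (x - y) = l ^ n / (2 * l ^ 3) *
      laplace (fun y => cutoff (l ^ 2 * ‖y - x‖ ^ 2)) y := by
  have hscale (s : ℝ) : HasDerivAt (fun s => l ^ 2 * s) (l ^ 2) s := by
    simpa using (hasDerivAt_id s).const_mul (l ^ 2)
  have hfirst (s : ℝ) : HasDerivAt (fun s => cutoff (l ^ 2 * s))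
      (deriv cutoff (l ^ 2 * s) * l ^ 2) s :=
    (hasDerivAt_cutoff (l ^ 2 * s)).comp s (hscale s)
  have hsecond (s : ℝ) : HasDerivAt (fun s => deriv cutoff (l ^ 2 * s) * l ^ 2)
      (deriv (deriv cutoff) (l ^ 2 * s) * l ^ 2 * l ^ 2) s :=
    ((hasDerivAt_deriv_cutoff (l ^ 2 * s)).comp s (hscale s)).mul_const (l ^ 2)
  rw [laplace_radial hfirst hsecond, cutoffKernelDeriv, norm_sub_rev x y,
    ← pow_sub_one_mul hn.ne' l]
  field_simp
  ring

lemma cutoffKernel_eq_pow_mul (l : ℝ) (v : EuclideanSpace ℝ (Fin n)) :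
    cutoffKernel l v = l ^ n * cutoffKernel 1 (l • v) := by
  simp only [cutoffKernel, norm_smul, Real.norm_eq_abs, mul_pow, sq_abs, one_pow, one_mul]

lemma exists_abs_cutoffKernel_le (n : ℕ) : ∃ C : ℝ, ∀ (l : ℝ) (v : EuclideanSpace ℝ (Fin n)),
    0 ≤ l → |cutoffKernel l v| ≤ C * l ^ n := by
  obtain ⟨C, hC⟩ := (contDiff_cutoffKernel (n := n) 1).continuous.bounded_above_of_compact_support
    (hasCompactSupport_cutoffKernel one_pos)
  refine ⟨C, fun l v hl => ?_⟩
  rw [cutoffKernel_eq_pow_mul, abs_mul, abs_of_nonneg (pow_nonneg hl n), mul_comm]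
  exact mul_le_mul_of_nonneg_right (hC _) (pow_nonneg hl n)

/-- The total mass of `cutoffKernel l`, which does not depend on `l > 0`. -/
def cutoffMass (n : ℕ) : ℝ := ∫ v : EuclideanSpace ℝ (Fin n), cutoffKernel 1 v

lemma integral_cutoffKernel {l : ℝ} (hl : 0 < l) :
    ∫ v : EuclideanSpace ℝ (Fin n), cutoffKernel l v = cutoffMass n := by
  simp_rw [cutoffKernel_eq_pow_mul l]
  rw [integral_const_mul, Measure.integral_comp_smul volume (fun v => cutoffKernel 1 v) l,
    finrank_euclideanSpace_fin, abs_of_pos (by positivity), smul_eq_mul,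
    mul_inv_cancel_left₀ (by positivity), cutoffMass]

lemma cutoffMass_ne_zero (hn : 0 < n) : cutoffMass n ≠ 0 := by
  obtain ⟨s, hs, hderiv⟩ := exists_deriv_cutoff_ne_zero
  have hpos := Continuous.integral_pos_of_hasCompactSupport_nonneg_nonzero (μ := volume)
    (f := fun v : EuclideanSpace ℝ (Fin n) => -cutoffKernel 1 v)
    (x := EuclideanSpace.single ⟨0, hn⟩ (Real.sqrt s))
    (contDiff_cutoffKernel 1).continuous.neg
    (HasCompactSupport.neg (hasCompactSupport_cutoffKernel one_pos))
    (fun v => by simpa [cutoffKernel] using deriv_cutoff_nonpos _)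
    (by simpa [cutoffKernel, Real.sq_sqrt hs.le] using hderiv)
  rw [integral_neg] at hpos
  exact (neg_pos.1 hpos).ne

end CutoffKernel

section CutoffMollify

variable {n : ℕ} {F : Type*} [NormedAddCommGroup F] [NormedSpace ℝ F]
  {u f : EuclideanSpace ℝ (Fin n) → F}

/-- The convolution of `u` with `cutoffKernel l`. -/
def cutoffMollify (u : EuclideanSpace ℝ (Fin n) → F) (l : ℝ) (x : EuclideanSpace ℝ (Fin n)) : F :=
  ∫ y, cutoffKernel l (x - y) • u y

/-- The integral of `f` against a smooth cutoff to the ball of radius `1 / l` about `x`. -/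
def cutoffIntegral (f : EuclideanSpace ℝ (Fin n) → F) (l : ℝ) (x : EuclideanSpace ℝ (Fin n)) : F :=
  ∫ y, cutoff (l ^ 2 * ‖y - x‖ ^ 2) • f y

/-- `Δu = f` in the sense of distributions. -/
def IsDistribLaplacian (u f : EuclideanSpace ℝ (Fin n) → F) : Prop :=
  ∀ φ : EuclideanSpace ℝ (Fin n) → ℝ, ContDiff ℝ ∞ φ → HasCompactSupport φ →
    ∫ y, laplace φ y • u y = ∫ y, φ y • f y

lemma contDiff_cutoffMollify (hu : LocallyIntegrable u) {l : ℝ} (hl : 0 < l) :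
    ContDiff ℝ 1 (cutoffMollify u l) := by
  have hconv := (hasCompactSupport_cutoffKernel (n := n) hl).contDiff_convolution_left (𝕜 := ℝ)
    (μ := volume) (n := 1) (ContinuousLinearMap.lsmul ℝ ℝ)
    ((contDiff_cutoffKernel l).of_le (mod_cast le_top)) hu
  convert! hconv using 1
  ext x
  rw [convolution_eq_swap]
  rfl

lemma cutoff_eq_zero_of_notMem_closedBall {l : ℝ} (hl : 0 < l) {x y : EuclideanSpace ℝ (Fin n)}
    (hy : y ∉ Metric.closedBall x (1 / l)) : cutoff (l ^ 2 * ‖y - x‖ ^ 2) = 0 := by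
  rw [Metric.mem_closedBall, dist_eq_norm, not_le] at hy
  exact cutoff_eq_zero (one_lt_sq_mul_sq hl hy).le

lemma contDiff_cutoff_norm_sub (l : ℝ) (x : EuclideanSpace ℝ (Fin n)) :
    ContDiff ℝ ∞ fun y => cutoff (l ^ 2 * ‖y - x‖ ^ 2) :=
  contDiff_cutoff.comp (contDiff_const.mul ((contDiff_id.sub contDiff_const).norm_sq ℝ))

lemma hasCompactSupport_cutoff_norm_sub {l : ℝ} (hl : 0 < l) (x : EuclideanSpace ℝ (Fin n)) :
    HasCompactSupport fun y => cutoff (l ^ 2 * ‖y - x‖ ^ 2) :=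
  HasCompactSupport.intro (isCompact_closedBall x (1 / l)) fun _ hy =>
    cutoff_eq_zero_of_notMem_closedBall hl hy

lemma exists_integrable_norm_cutoffKernelDeriv_smul_le (hu : LocallyIntegrable u) {l : ℝ}
    (hl : 0 < l) (x : EuclideanSpace ℝ (Fin n)) :
    ∃ bound : EuclideanSpace ℝ (Fin n) → ℝ, Integrable bound ∧
      ∀ y, ∀ l' ∈ Set.Ioo (l / 2) (2 * l), ‖cutoffKernelDeriv l' (x - y) • u y‖ ≤ bound y := by
  obtain ⟨C, hC⟩ := ((isCompact_Icc (a := l / 2) (b := 2 * l)).prod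
    (isCompact_closedBall (0 : EuclideanSpace ℝ (Fin n)) (2 / l))).exists_bound_of_continuousOn
      continuous_cutoffKernelDeriv.continuousOn
  refine ⟨(Metric.closedBall x (2 / l)).indicator fun y => C * ‖u y‖,
    (integrable_indicator_iff measurableSet_closedBall).2
      ((hu.integrableOn_isCompact (isCompact_closedBall x (2 / l))).norm.const_mul C),
    fun y l' hl' => ?_⟩
  have hl'0 : 0 < l' := (half_pos hl).trans hl'.1
  by_cases hy : y ∈ Metric.closedBall x (2 / l)
  · rw [Set.indicator_of_mem hy, norm_smul]
    refine mul_le_mul_of_nonneg_right (hC (l', x - y) ⟨⟨hl'.1.le, hl'.2.le⟩, ?_⟩) (norm_nonneg _)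
    rwa [mem_closedBall_zero_iff, ← dist_eq_norm, dist_comm]
  · rw [Set.indicator_of_notMem hy]
    rw [Metric.mem_closedBall, dist_comm, dist_eq_norm, not_le] at hy
    have hscale : 1 / l' < 2 / l := by
      rw [div_lt_div_iff₀ hl'0 hl]
      linarith [hl'.1]
    rw [cutoffKernelDeriv_eq_zero hl'0 (hscale.trans hy), zero_smul, norm_zero]

lemma hasDerivAt_cutoffMollify_integral (hu : LocallyIntegrable u) {l : ℝ} (hl : 0 < l)
    (x : EuclideanSpace ℝ (Fin n)) :
    HasDerivAt (fun l => cutoffMollify u l x) (∫ y, cutoffKernelDeriv l (x - y) • u y) l := by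
  obtain ⟨bound, hbound, hle⟩ := exists_integrable_norm_cutoffKernelDeriv_smul_le hu hl x
  have hkernel (l' : ℝ) : Continuous fun y => cutoffKernel l' (x - y) :=
    (contDiff_cutoffKernel l').continuous.comp (continuous_const.sub continuous_id)
  have hkernelDeriv : Continuous fun y => cutoffKernelDeriv l (x - y) :=
    continuous_cutoffKernelDeriv.comp (by fun_prop : Continuous fun y => (l, x - y))
  exact (hasDerivAt_integral_of_dominated_loc_of_deriv_le (μ := volume)
    (Ioo_mem_nhds (by linarith) (by linarith) : Set.Ioo (l / 2) (2 * l) ∈ 𝓝 l)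
    (Eventually.of_forall fun l' =>
      (hkernel l').aestronglyMeasurable.smul hu.aestronglyMeasurable)
    (hu.integrable_smul_left_of_hasCompactSupport (hkernel l)
      ((hasCompactSupport_cutoffKernel hl).comp_homeomorph (Homeomorph.subLeft x)))
    (hkernelDeriv.aestronglyMeasurable.smul hu.aestronglyMeasurable)
    (Eventually.of_forall hle) hbound
    (Eventually.of_forall fun y l' _ => (hasDerivAt_cutoffKernel l' (x - y)).smul_const (u y))).2

lemma IsDistribLaplacian.hasDerivAt_cutoffMollify (hn : 0 < n) (hu : LocallyIntegrable u)
    (huf : IsDistribLaplacian u f) {l : ℝ} (hl : 0 < l) (x : EuclideanSpace ℝ (Fin n)) :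
    HasDerivAt (fun l => cutoffMollify u l x)
      ((l ^ n / (2 * l ^ 3)) • cutoffIntegral f l x) l := by
  convert! hasDerivAt_cutoffMollify_integral hu hl x using 1
  rw [cutoffIntegral, ← huf _ (contDiff_cutoff_norm_sub l x)
    (hasCompactSupport_cutoff_norm_sub hl x), ← integral_smul]
  simp only [cutoffKernelDeriv_eq_laplace hn hl.ne', mul_smul]

lemma norm_sub_le_of_hasDerivAt_pow_smul {Φ I : ℝ → F}
    (hΦ : ∀ l : ℝ, 0 < l → HasDerivAt Φ ((l ^ n / (2 * l ^ 3)) • I l) l) {a B : ℝ} (ha : 0 < a)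
    (hB : ∀ l : ℝ, a ≤ l → l ^ n / l ^ 3 * ‖I l‖ ≤ B) :
    ‖Φ (4 * a) - Φ a‖ ≤ 3 / 2 * B * a := by
  have hle : a ≤ 4 * a := by linarith
  have hderiv : ∀ l ∈ Set.Icc a (4 * a), ‖(l ^ n / (2 * l ^ 3)) • I l‖ ≤ B / 2 := by
    intro l hl
    have hl0 : 0 < l := ha.trans_le hl.1
    calc ‖(l ^ n / (2 * l ^ 3)) • I l‖ = l ^ n / l ^ 3 * ‖I l‖ / 2 := by
          rw [norm_smul, Real.norm_of_nonneg (by positivity)]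
          field_simp
      _ ≤ B / 2 := by gcongr; exact hB l hl.1
  refine ((convex_Icc a (4 * a)).norm_image_sub_le_of_norm_hasDerivWithin_le
    (fun l hl => (hΦ l (ha.trans_le hl.1)).hasDerivWithinAt) hderiv (Set.left_mem_Icc.2 hle)
    (Set.right_mem_Icc.2 hle)).trans_eq ?_
  rw [Real.norm_of_nonneg (by linarith)]
  ring

end CutoffMollify

section Convergence

variable {n : ℕ} {F : Type*} [NormedAddCommGroup F] [NormedSpace ℝ F]
  {u : EuclideanSpace ℝ (Fin n) → F}

/-- The volume of the unit ball of `ℝⁿ`. -/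
def unitBallVolume (n : ℕ) : ℝ := volume.real (Metric.ball (0 : EuclideanSpace ℝ (Fin n)) 1)

lemma unitBallVolume_pos (n : ℕ) : 0 < unitBallVolume n :=
  ENNReal.toReal_pos (Metric.measure_ball_pos volume 0 one_pos).ne' measure_ball_lt_top.ne

lemma volumeReal_closedBall_one_div (x : EuclideanSpace ℝ (Fin n)) {l : ℝ} (hl : 0 < l) :
    volume.real (Metric.closedBall x (1 / l)) = unitBallVolume n / l ^ n := by
  rw [Measure.addHaar_real_closedBall _ _ (by positivity), finrank_euclideanSpace_fin,
    one_div_pow, one_div_mul_eq_div, unitBallVolume]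

lemma exists_abs_cutoffKernel_le_div_volumeReal (n : ℕ) :
    ∃ C : ℝ, ∀ (l : ℝ) (x y : EuclideanSpace ℝ (Fin n)), 0 < l →
      |cutoffKernel l (x - y)| ≤ C / volume.real (Metric.closedBall x (1 / l)) := by
  obtain ⟨C, hC⟩ := exists_abs_cutoffKernel_le n
  refine ⟨C * unitBallVolume n, fun l x y hl => (hC l (x - y) hl.le).trans_eq ?_⟩
  rw [volumeReal_closedBall_one_div x hl]
  field_simp [(unitBallVolume_pos n).ne']

lemma tendsto_one_div_four_pow :
    Tendsto (fun j : ℕ => 1 / (4 : ℝ) ^ j) atTop (𝓝[>] 0) := by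
  simp_rw [← one_div_pow]
  exact tendsto_pow_atTop_nhdsWithin_zero_of_lt_one (by norm_num) (by norm_num)

lemma ae_tendsto_cutoffMollify [CompleteSpace F] (hn : 0 < n) (hu : LocallyIntegrable u) :
    ∀ᵐ x, Tendsto (fun j : ℕ => (cutoffMass n)⁻¹ • cutoffMollify u (4 ^ j) x) atTop (𝓝 (u x)) := by
  obtain ⟨C, hC⟩ := exists_abs_cutoffKernel_le_div_volumeReal n
  filter_upwards [(Besicovitch.vitaliFamily
    (volume : Measure (EuclideanSpace ℝ (Fin n)))).ae_tendsto_average_norm_sub hu] with x hx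
  have haverage := hx.comp ((Besicovitch.tendsto_filterAt volume x).comp tendsto_one_div_four_pow)
  have hlim := tendsto_integral_smul_of_tendsto_average_norm_sub
    (g := fun (j : ℕ) y => (cutoffMass n)⁻¹ * cutoffKernel (4 ^ j) (x - y))
    (|(cutoffMass n)⁻¹| * C) haverage
    (Eventually.of_forall fun j => hu.integrableOn_isCompact (isCompact_closedBall _ _))
    (tendsto_const_nhds.congr fun j => by
      rw [integral_const_mul, integral_sub_left_eq_self (fun v => cutoffKernel (4 ^ j) v),
        integral_cutoffKernel (by positivity), inv_mul_cancel₀ (cutoffMass_ne_zero hn)])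
    (Eventually.of_forall fun j => Function.support_subset_iff'.2 fun y hy => by
      rw [Function.comp_apply, Metric.mem_closedBall, dist_comm, dist_eq_norm, not_le] at hy
      rw [cutoffKernel_eq_zero (by positivity) hy, mul_zero])
    (Eventually.of_forall fun j y => by
      rw [abs_mul, mul_div_assoc]
      exact mul_le_mul_of_nonneg_left (hC _ x y (by positivity)) (abs_nonneg _))
  refine hlim.congr fun j => ?_
  simp only [mul_smul]
  rw [integral_smul, cutoffMollify]

lemma exists_tendstoLocallyUniformly_of_geometric {V W : Type*} [SeminormedAddCommGroup V]
    [NormedAddCommGroup W] [CompleteSpace W] {h : ℕ → V → W} {r : ℝ} (hr0 : 0 ≤ r) (hr1 : r < 1)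
    (hh : ∀ R : ℝ, ∃ C : ℝ, ∀ j x, ‖x‖ ≤ R → ‖h (j + 1) x - h j x‖ ≤ C * r ^ j) :
    ∃ H : V → W, TendstoLocallyUniformly h H atTop := by
  choose C hC using hh
  simp_rw [← dist_eq_norm, dist_comm (h (_ + 1) _)] at hC
  choose H hH using fun x => cauchySeq_tendsto_of_complete
    (cauchySeq_of_le_geometric r (C ‖x‖) hr1 fun j => hC ‖x‖ j x le_rfl)
  refine ⟨H, Metric.tendstoLocallyUniformly_iff.2 fun ε hε x =>
    ⟨Metric.ball x 1, Metric.ball_mem_nhds x one_pos, ?_⟩⟩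
  have htail : Tendsto (fun j : ℕ => C (‖x‖ + 1) * r ^ j / (1 - r)) atTop (𝓝 0) := by
    simpa using ((tendsto_pow_atTop_nhds_zero_of_lt_one hr0 hr1).const_mul
      (C (‖x‖ + 1))).div_const (1 - r)
  filter_upwards [htail.eventually (gt_mem_nhds hε)] with j hj y hy
  have hy' : ‖y‖ ≤ ‖x‖ + 1 := by
    rw [mem_ball_iff_norm] at hy
    linarith [norm_le_norm_sub_add y x]
  rw [dist_comm]
  exact (dist_le_of_le_geometric_of_tendsto r _ hr1 (fun j => hC _ j y hy') (hH y) j).trans_lt hj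

lemma ae_eq_smul_of_tendstoLocallyUniformly [CompleteSpace F] (hn : 0 < n)
    (hu : LocallyIntegrable u) {H : EuclideanSpace ℝ (Fin n) → F}
    (hH : TendstoLocallyUniformly (fun j : ℕ => cutoffMollify u (4 ^ j)) H atTop) :
    u =ᵐ[volume] fun x => (cutoffMass n)⁻¹ • H x := by
  filter_upwards [ae_tendsto_cutoffMollify hn hu] with x hx
  exact tendsto_nhds_unique hx
    (((tendstoLocallyUniformlyOn_univ.2 hH).tendsto_at (Set.mem_univ x)).const_smul _)

end Convergence

section CutoffIntegral

variable {n : ℕ} {F : Type*} [NormedAddCommGroup F] [NormedSpace ℝ F]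
  {f : EuclideanSpace ℝ (Fin n) → F} {l : ℝ} {x x' : EuclideanSpace ℝ (Fin n)}

lemma setIntegral_norm_le_of_integrableOn_sq {α E : Type*} [MeasurableSpace α] {μ : Measure α}
    [NormedAddCommGroup E] {g : α → E} {s : Set α} (hs : μ s ≠ ⊤)
    (hg : IntegrableOn (fun y => ‖g y‖ ^ 2) s μ) {a : ℝ} (ha : 0 < a) :
    ∫ y in s, ‖g y‖ ∂μ ≤ μ.real s * (a / 2) + (∫ y in s, ‖g y‖ ^ 2 ∂μ) / (2 * a) := by
  have hconst : IntegrableOn (fun _ => a / 2) s μ := integrableOn_const hs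
  have hpointwise (t : ℝ) : t ≤ a / 2 + t ^ 2 / (2 * a) := by
    have hsq : 0 ≤ (t - a) ^ 2 / (2 * a) := by positivity
    have hexpand : (t - a) ^ 2 / (2 * a) = a / 2 + t ^ 2 / (2 * a) - t := by
      field_simp
      ring
    linarith
  calc ∫ y in s, ‖g y‖ ∂μ ≤ ∫ y in s, (a / 2 + ‖g y‖ ^ 2 / (2 * a)) ∂μ :=
        integral_mono_of_nonneg (Eventually.of_forall fun y => norm_nonneg _)
          (hconst.integrable.add (hg.div_const _)) (Eventually.of_forall fun y => hpointwise _)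
    _ = _ := by
        rw [integral_add hconst.integrable (hg.div_const _), setIntegral_const, integral_div,
          smul_eq_mul]

lemma closedBall_one_div_subset {R : ℝ} (hl : 1 ≤ l) (hx : ‖x‖ ≤ R) :
    Metric.closedBall x (1 / l) ⊆ Metric.closedBall 0 (R + 1) := by
  refine Metric.closedBall_subset_closedBall' ?_
  rw [dist_zero_right, add_comm]
  exact add_le_add hx ((div_le_one (by linarith)).2 hl)

lemma norm_cutoffIntegral_le (hl : 0 < l)
    (hf : IntegrableOn (fun y => ‖f y‖) (Metric.closedBall x (1 / l))) :
    ‖cutoffIntegral f l x‖ ≤ ∫ y in Metric.closedBall x (1 / l), ‖f y‖ := by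
  rw [cutoffIntegral, ← setIntegral_eq_integral_of_forall_compl_eq_zero
    (s := Metric.closedBall x (1 / l)) fun y hy => by
      rw [cutoff_eq_zero_of_notMem_closedBall hl hy, zero_smul]]
  refine norm_integral_le_of_norm_le hf (Eventually.of_forall fun y => ?_)
  rw [norm_smul, Real.norm_of_nonneg (cutoff_nonneg _)]
  exact mul_le_of_le_one_left (norm_nonneg _) (cutoff_le_one _)

lemma pow_div_pow_three_mul_norm_cutoffIntegral_le (hn : n ≤ 3)
    (hf : LocallyIntegrable f) (hf2 : LocallyIntegrable fun y => ‖f y‖ ^ 2) {m R : ℝ}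
    (hm : 1 ≤ m) (hml : m ^ 2 ≤ l) (hx : ‖x‖ ≤ R) :
    l ^ n / l ^ 3 * ‖cutoffIntegral f l x‖ ≤
      (unitBallVolume n + ∫ y in Metric.closedBall 0 (R + 1), ‖f y‖ ^ 2) / 2 / m ^ 3 := by
  set A := ∫ y in Metric.closedBall 0 (R + 1), ‖f y‖ ^ 2
  have hv : 0 < unitBallVolume n := unitBallVolume_pos n
  have hA : 0 ≤ A := integral_nonneg fun y => by positivity
  have hl : 1 ≤ l := (one_le_pow₀ hm).trans hml
  have hl0 : 0 < l := by linarith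
  have hint2 {y : EuclideanSpace ℝ (Fin n)} {r : ℝ} :
      IntegrableOn (fun y => ‖f y‖ ^ 2) (Metric.closedBall y r) :=
    hf2.integrableOn_isCompact (isCompact_closedBall y r)
  have hsub : ∫ y in Metric.closedBall x (1 / l), ‖f y‖ ^ 2 ≤ A :=
    setIntegral_mono_set hint2 (Eventually.of_forall fun y => by positivity)
      (closedBall_one_div_subset hl hx).eventuallyLE
  have hnorm : ‖cutoffIntegral f l x‖ ≤
      unitBallVolume n / l ^ n * (m ^ 3 / 2) + A / (2 * m ^ 3) :=
    calc _ ≤ ∫ y in Metric.closedBall x (1 / l), ‖f y‖ :=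
          norm_cutoffIntegral_le hl0 (hf.integrableOn_isCompact (isCompact_closedBall _ _)).norm
      _ ≤ _ := setIntegral_norm_le_of_integrableOn_sq measure_closedBall_lt_top.ne hint2
          (by positivity : 0 < m ^ 3)
      _ ≤ _ := by
          rw [volumeReal_closedBall_one_div x hl0]
          gcongr
  have hpow : l ^ n / l ^ 3 ≤ 1 := (div_le_one (by positivity)).2 (pow_le_pow_right₀ hl hn)
  calc l ^ n / l ^ 3 * ‖cutoffIntegral f l x‖
      ≤ l ^ n / l ^ 3 * (unitBallVolume n / l ^ n * (m ^ 3 / 2) + A / (2 * m ^ 3)) := by gcongr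
    _ = unitBallVolume n * m ^ 3 / 2 * (1 / l ^ 3) + l ^ n / l ^ 3 * (A / (2 * m ^ 3)) := by
        field_simp
    _ ≤ unitBallVolume n * m ^ 3 / 2 * (1 / (m ^ 2) ^ 3) + 1 * (A / (2 * m ^ 3)) := by gcongr
    _ = (unitBallVolume n + A) / 2 / m ^ 3 := by field_simp

lemma pow_mul_norm_cutoffIntegral_le (hl : 0 < l) {C : ℝ}
    (hC : ∀ᵐ y, y ∈ Metric.closedBall x (1 / l) → ‖f y‖ ≤ C) :
    l ^ n * ‖cutoffIntegral f l x‖ ≤ C * unitBallVolume n := by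
  rw [← div_mul_cancel₀ (C * unitBallVolume n) (pow_pos hl n).ne', mul_comm]
  refine mul_le_mul_of_nonneg_right ?_ (by positivity)
  rw [cutoffIntegral, ← setIntegral_eq_integral_of_forall_compl_eq_zero
    (s := Metric.closedBall x (1 / l)) fun y hy => by
      rw [cutoff_eq_zero_of_notMem_closedBall hl hy, zero_smul], mul_div_assoc,
    ← volumeReal_closedBall_one_div x hl]
  refine norm_setIntegral_le_of_norm_le_const_ae' measure_closedBall_lt_top ?_
  filter_upwards [hC] with y hy hyx
  rw [norm_smul, Real.norm_of_nonneg (cutoff_nonneg _)]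
  exact (mul_le_of_le_one_left (norm_nonneg _) (cutoff_le_one _)).trans (hy hyx)

lemma integrable_cutoff_smul (hf : LocallyIntegrable f) (hl : 0 < l)
    (x : EuclideanSpace ℝ (Fin n)) : Integrable fun y => cutoff (l ^ 2 * ‖y - x‖ ^ 2) • f y :=
  hf.integrable_smul_left_of_hasCompactSupport (contDiff_cutoff_norm_sub l x).continuous
    (hasCompactSupport_cutoff_norm_sub hl x)

lemma abs_cutoff_sub_cutoff_le {L : ℝ≥0} (hL : LipschitzWith L fun s : ℝ => cutoff (s ^ 2))
    (hl : 0 ≤ l) (x x' y : EuclideanSpace ℝ (Fin n)) :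
    |cutoff (l ^ 2 * ‖y - x‖ ^ 2) - cutoff (l ^ 2 * ‖y - x'‖ ^ 2)| ≤ L * (l * ‖x - x'‖) := by
  have hdist := hL.dist_le_mul (l * ‖y - x‖) (l * ‖y - x'‖)
  rw [dist_eq_norm, Real.dist_eq, ← mul_sub, abs_mul, abs_of_nonneg hl, mul_pow, mul_pow] at hdist
  refine hdist.trans ?_
  gcongr
  refine (abs_norm_sub_norm_le _ _).trans_eq ?_
  rw [sub_sub_sub_cancel_left, norm_sub_rev]

lemma pow_mul_norm_cutoffIntegral_sub_le (hf : LocallyIntegrable f) (hl : 0 < l) {L : ℝ≥0}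
    (hL : LipschitzWith L fun s : ℝ => cutoff (s ^ 2)) {C : ℝ}
    (hC : ∀ᵐ y, y ∈ Metric.closedBall x (1 / l) ∪ Metric.closedBall x' (1 / l) → ‖f y‖ ≤ C) :
    l ^ n * ‖cutoffIntegral f l x - cutoffIntegral f l x'‖ ≤
      2 * unitBallVolume n * (L * (l * ‖x - x'‖) * |C|) := by
  set S := Metric.closedBall x (1 / l) ∪ Metric.closedBall x' (1 / l)
  have hvolume : volume.real S ≤ 2 * unitBallVolume n / l ^ n := by
    refine (measureReal_union_le _ _).trans_eq ?_
    rw [volumeReal_closedBall_one_div x hl, volumeReal_closedBall_one_div x' hl]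
    ring
  have hfinite : volume S < ⊤ :=
    measure_union_lt_top measure_closedBall_lt_top measure_closedBall_lt_top
  have hnorm : ‖cutoffIntegral f l x - cutoffIntegral f l x'‖ ≤
      L * (l * ‖x - x'‖) * |C| * volume.real S := by
    rw [cutoffIntegral, cutoffIntegral,
      ← integral_sub (integrable_cutoff_smul hf hl x) (integrable_cutoff_smul hf hl x'),
      ← setIntegral_eq_integral_of_forall_compl_eq_zero (s := S) fun y hy => by
        rw [Set.mem_union, not_or] at hy
        rw [cutoff_eq_zero_of_notMem_closedBall hl hy.1,
          cutoff_eq_zero_of_notMem_closedBall hl hy.2, zero_smul, sub_zero]]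
    refine norm_setIntegral_le_of_norm_le_const_ae' hfinite ?_
    filter_upwards [hC] with y hy hyS
    rw [← sub_smul, norm_smul]
    exact mul_le_mul (abs_cutoff_sub_cutoff_le hL hl.le x x' y) ((hy hyS).trans (le_abs_self C))
      (norm_nonneg _) (by positivity)
  calc _ ≤ l ^ n * (L * (l * ‖x - x'‖) * |C| * (2 * unitBallVolume n / l ^ n)) := by
        gcongr
        exact hnorm.trans (by gcongr)
    _ = _ := by field_simp

end CutoffIntegral

section Regularity

variable {n : ℕ} {F : Type*} [NormedAddCommGroup F] [NormedSpace ℝ F]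
  {u f : EuclideanSpace ℝ (Fin n) → F}

namespace IsDistribLaplacian

lemma norm_cutoffMollify_sub_le_of_sq (hn : 0 < n) (hn3 : n ≤ 3) (hu : LocallyIntegrable u)
    (hf : LocallyIntegrable f) (hf2 : LocallyIntegrable fun y => ‖f y‖ ^ 2)
    (huf : IsDistribLaplacian u f) (R : ℝ) :
    ∃ C : ℝ, ∀ (j : ℕ) x, ‖x‖ ≤ R →
      ‖cutoffMollify u (4 ^ (j + 1)) x - cutoffMollify u (4 ^ j) x‖ ≤ C * (1 / 2) ^ j := by
  refine ⟨3 / 2 * ((unitBallVolume n + ∫ y in Metric.closedBall 0 (R + 1), ‖f y‖ ^ 2) / 2),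
    fun j x hx => ?_⟩
  have hfour : (4 : ℝ) ^ j = (2 ^ j) ^ 2 := by
    rw [← pow_mul, mul_comm, pow_mul]
    norm_num
  rw [pow_succ']
  refine (norm_sub_le_of_hasDerivAt_pow_smul (n := n) (Φ := fun l => cutoffMollify u l x)
    (fun l hl => huf.hasDerivAt_cutoffMollify hn hu hl x)
    (by positivity) fun l hl => pow_div_pow_three_mul_norm_cutoffIntegral_le hn3 hf hf2
      (one_le_pow₀ one_le_two : (1 : ℝ) ≤ 2 ^ j) (hfour ▸ hl) hx).trans_eq ?_
  rw [hfour, one_div_pow]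
  field_simp

lemma norm_cutoffMollify_sub_le (hn : 0 < n) (hu : LocallyIntegrable u)
    (hf : LocallyEssBounded f) (huf : IsDistribLaplacian u f) (R : ℝ) :
    ∃ C : ℝ, ∀ (j : ℕ) x, ‖x‖ ≤ R →
      ‖cutoffMollify u (4 ^ (j + 1)) x - cutoffMollify u (4 ^ j) x‖ ≤ C * (1 / 4) ^ j := by
  obtain ⟨C, hC⟩ := hf (R + 1)
  refine ⟨3 / 2 * (|C| * unitBallVolume n), fun j x hx => ?_⟩
  have hfour : (1 : ℝ) ≤ 4 ^ j := one_le_pow₀ (by norm_num)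
  have hv := (unitBallVolume_pos n).le
  rw [pow_succ']
  refine (norm_sub_le_of_hasDerivAt_pow_smul (n := n) (Φ := fun l => cutoffMollify u l x)
    (fun l hl => huf.hasDerivAt_cutoffMollify hn hu hl x) (by positivity)
    (B := |C| * unitBallVolume n / (4 ^ j) ^ 2) fun l hl => ?_).trans_eq ?_
  · have hl1 : 1 ≤ l := hfour.trans hl
    have hbound := pow_mul_norm_cutoffIntegral_le (x := x) (f := f) (C := |C|) (by linarith) <|
      hC.mono fun y hy hyx => (hy (mem_closedBall_zero_iff.1
        (closedBall_one_div_subset hl1 hx hyx))).trans (le_abs_self C)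
    rw [div_mul_eq_mul_div]
    calc _ ≤ |C| * unitBallVolume n / l ^ 3 := by gcongr
      _ ≤ |C| * unitBallVolume n / l ^ 2 := by gcongr; norm_num
      _ ≤ _ := by gcongr
  · rw [one_div_pow]
    field_simp

lemma norm_cutoffMollify_sub_sub_le (hn : 0 < n) (hu : LocallyIntegrable u)
    (hfm : AEStronglyMeasurable f volume) (hf : LocallyEssBounded f)
    (huf : IsDistribLaplacian u f) (R : ℝ) :
    ∃ C : ℝ, 0 ≤ C ∧ ∀ (j : ℕ) x x', ‖x‖ ≤ R → ‖x'‖ ≤ R →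
      ‖(cutoffMollify u (4 ^ (j + 1)) x - cutoffMollify u (4 ^ j) x) -
        (cutoffMollify u (4 ^ (j + 1)) x' - cutoffMollify u (4 ^ j) x')‖ ≤
      C * (1 / 4) ^ j * ‖x - x'‖ := by
  obtain ⟨L, hL⟩ := exists_lipschitzWith_cutoff_sq
  obtain ⟨C, hC⟩ := hf (R + 1)
  have hv := (unitBallVolume_pos n).le
  refine ⟨3 * unitBallVolume n * L * |C|, by positivity, fun j x x' hx hx' => ?_⟩
  have hfour : (1 : ℝ) ≤ 4 ^ j := one_le_pow₀ (by norm_num)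
  rw [pow_succ', sub_sub_sub_comm]
  refine (norm_sub_le_of_hasDerivAt_pow_smul (n := n)
    (Φ := fun l => cutoffMollify u l x - cutoffMollify u l x')
    (I := fun l => cutoffIntegral f l x - cutoffIntegral f l x')
    (fun l hl => by
      simpa only [smul_sub] using (huf.hasDerivAt_cutoffMollify hn hu hl x).fun_sub
        (huf.hasDerivAt_cutoffMollify hn hu hl x')) (by positivity)
    (B := 2 * unitBallVolume n * L * |C| * ‖x - x'‖ / (4 ^ j) ^ 2) fun l hl => ?_).trans_eq ?_
  · have hl1 : 1 ≤ l := hfour.trans hl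
    have hsubset := Set.union_subset (closedBall_one_div_subset hl1 hx)
      (closedBall_one_div_subset hl1 hx')
    have hbound := pow_mul_norm_cutoffIntegral_sub_le (x := x) (x' := x')
      (hf.locallyIntegrable hfm) (by linarith) hL <|
      hC.mono fun y hy hyS => hy (mem_closedBall_zero_iff.1 (hsubset hyS))
    rw [div_mul_eq_mul_div]
    calc _ ≤ 2 * unitBallVolume n * (L * (l * ‖x - x'‖) * |C|) / l ^ 3 := by gcongr
      _ = 2 * unitBallVolume n * L * |C| * ‖x - x'‖ / l ^ 2 := by field_simp
      _ ≤ _ := by gcongr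
  · rw [one_div_pow]
    field_simp

lemma norm_fderiv_cutoffMollify_sub_le (hn : 0 < n) (hu : LocallyIntegrable u)
    (hfm : AEStronglyMeasurable f volume) (hf : LocallyEssBounded f)
    (huf : IsDistribLaplacian u f) (R : ℝ) :
    ∃ C : ℝ, ∀ (j : ℕ) x, ‖x‖ ≤ R →
      ‖fderiv ℝ (cutoffMollify u (4 ^ (j + 1))) x - fderiv ℝ (cutoffMollify u (4 ^ j)) x‖ ≤
        C * (1 / 4) ^ j := by
  obtain ⟨C, hC0, hC⟩ := huf.norm_cutoffMollify_sub_sub_le hn hu hfm hf (R + 1)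
  refine ⟨C, fun j x hx => ?_⟩
  have hdiff (i : ℕ) : DifferentiableAt ℝ (cutoffMollify u (4 ^ i)) x :=
    (contDiff_cutoffMollify hu (by positivity)).differentiable one_ne_zero x
  rw [← fderiv_sub (hdiff (j + 1)) (hdiff j)]
  refine norm_fderiv_le_of_lip' ℝ (by positivity) ?_
  filter_upwards [Metric.ball_mem_nhds x one_pos] with y hy
  rw [mem_ball_iff_norm] at hy
  exact hC j y x (by linarith [norm_le_norm_sub_add y x]) (by linarith)

variable [CompleteSpace F]

theorem exists_continuous (hn : 0 < n) (hn3 : n ≤ 3) (hu : LocallyIntegrable u)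
    (hf : LocallyIntegrable f) (hf2 : LocallyIntegrable fun y => ‖f y‖ ^ 2)
    (huf : IsDistribLaplacian u f) : ∃ v, Continuous v ∧ u =ᵐ[volume] v := by
  obtain ⟨H, hH⟩ := exists_tendstoLocallyUniformly_of_geometric
    (h := fun j : ℕ => cutoffMollify u (4 ^ j)) one_half_pos.le one_half_lt_one
    (huf.norm_cutoffMollify_sub_le_of_sq hn hn3 hu hf hf2)
  have hcont : Continuous H := hH.continuous
    (Frequently.of_forall fun j => (contDiff_cutoffMollify hu (by positivity)).continuous)
  exact ⟨_, hcont.fun_const_smul _, ae_eq_smul_of_tendstoLocallyUniformly hn hu hH⟩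

theorem exists_contDiff (hn : 0 < n) (hu : LocallyIntegrable u)
    (hfm : AEStronglyMeasurable f volume) (hf : LocallyEssBounded f)
    (huf : IsDistribLaplacian u f) : ∃ v, ContDiff ℝ 1 v ∧ u =ᵐ[volume] v := by
  have hcontDiff (j : ℕ) : ContDiff ℝ 1 (cutoffMollify u (4 ^ j)) :=
    contDiff_cutoffMollify hu (by positivity)
  obtain ⟨H, hH⟩ := exists_tendstoLocallyUniformly_of_geometric
    (h := fun j : ℕ => cutoffMollify u (4 ^ j)) (r := 1 / 4) (by norm_num) (by norm_num)
    (huf.norm_cutoffMollify_sub_le hn hu hf)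
  obtain ⟨H', hH'⟩ := exists_tendstoLocallyUniformly_of_geometric
    (h := fun j : ℕ => fderiv ℝ (cutoffMollify u (4 ^ j))) (r := 1 / 4) (by norm_num) (by norm_num)
    (huf.norm_fderiv_cutoffMollify_sub_le hn hu hfm hf)
  have hcont : Continuous H' := hH'.continuous
    (Frequently.of_forall fun j => (hcontDiff j).continuous_fderiv one_ne_zero)
  have hderiv (x : EuclideanSpace ℝ (Fin n)) : HasFDerivAt H (H' x) x :=
    hasFDerivAt_of_tendstoLocallyUniformlyOn isOpen_univ (tendstoLocallyUniformlyOn_univ.2 hH')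
      (fun j x _ => ((hcontDiff j).differentiable one_ne_zero x).hasFDerivAt)
      (fun x _ => (tendstoLocallyUniformlyOn_univ.2 hH).tendsto_at (Set.mem_univ x))
      (Set.mem_univ x)
  have hHcontDiff : ContDiff ℝ 1 H := contDiff_one_iff_hasFDerivAt.2 ⟨H', hcont, hderiv⟩
  exact ⟨_, hHcontDiff.const_smul _, ae_eq_smul_of_tendstoLocallyUniformly hn hu hH⟩

end IsDistribLaplacian

end Regularity

/-! ### The weak divergence of `v ∇w - w ∇v` -/

section WeakLaplacian

variable {n : ℕ} {φ ψ w : EuclideanSpace ℝ (Fin n) → ℝ}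

lemma contDiff_partialDeriv (hφ : ContDiff ℝ ∞ φ) (i : Fin n) : ContDiff ℝ ∞ (partialDeriv i φ) :=
  (hφ.fderiv_right (m := ∞) (by simp)).clm_apply contDiff_const

lemma contDiff_laplace (hφ : ContDiff ℝ ∞ φ) : ContDiff ℝ ∞ (laplace φ) :=
  .sum fun i _ => contDiff_partialDeriv (contDiff_partialDeriv hφ i) i

lemma hasCompactSupport_laplace (hφ : HasCompactSupport φ) : HasCompactSupport (laplace φ) := by
  refine hφ.mono' fun x hx => ?_
  obtain ⟨i, -, hi⟩ := Finset.exists_ne_zero_of_sum_ne_zero hx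
  exact tsupport_fderiv_apply_subset ℝ _
    (closure_minimal (subset_tsupport _) (isClosed_tsupport _)
      (tsupport_fderiv_apply_subset ℝ _ (subset_tsupport _ hi)))

lemma partialDeriv_mul {x : EuclideanSpace ℝ (Fin n)} (hφ : DifferentiableAt ℝ φ x)
    (hψ : DifferentiableAt ℝ ψ x) (i : Fin n) :
    partialDeriv i (fun x => φ x * ψ x) x =
      φ x * partialDeriv i ψ x + ψ x * partialDeriv i φ x := by
  rw [partialDeriv, fderiv_fun_mul hφ hψ]
  rfl

lemma laplace_mul (hφ : ContDiff ℝ ∞ φ) (hψ : ContDiff ℝ ∞ ψ) (x : EuclideanSpace ℝ (Fin n)) :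
    laplace (fun x => φ x * ψ x) x =
      φ x * laplace ψ x + 2 * ∑ i, partialDeriv i φ x * partialDeriv i ψ x + ψ x * laplace φ x := by
  have hd {χ : EuclideanSpace ℝ (Fin n) → ℝ} (hχ : ContDiff ℝ ∞ χ) : Differentiable ℝ χ :=
    hχ.differentiable (by simp)
  have hφ' := fun i => contDiff_partialDeriv hφ i
  have hψ' := fun i => contDiff_partialDeriv hψ i
  simp only [laplace, Finset.mul_sum, ← Finset.sum_add_distrib]
  refine Finset.sum_congr rfl fun i _ => ?_
  have hfirst : partialDeriv i (fun x => φ x * ψ x) =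
      fun x => φ x * partialDeriv i ψ x + ψ x * partialDeriv i φ x :=
    funext fun x => partialDeriv_mul (hd hφ x) (hd hψ x) i
  have hadd : partialDeriv i (fun x => φ x * partialDeriv i ψ x + ψ x * partialDeriv i φ x) x =
      partialDeriv i (fun x => φ x * partialDeriv i ψ x) x +
        partialDeriv i (fun x => ψ x * partialDeriv i φ x) x := by
    rw [partialDeriv, fderiv_fun_add (hd (hφ.mul (hψ' i)) x) (hd (hψ.mul (hφ' i)) x)]
    rfl
  rw [hfirst, hadd, partialDeriv_mul (hd hφ x) (hd (hψ' i) x),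
    partialDeriv_mul (hd hψ x) (hd (hφ' i) x)]
  ring

section Normed

variable {F : Type*} [NormedAddCommGroup F] [NormedSpace ℝ F]
  {u v f g : EuclideanSpace ℝ (Fin n) → F}

lemma integral_partialDeriv_smul (hv : ContDiff ℝ 1 v) (hψ : ContDiff ℝ 1 ψ)
    (hψc : HasCompactSupport ψ) (i : Fin n) :
    ∫ x, partialDeriv i ψ x • v x = -∫ x, ψ x • fderiv ℝ v x (EuclideanSpace.single i 1) := by
  have hdv : Continuous fun x => fderiv ℝ v x (EuclideanSpace.single i 1) :=
    (hv.continuous_fderiv one_ne_zero).clm_apply continuous_const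
  rw [integral_smul_fderiv_eq_neg_fderiv_smul_of_integrable (𝕜 := ℝ), neg_neg]
  · rfl
  · exact hv.continuous.locallyIntegrable.integrable_smul_left_of_hasCompactSupport
      (continuous_partialDeriv hψ i) (hasCompactSupport_partialDeriv hψc i)
  · exact hdv.locallyIntegrable.integrable_smul_left_of_hasCompactSupport hψ.continuous hψc
  · exact hv.continuous.locallyIntegrable.integrable_smul_left_of_hasCompactSupport
      hψ.continuous hψc
  · exact fun x _ => hψ.differentiable one_ne_zero x
  · exact fun x _ => hv.differentiable one_ne_zero x

lemma integral_laplace_smul (hv : LocallyIntegrable v) (hφ : ContDiff ℝ ∞ φ)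
    (hφc : HasCompactSupport φ) :
    ∫ x, laplace φ x • v x = ∑ i, ∫ x, partialDeriv i (partialDeriv i φ) x • v x := by
  simp_rw [laplace, Finset.sum_smul]
  exact integral_finsetSum _ fun i _ => hv.integrable_smul_left_of_hasCompactSupport
    (contDiff_partialDeriv (contDiff_partialDeriv hφ i) i).continuous
    (hasCompactSupport_partialDeriv (hasCompactSupport_partialDeriv hφc i) i)

lemma IsDistribLaplacian.congr (h : IsDistribLaplacian u f) (huv : u =ᵐ[volume] v)
    (hfg : f =ᵐ[volume] g) : IsDistribLaplacian v g := by
  intro φ hφ hφc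
  have hl : ∫ x, laplace φ x • v x = ∫ x, laplace φ x • u x :=
    integral_congr_ae (huv.mono fun x hx => congrArg (laplace φ x • ·) hx.symm)
  rw [hl, h φ hφ hφc]
  exact integral_congr_ae (hfg.mono fun x hx => congrArg (φ x • ·) hx)

lemma IsDistribLaplacian.sub (h : IsDistribLaplacian u f) (h' : IsDistribLaplacian v g)
    (hu : LocallyIntegrable u) (hv : LocallyIntegrable v) (hf : LocallyIntegrable f)
    (hg : LocallyIntegrable g) :
    IsDistribLaplacian (fun x => u x - v x) (fun x => f x - g x) := by
  intro φ hφ hφc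
  have hΔ : Continuous (laplace φ) := (contDiff_laplace hφ).continuous
  have hΔc : HasCompactSupport (laplace φ) := hasCompactSupport_laplace hφc
  simp_rw [smul_sub]
  rw [integral_sub (hu.integrable_smul_left_of_hasCompactSupport hΔ hΔc)
    (hv.integrable_smul_left_of_hasCompactSupport hΔ hΔc),
    integral_sub (hf.integrable_smul_left_of_hasCompactSupport hφ.continuous hφc)
    (hg.integrable_smul_left_of_hasCompactSupport hφ.continuous hφc), h φ hφ hφc, h' φ hφ hφc]

end Normed

variable {v F : EuclideanSpace ℝ (Fin n) → ℂ}

lemma integral_mul_partialDeriv_smul_fderiv (hv : ContDiff ℝ 1 v) (hw : ContDiff ℝ ∞ w)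
    (hφ : ContDiff ℝ ∞ φ) (hφc : HasCompactSupport φ) (i : Fin n) :
    ∫ x, (w x * partialDeriv i φ x) • fderiv ℝ v x (EuclideanSpace.single i 1) =
      -∫ x, (w x * partialDeriv i (partialDeriv i φ) x +
        partialDeriv i φ x * partialDeriv i w x) • v x := by
  have hψ := contDiff_partialDeriv hφ i
  have hwψ : ContDiff ℝ 1 fun x => w x * partialDeriv i φ x := (hw.mul hψ).of_le (mod_cast le_top)
  rw [← neg_eq_iff_eq_neg, ← integral_partialDeriv_smul hv hwψ
    (hasCompactSupport_partialDeriv hφc i).mul_left i]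
  simp_rw [partialDeriv_mul (hw.differentiable (by simp) _) (hψ.differentiable (by simp) _)]

lemma integral_mul_sub_mul_fderiv_mul_partialDeriv (hv : ContDiff ℝ 1 v) (hw : ContDiff ℝ ∞ w)
    (hφ : ContDiff ℝ ∞ φ) (hφc : HasCompactSupport φ) (i : Fin n) :
    ∫ x, ((partialDeriv i w x : ℂ) * v x -
        (w x : ℂ) * fderiv ℝ v x (EuclideanSpace.single i 1)) * (partialDeriv i φ x : ℂ) =
      ∫ x, (w x * partialDeriv i (partialDeriv i φ) x +
        2 * (partialDeriv i w x * partialDeriv i φ x)) • v x := by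
  have hint {ψ : EuclideanSpace ℝ (Fin n) → ℝ} {a : EuclideanSpace ℝ (Fin n) → ℂ}
      (ha : Continuous a) (hψ : Continuous ψ) (hψc : HasCompactSupport ψ) :
      Integrable fun x => ψ x • a x :=
    ha.locallyIntegrable.integrable_smul_left_of_hasCompactSupport hψ hψc
  have hvc := hv.continuous
  have hwc := hw.continuous
  have hdw := (contDiff_partialDeriv hw i).continuous
  have hdφ := (contDiff_partialDeriv hφ i).continuous
  have hddφ := (contDiff_partialDeriv (contDiff_partialDeriv hφ i) i).continuous
  have hdφc := hasCompactSupport_partialDeriv hφc i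
  have hddφc := hasCompactSupport_partialDeriv hdφc i
  have hdv : Continuous fun x => fderiv ℝ v x (EuclideanSpace.single i 1) :=
    (hv.continuous_fderiv one_ne_zero).clm_apply continuous_const
  have hfirst : Integrable fun x => (partialDeriv i φ x * partialDeriv i w x) • v x :=
    hint hvc (hdφ.mul hdw) hdφc.mul_right
  have hsecond : Integrable fun x =>
      (w x * partialDeriv i φ x) • fderiv ℝ v x (EuclideanSpace.single i 1) :=
    hint hdv (hwc.mul hdφ) hdφc.mul_left
  have hparts : Integrable fun x => (w x * partialDeriv i (partialDeriv i φ) x +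
      partialDeriv i φ x * partialDeriv i w x) • v x :=
    hint hvc ((hwc.mul hddφ).add (hdφ.mul hdw)) (hddφc.mul_left.add hdφc.mul_right)
  calc
    _ = ∫ x, ((partialDeriv i φ x * partialDeriv i w x) • v x -
          (w x * partialDeriv i φ x) • fderiv ℝ v x (EuclideanSpace.single i 1)) := by
      congr 1 with x
      simp only [Complex.real_smul, Complex.ofReal_mul]
      ring
    _ = (∫ x, (partialDeriv i φ x * partialDeriv i w x) • v x) +
          ∫ x, (w x * partialDeriv i (partialDeriv i φ) x +
            partialDeriv i φ x * partialDeriv i w x) • v x := by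
      rw [integral_sub hfirst hsecond, integral_mul_partialDeriv_smul_fderiv hv hw hφ hφc i,
        sub_neg_eq_add]
    _ = _ := by
      rw [← integral_add hfirst hparts]
      congr 1 with x
      module

lemma IsDistribLaplacian.isWeakDivergence (hv : ContDiff ℝ 1 v) (hF : LocallyIntegrable F)
    (hvF : IsDistribLaplacian v F) (hw : ContDiff ℝ ∞ w) :
    IsWeakDivergence (fun i x => (partialDeriv i w x : ℂ) * v x -
        (w x : ℂ) * fderiv ℝ v x (EuclideanSpace.single i 1))
      (fun x => (laplace w x : ℂ) * v x - (w x : ℂ) * F x) := by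
  intro φ hφ hφc
  have hvl := hv.continuous.locallyIntegrable (μ := volume)
  have hdw i := (contDiff_partialDeriv hw i).continuous
  have hdφ i := (contDiff_partialDeriv hφ i).continuous
  have hddφ i := (contDiff_partialDeriv (contDiff_partialDeriv hφ i) i).continuous
  have hdφc i := hasCompactSupport_partialDeriv hφc i
  have (i : Fin n) : Continuous fun x => fderiv ℝ v x (EuclideanSpace.single i 1) :=
    (hv.continuous_fderiv one_ne_zero).clm_apply continuous_const
  have hterm (i : Fin n) : Integrable fun x => (w x * partialDeriv i (partialDeriv i φ) x +
      2 * (partialDeriv i w x * partialDeriv i φ x)) • v x :=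
    hvl.integrable_smul_left_of_hasCompactSupport (by fun_prop)
      ((hasCompactSupport_partialDeriv (hdφc i) i).mul_left.add (hdφc i).mul_left.mul_left)
  have hwφF : Integrable fun x => (w x * φ x) • F x :=
    hF.integrable_smul_left_of_hasCompactSupport (hw.continuous.mul hφ.continuous) hφc.mul_left
  have hΔwφv : Integrable fun x => (φ x * laplace w x) • v x :=
    hvl.integrable_smul_left_of_hasCompactSupport
      (hφ.continuous.mul (contDiff_laplace hw).continuous) hφc.mul_right
  have hΔv : Integrable fun x => laplace (fun y => w y * φ y) x • v x :=
    hvl.integrable_smul_left_of_hasCompactSupport (contDiff_laplace (hw.mul hφ)).continuous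
      (hasCompactSupport_laplace hφc.mul_left)
  calc
    _ = ∑ i, ∫ x, (w x * partialDeriv i (partialDeriv i φ) x +
          2 * (partialDeriv i w x * partialDeriv i φ x)) • v x := by
      rw [integral_finsetSum _ fun i _ => integrable_mul_ofReal_of_hasCompactSupport
        (Continuous.locallyIntegrable (by fun_prop)) (hdφ i) (hdφc i)]
      exact Finset.sum_congr rfl fun i _ =>
        integral_mul_sub_mul_fderiv_mul_partialDeriv hv hw hφ hφc i
    _ = ∫ x, (laplace (fun y => w y * φ y) x • v x - (φ x * laplace w x) • v x) := by
      rw [← integral_finsetSum _ fun i _ => hterm i]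
      congr 1 with x
      rw [laplace_mul hw hφ, ← Finset.sum_smul, Finset.sum_add_distrib, ← Finset.mul_sum,
        ← Finset.mul_sum, ← laplace]
      module
    _ = (∫ x, (w x * φ x) • F x) - ∫ x, (φ x * laplace w x) • v x := by
      rw [integral_sub hΔv hΔwφv, hvF _ (hw.mul hφ) hφc.mul_left]
    _ = _ := by
      rw [← integral_sub hwφF hΔwφv, ← integral_neg]
      congr 1 with x
      simp only [Complex.real_smul, Complex.ofReal_mul]
      ring

end WeakLaplacian

/-! ### Regularity of weak solutions of the Helmholtz equation -/

section Fields

variable {n : ℕ}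

lemma MemL2Loc.locallyIntegrable {u : EuclideanSpace ℝ (Fin n) → ℂ} (hu : MemL2Loc u) :
    LocallyIntegrable u :=
  locallyIntegrable_iff.2 fun K hK => by
    have : IsFiniteMeasure (volume.restrict K) := isFiniteMeasure_restrict.2 hK.measure_ne_top
    exact (hu K hK).integrable one_le_two

lemma MemL2Loc.locallyIntegrable_norm_sq {u : EuclideanSpace ℝ (Fin n) → ℂ} (hu : MemL2Loc u) :
    LocallyIntegrable fun x => ‖u x‖ ^ 2 :=
  locallyIntegrable_iff.2 fun K hK => (memLp_two_iff_integrable_sq_norm (hu K hK).1).1 (hu K hK)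

lemma MemL2Loc.mul_of_memLp_top {a u : EuclideanSpace ℝ (Fin n) → ℂ} (hu : MemL2Loc u)
    (ha : MemLp a ⊤) : MemL2Loc fun x => a x * u x :=
  fun K hK => (hu K hK).mul' (ha.restrict K)

lemma memLp_top_neg_sq_mul_one_add (k : ℝ) {η : EuclideanSpace ℝ (Fin n) → ℂ}
    (hη : MemLp η ⊤) : MemLp (fun x => -(k : ℂ) ^ 2 * (1 + η x)) ⊤ :=
  MemLp.const_mul ((memLp_top_const (1 : ℂ)).add hη) (-(k : ℂ) ^ 2)

lemma contDiff_planeWave (k : ℝ) (d : EuclideanSpace ℝ (Fin n)) : ContDiff ℝ ∞ (planeWave k d) :=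
  (contDiff_const.mul (Complex.ofRealCLM.contDiff.comp
    (contDiff_id.inner ℝ contDiff_const))).cexp

lemma fderiv_planeWave (k : ℝ) (d x h : EuclideanSpace ℝ (Fin n)) :
    fderiv ℝ (planeWave k d) x h = Complex.I * k * (inner ℝ h d : ℝ) * planeWave k d x := by
  have hinner : HasFDerivAt (fun x : EuclideanSpace ℝ (Fin n) => ((inner ℝ x d : ℝ) : ℂ))
      (Complex.ofRealCLM.comp (innerSL ℝ d)) x :=
    (Complex.ofRealCLM.comp (innerSL ℝ d)).hasFDerivAt.congr_of_eventuallyEq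
      (Eventually.of_forall fun y => by simp [real_inner_comm])
  have hwave : HasFDerivAt (planeWave k d) (planeWave k d x •
      (Complex.I * (k : ℂ)) • Complex.ofRealCLM.comp (innerSL ℝ d)) x :=
    (hinner.const_mul (Complex.I * (k : ℂ))).cexp
  rw [hwave.fderiv]
  simp [real_inner_comm]
  ring

lemma fderiv_planeWave_single (k : ℝ) (d x : EuclideanSpace ℝ (Fin n)) (i : Fin n) :
    fderiv ℝ (planeWave k d) x (EuclideanSpace.single i 1) =
      Complex.I * k * d i * planeWave k d x := by
  rw [fderiv_planeWave, EuclideanSpace.inner_single_left, map_one, one_mul]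

lemma isDistribLaplacian_planeWave (k : ℝ) (d : EuclideanSpace ℝ (Fin n)) :
    IsDistribLaplacian (planeWave k d) fun x => -((k : ℂ) * ‖d‖) ^ 2 * planeWave k d x := by
  have hp : ContDiff ℝ 1 (planeWave k d) := (contDiff_planeWave k d).of_le (mod_cast le_top)
  intro φ hφ hφc
  have hparts {ψ : EuclideanSpace ℝ (Fin n) → ℝ} (hψ : ContDiff ℝ ∞ ψ) (hψc : HasCompactSupport ψ)
      (i : Fin n) : ∫ x, partialDeriv i ψ x • planeWave k d x =
        -(Complex.I * k * d i) * ∫ x, ψ x • planeWave k d x := by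
    rw [integral_partialDeriv_smul hp (hψ.of_le (mod_cast le_top)) hψc]
    simp_rw [fderiv_planeWave_single, ← mul_smul_comm]
    rw [integral_const_mul, neg_mul]
  have hnorm : (‖d‖ : ℂ) ^ 2 = ∑ i, (d i : ℂ) ^ 2 := by
    exact_mod_cast EuclideanSpace.real_norm_sq_eq d
  rw [integral_laplace_smul hp.continuous.locallyIntegrable hφ hφc]
  simp_rw [fun i => hparts (contDiff_partialDeriv hφ i) (hasCompactSupport_partialDeriv hφc i) i,
    hparts hφ hφc, ← mul_smul_comm]
  rw [integral_const_mul, mul_pow, hnorm, Finset.mul_sum, ← Finset.sum_neg_distrib,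
    Finset.sum_mul]
  refine Finset.sum_congr rfl fun i _ => ?_
  linear_combination (k : ℂ) ^ 2 * (d i : ℂ) ^ 2 * (∫ x, φ x • planeWave k d x) * Complex.I_sq

lemma tendsto_average_ball {F : Type*} [NormedAddCommGroup F] [NormedSpace ℝ F] [CompleteSpace F]
    {f : EuclideanSpace ℝ (Fin n) → F} (hf : Continuous f) (x : EuclideanSpace ℝ (Fin n)) :
    Tendsto (fun r => ⨍ y in Metric.ball x r, f y) (𝓝[>] (0 : ℝ)) (𝓝 (f x)) := by
  rw [Metric.nhds_basis_closedBall.tendsto_right_iff]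
  intro ε hε
  obtain ⟨δ, hδ, hfδ⟩ := Metric.continuous_iff.1 hf x ε hε
  filter_upwards [Ioo_mem_nhdsGT hδ] with r hr
  refine (convex_closedBall _ _).set_average_mem Metric.isClosed_closedBall
    (Metric.measure_ball_pos volume x hr.1).ne' measure_ball_lt_top.ne ?_ ?_
  · exact ae_restrict_of_forall_mem Metric.isOpen_ball.measurableSet fun y hy =>
      (hfδ y (hy.trans hr.2)).le
  · exact (hf.locallyIntegrable.integrableOn_isCompact (isCompact_closedBall x r)).mono_set
      Metric.ball_subset_closedBall

lemma rep_eq_of_ae_eq {f g : EuclideanSpace ℝ (Fin n) → ℂ} (hg : Continuous g)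
    (hfg : f =ᵐ[volume] g) : rep f = g :=
  funext fun x => ((tendsto_average_ball hg x).congr fun _ =>
    (average_congr (ae_restrict_of_ae hfg)).symm).limUnder_eq

namespace IsWeakHelmholtzSolution

variable {k : ℝ} {η u : EuclideanSpace ℝ (Fin n) → ℂ}

lemma isDistribLaplacian (hu : IsWeakHelmholtzSolution k η u) :
    IsDistribLaplacian u fun x => -(k : ℂ) ^ 2 * (1 + η x) * u x := by
  obtain ⟨hu2, G, hG, hGu, hweak⟩ := hu
  intro φ hφ hφc
  have hparts i : ∫ x, partialDeriv i (partialDeriv i φ) x • u x =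
      -∫ x, G i x * (partialDeriv i φ x : ℂ) := by
    simp_rw [Complex.real_smul, mul_comm (G i _)]
    exact hGu i _ (contDiff_partialDeriv hφ i) (hasCompactSupport_partialDeriv hφc i)
  have hint i : Integrable fun x => G i x * (partialDeriv i φ x : ℂ) :=
    integrable_mul_ofReal_of_hasCompactSupport (hG i).locallyIntegrable
      (contDiff_partialDeriv hφ i).continuous (hasCompactSupport_partialDeriv hφc i)
  rw [integral_laplace_smul hu2.locallyIntegrable hφ hφc]
  simp_rw [hparts]
  rw [Finset.sum_neg_distrib, ← integral_finsetSum _ fun i _ => hint i, hweak φ hφ hφc,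
    ← integral_neg]
  congr 1 with x
  rw [Complex.real_smul]
  ring

theorem exists_contDiff (hn : 0 < n) (hn3 : n ≤ 3) (hη : MemLp η ⊤)
    (hu : IsWeakHelmholtzSolution k η u) : ∃ v, ContDiff ℝ 1 v ∧ u =ᵐ[volume] v := by
  have hcoeff := memLp_top_neg_sq_mul_one_add k hη
  have hui := hu.1.locallyIntegrable
  have hΔ := hu.isDistribLaplacian
  have hf : MemL2Loc fun x => -(k : ℂ) ^ 2 * (1 + η x) * u x := hu.1.mul_of_memLp_top hcoeff
  obtain ⟨u₀, hu₀, huu₀⟩ :=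
    hΔ.exists_continuous hn hn3 hui hf.locallyIntegrable hf.locallyIntegrable_norm_sq
  have hbounded : LocallyEssBounded fun x => -(k : ℂ) ^ 2 * (1 + η x) * u x :=
    (locallyEssBounded_of_memLp_top hcoeff).mul
      ((locallyEssBounded_of_continuous hu₀).congr huu₀.symm)
  exact hΔ.exists_contDiff hn hui hf.locallyIntegrable.aestronglyMeasurable hbounded

lemma locallyEssBounded (hn : 0 < n) (hn3 : n ≤ 3) (hη : MemLp η ⊤)
    (hu : IsWeakHelmholtzSolution k η u) : LocallyEssBounded u := by
  obtain ⟨v, hv, huv⟩ := hu.exists_contDiff hn hn3 hη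
  exact (locallyEssBounded_of_continuous hv.continuous).congr huv.symm

theorem contDiff_rep_scattered {d : EuclideanSpace ℝ (Fin n)}
    {usc : EuclideanSpace ℝ (Fin n) → ℂ} (hn : 0 < n) (hn3 : n ≤ 3) (hη : MemLp η ⊤)
    (hu : IsWeakHelmholtzSolution k η (totalField k d usc)) :
    usc =ᵐ[volume] rep usc ∧ ContDiff ℝ 1 (rep usc) := by
  obtain ⟨v, hv, huv⟩ := hu.exists_contDiff hn hn3 hη
  have hvp : ContDiff ℝ 1 fun x => v x - planeWave k d x :=
    hv.sub ((contDiff_planeWave k d).of_le (mod_cast le_top))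
  have hae : usc =ᵐ[volume] fun x => v x - planeWave k d x := by
    filter_upwards [huv] with x hx
    rw [← hx, totalField, add_sub_cancel_right]
  rw [rep_eq_of_ae_eq hvp.continuous hae]
  exact ⟨hae, hvp⟩

lemma isDistribLaplacian_scattered {d : EuclideanSpace ℝ (Fin n)}
    {usc : EuclideanSpace ℝ (Fin n) → ℂ} (hd : ‖d‖ = 1) (hη : MemLp η ⊤)
    (hu : IsWeakHelmholtzSolution k η (totalField k d usc)) :
    IsDistribLaplacian usc fun x =>
      -(k : ℂ) ^ 2 * usc x - (k : ℂ) ^ 2 * (η x * totalField k d usc x) := by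
  have hp : Continuous (planeWave k d) := (contDiff_planeWave k d).continuous
  have hcoeff := memLp_top_neg_sq_mul_one_add k hη
  have hsub := hu.isDistribLaplacian.sub (isDistribLaplacian_planeWave k d) hu.1.locallyIntegrable
    hp.locallyIntegrable (hu.1.mul_of_memLp_top hcoeff).locallyIntegrable
    (hp.const_mul _).locallyIntegrable
  convert! hsub using 2 with x x
  · rw [totalField, add_sub_cancel_right]
  · rw [totalField, hd]
    push_cast
    ring

end IsWeakHelmholtzSolution

end Fields

/-! ### Green's representation of the boundary integral -/

section BoundaryIntegral

variable {n : ℕ} {Ω : Set (EuclideanSpace ℝ (Fin n))}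

lemma ae_surfaceMeasure_ne (hn : 2 ≤ n) (z : EuclideanSpace ℝ (Fin n)) :
    ∀ᵐ x ∂surfaceMeasure Ω, x ≠ z := by
  have hdim : (0 : ℝ) < ((n - 1 : ℕ) : ℝ) := by exact_mod_cast (by omega : 0 < n - 1)
  have := Measure.nullSingletonClass_hausdorff (EuclideanSpace ℝ (Fin n)) hdim
  have hz : (μHE[n - 1] : Measure (EuclideanSpace ℝ (Fin n))) {z} = 0 := by
    rw [Measure.euclideanHausdorffMeasure, Measure.smul_apply, measure_singleton, smul_zero]
  exact ae_restrict_of_ae (measure_eq_zero_iff_ae_notMem.1 hz)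

lemma apply_eq_sum_single {W : Type*} [NormedAddCommGroup W] [NormedSpace ℝ W]
    (L : EuclideanSpace ℝ (Fin n) →L[ℝ] W) (h : EuclideanSpace ℝ (Fin n)) :
    L h = ∑ i, h i • L (EuclideanSpace.single i 1) := by
  conv_lhs => rw [← (EuclideanSpace.basisFun (Fin n) ℝ).sum_repr h]
  simp [map_sum]

variable {k : ℝ} {z : EuclideanSpace ℝ (Fin n)} {v q : EuclideanSpace ℝ (Fin n) → ℂ}

/-- The vector field `v ∇w - w ∇v`, where `w` is the smooth extension of `Im Φ(·, z)` across
`z`. -/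
def greenField (k : ℝ) (z : EuclideanSpace ℝ (Fin n)) (v : EuclideanSpace ℝ (Fin n) → ℂ)
    (i : Fin n) (x : EuclideanSpace ℝ (Fin n)) : ℂ :=
  (partialDeriv i (radialWave k (greenConst n k) z) x : ℂ) * v x -
    (radialWave k (greenConst n k) z x : ℂ) * fderiv ℝ v x (EuclideanSpace.single i 1)

lemma continuous_greenField (hn : 0 < n) (hv : ContDiff ℝ 1 v) (i : Fin n) :
    Continuous (greenField k z v i) := by
  have hw := contDiff_radialWave (k := k) (c := greenConst n k) hn z
  have hwc := hw.continuous
  have hdw := (contDiff_partialDeriv hw i).continuous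
  have hvc := hv.continuous
  have : Continuous fun x => fderiv ℝ v x (EuclideanSpace.single i 1) :=
    (hv.continuous_fderiv one_ne_zero).clm_apply continuous_const
  unfold greenField
  fun_prop

lemma boundaryIntegrand_eq_sum_greenField (hn : n = 2 ∨ n = 3)
    {x : EuclideanSpace ℝ (Fin n)} (hxz : x ≠ z) :
    boundaryIntegrand k Ω v z x = ∑ i, greenField k z v i x * (outwardNormal Ω x i : ℂ) := by
  have hloc : (fun x' => ((green k x' z).im : ℂ)) =ᶠ[𝓝 x]
      fun x' => (radialWave k (greenConst n k) z x' : ℂ) := by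
    filter_upwards [isOpen_ne.mem_nhds hxz] with y hy
    rw [im_green_eq_radialWave hn k hy]
  have hw : HasFDerivAt (fun x' => (radialWave k (greenConst n k) z x' : ℂ))
      (Complex.ofRealCLM.comp (fderiv ℝ (radialWave k (greenConst n k) z) x)) x :=
    Complex.ofRealCLM.hasFDerivAt.comp x
      ((contDiff_radialWave (by omega) z).differentiable (by simp) x).hasFDerivAt
  rw [boundaryIntegrand, normalDeriv, normalDeriv, hloc.fderiv_eq, hw.fderiv,
    im_green_eq_radialWave hn k hxz, apply_eq_sum_single (fderiv ℝ v x),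
    apply_eq_sum_single (Complex.ofRealCLM.comp _), Finset.sum_mul, Finset.mul_sum,
    ← Finset.sum_sub_distrib]
  refine Finset.sum_congr rfl fun i _ => ?_
  rw [greenField, ContinuousLinearMap.comp_apply, Complex.ofRealCLM_apply, ← partialDeriv,
    Complex.real_smul, Complex.real_smul]
  ring

lemma boundaryIntegrand_ae_eq_sum_greenField (hn : n = 2 ∨ n = 3) :
    boundaryIntegrand k Ω v z =ᵐ[surfaceMeasure Ω]
      fun x => ∑ i, greenField k z v i x * (outwardNormal Ω x i : ℂ) :=
  (ae_surfaceMeasure_ne (by omega) z).mono fun _ => boundaryIntegrand_eq_sum_greenField hn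

lemma IsBoundedLipschitz.integrable_boundaryIntegrand (hn : n = 2 ∨ n = 3)
    (hΩ : IsBoundedLipschitz Ω) (hv : ContDiff ℝ 1 v) :
    Integrable (boundaryIntegrand k Ω v z) (surfaceMeasure Ω) :=
  (hΩ.integrable_sum_mul_outwardNormal fun i => continuous_greenField (by omega) hv i).congr
    (boundaryIntegrand_ae_eq_sum_greenField hn).symm

lemma im_green_ae_eq_radialWave (hn : n = 2 ∨ n = 3) (k : ℝ) (z : EuclideanSpace ℝ (Fin n)) :
    (fun y => (green k y z).im) =ᵐ[volume] radialWave k (greenConst n k) z := by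
  have : Nontrivial (EuclideanSpace ℝ (Fin n)) :=
    Module.nontrivial_of_finrank_pos (R := ℝ) (by rw [finrank_euclideanSpace_fin]; omega)
  filter_upwards [measure_eq_zero_iff_ae_notMem.1 (measure_singleton z)] with y hyz
  exact im_green_eq_radialWave hn k hyz

lemma aestronglyMeasurable_im_green_mul (hn : n = 2 ∨ n = 3)
    (hqm : AEStronglyMeasurable q volume) :
    AEStronglyMeasurable (fun y => ((green k y z).im : ℂ) * q y) volume := by
  have hw := (contDiff_radialWave (k := k) (c := greenConst n k) (by omega) z).continuous
  refine ((Complex.continuous_ofReal.comp hw).aestronglyMeasurable.congr ?_).mul hqm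
  exact (im_green_ae_eq_radialWave hn k z).symm.fun_comp Complex.ofReal

lemma LocallyEssBounded.im_green_mul (hn : n = 2 ∨ n = 3) (hq : LocallyEssBounded q) :
    LocallyEssBounded fun y => ((green k y z).im : ℂ) * q y := by
  have hw := (contDiff_radialWave (k := k) (c := greenConst n k) (by omega) z).continuous
  refine ((locallyEssBounded_of_continuous (Complex.continuous_ofReal.comp hw)).congr ?_).mul hq
  exact (im_green_ae_eq_radialWave hn k z).symm.fun_comp Complex.ofReal

lemma IsDistribLaplacian.isWeakDivergence_greenField (hn : n = 2 ∨ n = 3) (hv : ContDiff ℝ 1 v)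
    (hq : LocallyIntegrable q)
    (hvq : IsDistribLaplacian v fun x => -(k : ℂ) ^ 2 * v x - q x) :
    IsWeakDivergence (greenField k z v) fun y => ((green k y z).im : ℂ) * q y := by
  have hw := contDiff_radialWave (k := k) (c := greenConst n k) (by omega) z
  intro φ hφ hφc
  refine (hvq.isWeakDivergence hv
    ((hv.continuous.const_mul (-(k : ℂ) ^ 2)).locallyIntegrable.sub hq) hw φ hφ hφc).trans ?_
  congr 1
  refine integral_congr_ae ?_
  filter_upwards [im_green_ae_eq_radialWave hn k z] with x hx
  rw [hx, laplace_radialWave (by omega), Pi.sub_apply]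
  push_cast
  ring

theorem IsBoundedLipschitz.integral_boundaryIntegrand (hn : n = 2 ∨ n = 3)
    (hΩ : IsBoundedLipschitz Ω) (hv : ContDiff ℝ 1 v) (hqm : AEStronglyMeasurable q volume)
    (hq : LocallyEssBounded q) (hvq : IsDistribLaplacian v fun x => -(k : ℂ) ^ 2 * v x - q x) :
    ∫ x, boundaryIntegrand k Ω v z x ∂surfaceMeasure Ω =
      ∫ y in Ω, ((green k y z).im : ℂ) * q y := by
  rw [integral_congr_ae (boundaryIntegrand_ae_eq_sum_greenField hn)]
  exact hΩ.integral_sum_mul_outwardNormal (fun i => continuous_greenField (by omega) hv i)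
    (aestronglyMeasurable_im_green_mul hn hqm) (hq.im_green_mul hn)
    (hvq.isWeakDivergence_greenField hn hv (hq.locallyIntegrable hqm))

end BoundaryIntegral

namespace IsWeakHelmholtzSolution

variable {n : ℕ} {k : ℝ} {Ω D : Set (EuclideanSpace ℝ (Fin n))}
  {η u usc : EuclideanSpace ℝ (Fin n) → ℂ}

lemma integrableOn_im_green_mul (hn : n = 2 ∨ n = 3) (hD : Bornology.IsBounded D)
    (hη : MemLp η ⊤) (hu : IsWeakHelmholtzSolution k η u) (z : EuclideanSpace ℝ (Fin n)) :
    IntegrableOn (fun y => ((green k y z).im : ℂ) * η y * u y) D := by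
  have hb : LocallyEssBounded fun y => η y * u y :=
    (locallyEssBounded_of_memLp_top hη).mul (hu.locallyEssBounded (by omega) (by omega) hη)
  have hm : AEStronglyMeasurable (fun y => η y * u y) volume :=
    hη.1.mul hu.1.locallyIntegrable.aestronglyMeasurable
  simp_rw [mul_assoc]
  exact (hb.im_green_mul hn).integrableOn (aestronglyMeasurable_im_green_mul hn hm) hD

theorem integral_boundaryIntegrand_rep (hn : n = 2 ∨ n = 3) (hΩ : IsBoundedLipschitz Ω)
    (hDΩ : D ⊆ Ω) (hη : MemLp η ⊤) (hηD : ∀ᵐ x, x ∉ D → η x = 0)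
    {d : EuclideanSpace ℝ (Fin n)} (hd : ‖d‖ = 1)
    (hu : IsWeakHelmholtzSolution k η (totalField k d usc)) (z : EuclideanSpace ℝ (Fin n)) :
    ∫ x, boundaryIntegrand k Ω (rep usc) z x ∂surfaceMeasure Ω =
      (k : ℂ) ^ 2 * ∫ y in D, ((green k y z).im : ℂ) * η y * totalField k d usc y := by
  obtain ⟨hrep, hrepC⟩ := hu.contDiff_rep_scattered (by omega) (by omega) hη
  have hb : LocallyEssBounded fun y => (k : ℂ) ^ 2 * (η y * totalField k d usc y) :=
    (locallyEssBounded_of_continuous continuous_const).mul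
      ((locallyEssBounded_of_memLp_top hη).mul (hu.locallyEssBounded (by omega) (by omega) hη))
  have hm : AEStronglyMeasurable (fun y => (k : ℂ) ^ 2 * (η y * totalField k d usc y)) volume :=
    (hη.1.mul hu.1.locallyIntegrable.aestronglyMeasurable).const_mul _
  have hΔ : IsDistribLaplacian (rep usc) fun x =>
      -(k : ℂ) ^ 2 * rep usc x - (k : ℂ) ^ 2 * (η x * totalField k d usc x) :=
    (hu.isDistribLaplacian_scattered hd hη).congr hrep (hrep.mono fun x hx => by simp only [hx])
  have hsupport : ∫ y in Ω, ((green k y z).im : ℂ) * η y * totalField k d usc y =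
      ∫ y in D, ((green k y z).im : ℂ) * η y * totalField k d usc y := by
    refine setIntegral_eq_of_subset_of_ae_sdiff_eq_zero
      hΩ.isOpen.measurableSet.nullMeasurableSet hDΩ (hηD.mono fun x hx hxD => ?_)
    rw [hx hxD.2, mul_zero, zero_mul]
  rw [hΩ.integral_boundaryIntegrand hn hrepC hm hb hΔ, ← hsupport, ← integral_const_mul]
  congr 1 with y
  ring

end IsWeakHelmholtzSolution

lemma IsBoundedLipschitz.ae_eq_zero_of_notMem {n : ℕ} {D : Set (EuclideanSpace ℝ (Fin n))}
    {F : Type*} [Zero F] {η : EuclideanSpace ℝ (Fin n) → F} (hD : IsBoundedLipschitz D)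
    (hη : ∀ᵐ x, x ∉ closure D → η x = 0) : ∀ᵐ x, x ∉ D → η x = 0 := by
  filter_upwards [hη, measure_eq_zero_iff_ae_notMem.1 hD.volume_frontier] with x hx hfr hxD
  exact hx fun hcl => hfr ⟨hcl, by rwa [hD.isOpen.interior_eq]⟩

end Scattering

end

theorem mainTheorem3_general {n : ℕ} (hn : n = 2 ∨ n = 3) (k : ℝ) (_hk : 0 < k)
    (D Ω : Set (EuclideanSpace ℝ (Fin n))) (hΩ : IsBoundedLipschitz Ω) (hDΩ : D ⊆ Ω)
    (η : EuclideanSpace ℝ (Fin n) → ℂ) (hη : MemLp η ⊤ volume)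
    (hηD : ∀ᵐ x ∂volume, x ∉ D → η x = 0)
    (usc : Metric.sphere (0 : EuclideanSpace ℝ (Fin n)) 1 → EuclideanSpace ℝ (Fin n) → ℂ)
    (husc : ∀ d : Metric.sphere (0 : EuclideanSpace ℝ (Fin n)) 1,
      IsWeakHelmholtzSolution k η (totalField k d (usc d))) :
    (∀ d, usc d =ᵐ[volume] rep (usc d) ∧ ContDiff ℝ 1 (rep (usc d))) ∧
    (∀ z d, Integrable (boundaryIntegrand k Ω (rep (usc d)) z) (surfaceMeasure Ω) ∧
      IntegrableOn (fun y => ((green k y z).im : ℂ) * η y * totalField k d (usc d) y) D volume) ∧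
    (∀ z, imagingI2 k Ω usc z =
      ∫⁻ d, ‖(k : ℂ) ^ 2 *
          ∫ y in D, ((green k y z).im : ℂ) * η y * totalField k d (usc d) y‖ₑ ^ 2
        ∂(volume : Measure (EuclideanSpace ℝ (Fin n))).toSphere) ∧
    (∀ y z : EuclideanSpace ℝ (Fin n), y ≠ z →
      (n = 2 → (green k y z).im = 1 / 4 * besselJ0 (k * ‖z - y‖)) ∧
      (n = 3 → (green k y z).im = k / (4 * Real.pi) * Real.sinc (k * ‖z - y‖))) := by
  have hrep (d) : usc d =ᵐ[volume] rep (usc d) ∧ ContDiff ℝ 1 (rep (usc d)) :=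
    (husc d).contDiff_rep_scattered (by omega) (by omega) hη
  refine ⟨hrep, fun z d => ⟨?_, ?_⟩, fun z => ?_, fun y z hyz => ?_⟩
  · exact hΩ.integrable_boundaryIntegrand hn (hrep d).2
  · exact (husc d).integrableOn_im_green_mul hn (hΩ.isBounded.subset hDΩ) hη z
  · refine lintegral_congr fun d => ?_
    rw [(husc d).integral_boundaryIntegrand_rep hn hΩ hDΩ hη hηD (norm_eq_of_mem_sphere d) z]
  · rw [norm_sub_rev z y]
    exact ⟨fun h2 => im_green_eq_two h2 k y z, fun h3 => im_green_eq_three h3 k hyz⟩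

theorem mainTheorem3 {n : ℕ} (hn : n = 2 ∨ n = 3) (k : ℝ) (hk : 0 < k)
    (D Ω : Set (EuclideanSpace ℝ (Fin n)))
    (hD : IsBoundedLipschitz D) (hΩ : IsBoundedLipschitz Ω) (hDΩ : D ⊆ Ω)
    (η : EuclideanSpace ℝ (Fin n) → ℂ) (hη : MemLp η ⊤ volume)
    (hηD : ∀ᵐ x ∂volume, x ∉ closure D → η x = 0)
    (usc : Metric.sphere (0 : EuclideanSpace ℝ (Fin n)) 1 → EuclideanSpace ℝ (Fin n) → ℂ)
    (husc : ∀ d : Metric.sphere (0 : EuclideanSpace ℝ (Fin n)) 1, IsScatteredField k η d (usc d)) :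
    -- the scattered fields are `C¹` functions, so that the Cauchy data make sense pointwise
    (∀ d, usc d =ᵐ[volume] rep (usc d) ∧ ContDiff ℝ 1 (rep (usc d))) ∧
    -- the inner integrals exist
    (∀ z d, Integrable (boundaryIntegrand k Ω (rep (usc d)) z) (surfaceMeasure Ω) ∧
      IntegrableOn (fun y => ((green k y z).im : ℂ) * η y * totalField k d (usc d) y) D volume) ∧
    -- the representation of the imaging functional
    (∀ z, imagingI2 k Ω usc z =
      ∫⁻ d, ‖(k : ℂ) ^ 2 *
          ∫ y in D, ((green k y z).im : ℂ) * η y * totalField k d (usc d) y‖ₑ ^ 2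
        ∂(volume : Measure (EuclideanSpace ℝ (Fin n))).toSphere) ∧
    -- the imaginary part of the fundamental solution
    (∀ y z : EuclideanSpace ℝ (Fin n), y ≠ z →
      (n = 2 → (green k y z).im = 1 / 4 * besselJ0 (k * ‖z - y‖)) ∧
      (n = 3 → (green k y z).im = k / (4 * Real.pi) * Real.sinc (k * ‖z - y‖))) := by
  exact mainTheorem3_general hn k hk D Ω hΩ hDΩ η hη (hD.ae_eq_zero_of_notMem hηD) usc
    fun d => (husc d).weakSolution
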